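/- Let $(\mathbb X,d)$ be a complete separable metric space, let $\lambda$ be a locally finite and diffuse Borel measure on $\mathbb X$, and let $\varphi\colon\mathbb X^2\to[0,1]$ be measurable and symmetric with $\int\varphi(x,y)\,\lambda(dy)<\infty$ for $\lambda$-a.e. $x$. For $x\in\mathbb X$ let $\xi^x$ be the random connection model (RCM) based on $\eta+\delta_x$, where $\eta$ is a Poisson process on $\mathbb X$ with intensity measure $\lambda$: its vertices are the points of $\eta+\delta_x$, and distinct vertices $y,z$ are joined by an edge with probability $\varphi(y,z)$, independently for different pairs. For $n\in\mathbb N_0$ let $V^x_n$, $V^x_{\le n}$ and $V^x$ denote the sets (counting measures) of the vertices of $\xi^x$ at graph distance $n$ from $x$, at graph distance at most $n$ from $x$, and in the cluster (connected component) of $x$, respectively, and put $V^{x!}_{\le n}:=V^x_{\le n}-\delta_x$. We write $V^x_n(\xi)$ etc. for the same objects formed in a copy $\xi$ of $\xi^x$. Let $\mathbb N=\{1,2,\ldots\}$, $v\in\mathbb X$ and let $h\colon\mathbb X\to\mathbb N$ be measurable. Define a spatial branching process as follows. Put $W^{v,h}_0=\widetilde W^{v,h}_0=\delta_v$. Given the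 process up to generation $k\in\mathbb N_0$, let $\xi^k_x$, $x\in W^{v,h}_k$, be conditionally independent random graphs, where $\xi^k_x$ has the distribution of $\xi^x$, and put $$W^{v,h}_{k+1}=\int V^x_{h(x)}(\xi^k_x)\,W^{v,h}_k(dx),\qquad \widetilde W^{v,h}_{k+1}=\int V^{x!}_{\le h(x)}(\xi^k_x)\,W^{v,h}_k(dx).$$ Let $\widetilde W^{v,h}_{\le k}=\sum_{i=0}^k\widetilde W^{v,h}_i$ and $\widetilde W^{v,h}=\sum_{i=0}^\infty\widetilde W^{v,h}_i$, and write $n$ instead of $h$ in the upper index if $h\equiv n\in\mathbb N$. For random counting measures $\chi,\chi'$ on $\mathbb X$, $\chi\le_{st}\chi'$ means that $\mathbb E f(\chi)\le\mathbb E f(\chi')$ for all measurable increasing $f\ge 0$. Then, for every $v\in\mathbb X$: 1. $V^v\le_{st}\widetilde W^{v,h}$ for every measurable $h\colon\mathbb X\to\mathbb N$; 2. in particular, $V^v\le_{st}\widetilde W^{v,n}$ for every $n\in\mathbb N$; 3. $V^v_{\le kn}\le_{st}\widetilde W^{v,n}_{\le k}$ for all $n,k\in\mathbb N$. -/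

import Mathlib

open MeasureTheory ProbabilityTheory Set
open scoped ENNReal NNReal

noncomputable section

/-- `phi` is a connection function with respect to the measure `lam`: a measurable symmetric
function with values in `[0,1]` such that `∫ phi(x,y) lam(dy) < ∞` for `lam`-a.e. `x`. -/
structure IsConnectionFunction {X : Type*} [MeasurableSpace X] (lam : Measure X)
    (phi : X → X → ℝ) : Prop where
  measurable : Measurable (fun p : X × X => phi p.1 p.2)
  symm : ∀ x y, phi x y = phi y x
  mem_unit : ∀ x y, phi x y ∈ Set.Icc (0 : ℝ) 1
  integrable : ∀ᵐ x ∂lam, ∫⁻ y, ENNReal.ofReal (phi x y) ∂lam < ∞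

/-- `eta` is a Poisson process with intensity measure `lam`: `eta(B)` has a Poisson distribution
with parameter `lam(B)` (being a.s. infinite if `lam(B) = ∞`), and the values on finitely many
pairwise disjoint measurable sets are independent. -/
structure IsPoissonProcess {X Ω : Type*} [MeasurableSpace X] [MeasurableSpace Ω]
    (lam : Measure X) (P : Measure Ω) (eta : Ω → Measure X) : Prop where
  measurable : Measurable eta
  law : ∀ B : Set X, MeasurableSet B → lam B ≠ ∞ →
    P.map (fun ω => eta ω B) =
      (poissonMeasure (lam B).toNNReal).map (fun n : ℕ => (n : ℝ≥0∞))
  law_top : ∀ B : Set X, MeasurableSet B → lam B = ∞ → ∀ᵐ ω ∂P, eta ω B = ∞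
  indep : ∀ (n : ℕ) (B : Fin n → Set X), (∀ i, MeasurableSet (B i)) →
    Pairwise (fun i j => Disjoint (B i) (B j)) →
    iIndepFun (fun (i : Fin n) (ω : Ω) => eta ω (B i)) P

/-- The data from which a random connection model with one additional vertex is built:
the number `|η| ∈ ℕ ∪ {∞}` of points of a point process `η`, a sequence whose first `|η|` entries
enumerate the points of `η`, and one mark `Z m n` for every pair `m < n`. Vertices will be
numbered as follows: `0` is the additional vertex, `m + 1` is the `m`-th point of `η`. -/
abbrev Config (X : Type*) : Type _ :=
  ℕ∞ × (ℕ → X) × ({p : ℕ × ℕ // p.1 < p.2} → ℝ)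

namespace Config

variable {X : Type*}

/-- The number of points of `η`. -/
def count (c : Config X) : ℕ∞ := c.1

/-- The enumeration of the points of `η`; only the entries with index `< count` matter. -/
def points (c : Config X) : ℕ → X := c.2.1

/-- The marks deciding about the edges. -/
def marks (c : Config X) : {p : ℕ × ℕ // p.1 < p.2} → ℝ := c.2.2

/-- The counting measure `η`, the sum of the Dirac measures at its points. -/
def eta [MeasurableSpace X] (c : Config X) : Measure X :=
  Measure.sum (fun m : {m : ℕ // (m : ℕ∞) < c.count} => Measure.dirac (c.points m))

/-- The location of the vertex with number `m`, when the additional vertex is located at `x`. -/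
def loc (x : X) (c : Config X) : ℕ → X
  | 0 => x
  | m + 1 => c.points m

/-- The graph on the points of `η + δ_x`, in terms of the numbers `0, 1, …, |η|` of the vertices:
`m < n` are adjacent if and only if `Z m n ≤ phi(x_m, x_n)`. Numbers greater than `|η|` do not
represent vertices; they are isolated. -/
def graph (phi : X → X → ℝ) (x : X) (c : Config X) : SimpleGraph ℕ :=
  SimpleGraph.fromRel fun m n =>
    ∃ hmn : m < n, (n : ℕ∞) ≤ c.count ∧ c.marks ⟨(m, n), hmn⟩ ≤ phi (c.loc x m) (c.loc x n)

/-- The counting measure of the locations of the vertices whose numbers belong to `S`. -/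
def locMeasure [MeasurableSpace X] (x : X) (c : Config X) (S : Set ℕ) : Measure X :=
  Measure.sum (fun m : S => Measure.dirac (c.loc x m))

/-- `V^x`: the vertices of the cluster of `x`. -/
def cluster [MeasurableSpace X] (phi : X → X → ℝ) (x : X) (c : Config X) : Measure X :=
  c.locMeasure x {m | (c.graph phi x).Reachable 0 m}

/-- `V^x_{≤ n}`: the vertices at graph distance at most `n` from `x`. -/
def clusterLE [MeasurableSpace X] (phi : X → X → ℝ) (x : X) (c : Config X) (n : ℕ) : Measure X :=
  c.locMeasure x {m | (c.graph phi x).edist 0 m ≤ n}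

/-- `V^{x!}_{≤ n} = V^x_{≤ n} - δ_x`: the vertices different from `x` at graph distance at
most `n` from `x`. -/
def clusterLE' [MeasurableSpace X] (phi : X → X → ℝ) (x : X) (c : Config X) (n : ℕ) :
    Measure X :=
  c.locMeasure x {m | m ≠ 0 ∧ (c.graph phi x).edist 0 m ≤ n}

end Config

/-- The random data `c` turn `Config.graph` into the random connection model based on `η + δ_x`,
for `η` a Poisson process with intensity measure `lam`: the marks are independent, uniformly
distributed on `[0,1]`, and independent of the enumerated Poisson process. -/
structure IsRCM {X Ω : Type*} [MeasurableSpace X] [MeasurableSpace Ω]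
    (lam : Measure X) (P : Measure Ω) (c : Ω → Config X) : Prop where
  measurable : Measurable c
  poisson : IsPoissonProcess lam P (fun ω => (c ω).eta)
  marks_uniform : ∀ p, P.map (fun ω => (c ω).marks p) = volume.restrict (Set.Icc (0 : ℝ) 1)
  marks_indep : iIndepFun (fun p (ω : Ω) => (c ω).marks p) P
  points_indep_marks : IndepFun (fun ω => ((c ω).count, (c ω).points)) (fun ω => (c ω).marks) P

namespace Branching

variable {X : Type*}

/-- The location of an individual of the spatial branching process. Individuals are labelled by
finite sequences: `[]` is the ancestor, located at `v`, and `m :: u` is the child of `u` given by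
the vertex number `m` of the graph run by `u`. The data `b u` belong to the individual `u`. -/
def pos (v : X) (b : List ℕ → Config X) : List ℕ → X
  | [] => v
  | m :: u => (b u).loc (pos v b u) m

/-- The label `u` belongs to an individual of the process. The children of an individual located
at `x` are the vertices at graph distance exactly `h x` from `x` in the graph it runs. -/
def IsIndividual (phi : X → X → ℝ) (h : X → ℕ) (v : X) (b : List ℕ → Config X) :
    List ℕ → Prop
  | [] => True
  | m :: u => IsIndividual phi h v b u ∧
      ((b u).graph phi (pos v b u)).edist 0 m = (h (pos v b u) : ℕ∞)

/-- `W^{v,h}_k`: the individuals of the `k`-th generation. -/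
def W [MeasurableSpace X] (phi : X → X → ℝ) (h : X → ℕ) (v : X) (b : List ℕ → Config X)
    (k : ℕ) : Measure X :=
  Measure.sum (fun u : {u : List ℕ // u.length = k ∧ IsIndividual phi h v b u} =>
    Measure.dirac (pos v b u))

/-- `W̃^{v,h}_k`: it is `δ_v` for `k = 0`, and `W̃^{v,h}_{k+1}` is the sum of
`V^{x!}_{≤ h(x)}` over the individuals of the `k`-th generation, `x` being the location. -/
def Wtilde [MeasurableSpace X] (phi : X → X → ℝ) (h : X → ℕ) (v : X) (b : List ℕ → Config X) :
    ℕ → Measure X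
  | 0 => Measure.dirac v
  | k + 1 =>
    Measure.sum (fun u : {u : List ℕ // u.length = k ∧ IsIndividual phi h v b u} =>
      (b u).clusterLE' phi (pos v b u) (h (pos v b u)))

/-- `W̃^{v,h}_{≤ k}`. -/
def WtildeLE [MeasurableSpace X] (phi : X → X → ℝ) (h : X → ℕ) (v : X)
    (b : List ℕ → Config X) (k : ℕ) : Measure X :=
  ∑ i ∈ Finset.range (k + 1), Wtilde phi h v b i

/-- `W̃^{v,h}`, the total progeny. -/
def WtildeTotal [MeasurableSpace X] (phi : X → X → ℝ) (h : X → ℕ) (v : X)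
    (b : List ℕ → Config X) : Measure X :=
  Measure.sum (fun i : ℕ => Wtilde phi h v b i)

end Branching

/-- The data driving the spatial branching process: independent random connection models, one for
every label. -/
structure IsBranchingInput {X Ω : Type*} [MeasurableSpace X] [MeasurableSpace Ω]
    (lam : Measure X) (Q : Measure Ω) (b : List ℕ → Ω → Config X) : Prop where
  rcm : ∀ u, IsRCM lam Q (b u)
  indep : iIndepFun b Q

/-- Finite or countable sums of Dirac measures. -/
def countingMeasures (X : Type*) [MeasurableSpace X] : Set (Measure X) :=
  {mu | ∃ (S : Set ℕ) (x : ℕ → X), mu = Measure.sum (fun i : S => Measure.dirac (x i))}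

/-- Stochastic domination `V ≤_st W` of random counting measures: `E f(V) ≤ E f(W)` for all
measurable increasing functions `f ≥ 0` of a counting measure. -/
def StochLE {X Ω Ω' : Type*} [MeasurableSpace X] [MeasurableSpace Ω] [MeasurableSpace Ω']
    (P : Measure Ω) (Q : Measure Ω') (V : Ω → Measure X) (W : Ω' → Measure X) : Prop :=
  Measurable V ∧ Measurable W ∧
    ∀ f : Measure X → ℝ≥0∞, Measurable f → MonotoneOn f (countingMeasures X) →
      ∫⁻ ω, f (V ω) ∂P ≤ ∫⁻ ω, f (W ω) ∂Q

end

/-!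
The cluster of `v` is explored generation by generation, and the branching process arises by
forgetting, again and again, which points have already been used up.

*Exploration as a Markov chain.* Suppose that the available points form a Poisson process with
density `ρ` with respect to `lam`, and that the marks of the pairs containing an available point
have not been looked at. Each available point `z` is joined to the current generation `A` with
probability `1 - avoid A z`, independently of the others. By the colouring theorem for Poisson
processes (`CondPoisson.colour`) the points of the next generation form a Poisson process with
density `ρ (1 - avoid A)`, and the remaining points form an independent one with density
`ρ (avoid A)`; the marks among them are still fresh. Hence the exploration has the law of an
explicit chain of Poisson processes (`CondPoisson.explore`, `IsRCMLaw.explore`). Poisson processes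
enter through their Laplace functionals only, and these determine all joint laws needed
(`MeasureTheory.Measure.ext_of_laplace`).

*Growth.* `growth f s ρ a D` is the expectation of `f (D + χ)`, where `χ` are the points found in
`s` steps when the available points have density `ρ` and each of them avoids the source with
probability `a`. It satisfies a first step recursion (`IsRCMLaw.growth_succ`), and it increases with
`ρ` and decreases with `a`. This gives two comparisons for increasing `f`. After `j + 1` steps, the
exploration may be restarted from the last generation with all points of a new Poisson process
available (`IsRCMLaw.growth_add_le`). And two sources together produce at most as much as two
independent explorations (`IsRCMLaw.growth_mul_le`): the points hit by two sources are those hit by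
the first one plus an independent Poisson process of points hit by the second one only, and the
latter process is dominated by the one of all points hit by the second source.

*Comparison.* Let `1 ≤ n ≤ h`. By induction on `k`, the ball of radius `k * n` around `y` is
dominated by `k` generations of the branching process started at `y`
(`IsRCMLaw.growth_le_progeny`). Indeed, `(k + 1) * n ≤ k * n + h y`, so that after `h y` steps
the exploration is restarted from the vertices at distance `h y`; by subadditivity these vertices
can be treated as separate sources, and by the induction hypothesis each of them is dominated by the
branching process of a child. There may be infinitely many such vertices, which is why the induction
works with functions `f` that are continuous along increasing sequences (`IsTest`). Taking `h ≡ n`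
gives the comparison of balls, and `n = 1` that of clusters, as the cluster is the union of the
balls.

*From test functions to all increasing functions.* By the layer-cake formula it suffices to
consider an increasing event `U`. Such an event is determined by the values of the measure on a
countable algebra of sets; up to a small probability, the values lie in the image of a compact
set, which is a decreasing limit of open increasing conditions on finitely many values, whose
indicators are test functions (`measure_le_of_isTest`). This uses that a counting measure which
dominates an element of `U` on the algebra lies in `U` as well: it has the same values on the
algebra as a counting measure that dominates the element of `U` everywhere
(`exists_countingMeasures_ge`).
-/

noncomputable section

universe u

/-! ### The exponential of a negative extended number -/

/-- The function `x ↦ exp (-x)` on `[0,∞]`, with values in `[0,1]` and `exp (-∞) = 0`. -/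
def nexp (x : ℝ≥0∞) : ℝ≥0∞ := EReal.exp (-(x : EReal))

/-- The inverse of `nexp` on `[0,1]`. -/
def nlog (p : ℝ≥0∞) : ℝ≥0∞ := (-ENNReal.log p).toENNReal

@[simp] lemma nexp_zero : nexp 0 = 1 := by simp [nexp]

@[simp] lemma nexp_top : nexp ∞ = 0 := by simp [nexp]

lemma nexp_add (x y : ℝ≥0∞) : nexp (x + y) = nexp x * nexp y := by
  unfold nexp
  rw [← EReal.exp_add, EReal.coe_ennreal_add, EReal.neg_add, sub_eq_add_neg]
  · left; simp
  · right; simp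

lemma nexp_antitone : Antitone nexp := fun x y h => by
  unfold nexp
  exact EReal.exp_monotone (EReal.neg_le_neg_iff.2 (by exact_mod_cast h))

lemma nexp_le_one (x : ℝ≥0∞) : nexp x ≤ 1 := nexp_zero ▸ nexp_antitone (zero_le (a := x))

lemma nexp_ne_top (x : ℝ≥0∞) : nexp x ≠ ∞ := ((nexp_le_one x).trans_lt ENNReal.one_lt_top).ne

@[fun_prop] lemma continuous_nexp : Continuous nexp := by
  unfold nexp
  exact ENNReal.continuous_exp.comp (continuous_neg.comp continuous_coe_ennreal_ereal)

@[fun_prop] lemma measurable_nexp : Measurable nexp := continuous_nexp.measurable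

@[fun_prop] lemma measurable_nlog : Measurable nlog := by
  unfold nlog; fun_prop

lemma nexp_nlog {p : ℝ≥0∞} (hp : p ≤ 1) : nexp (nlog p) = p := by
  unfold nexp nlog
  rw [EReal.coe_toENNReal, neg_neg, ENNReal.exp_log]
  simpa using hp

lemma nlog_nexp (x : ℝ≥0∞) : nlog (nexp x) = x := by
  unfold nexp nlog
  simp

lemma nexp_injective : Function.Injective nexp := Function.LeftInverse.injective nlog_nexp

lemma nexp_ofReal {x : ℝ} (hx : 0 ≤ x) :
    nexp (ENNReal.ofReal x) = ENNReal.ofReal (Real.exp (-x)) := by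
  unfold nexp
  rw [EReal.coe_ennreal_ofReal, max_eq_left hx, ← EReal.coe_neg, EReal.exp_coe]

lemma nexp_sum {ι : Type*} (s : Finset ι) (f : ι → ℝ≥0∞) :
    nexp (∑ i ∈ s, f i) = ∏ i ∈ s, nexp (f i) := by
  classical
  induction s using Finset.induction_on with
  | empty => simp
  | insert i s hi ih => rw [Finset.sum_insert hi, Finset.prod_insert hi, nexp_add, ih]

lemma nexp_nat_mul (n : ℕ) (x : ℝ≥0∞) : nexp (n * x) = nexp x ^ n := by
  have := nexp_sum (Finset.range n) (fun _ => x)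
  simpa using this

lemma nexp_tsum_tendsto (f : ℕ → ℝ≥0∞) :
    Filter.Tendsto (fun n => ∏ i ∈ Finset.range n, nexp (f i)) Filter.atTop
      (nhds (nexp (∑' i, f i))) := by
  simp_rw [← nexp_sum]
  exact (continuous_nexp.tendsto _).comp ENNReal.summable.hasSum.tendsto_sum_nat

/-! ### Measures are determined by a multiplicative class of functions -/

/-- Two finite measures agree if they assign the same integrals to the members of a class of
`[0,1]`-valued functions that is closed under products and generates the `σ`-algebra. On finitely
many functions of the class this is the Stone-Weierstrass theorem on a cube. -/
theorem MeasureTheory.Measure.ext_of_multiplicative {E : Type*} [mE : MeasurableSpace E]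
    {C : Set (E → ℝ≥0∞)} (hmeas : ∀ h ∈ C, Measurable h) (hle : ∀ h ∈ C, ∀ x, h x ≤ 1)
    (hone : (fun _ => 1) ∈ C) (hmul : ∀ h ∈ C, ∀ h' ∈ C, (fun x => h x * h' x) ∈ C)
    (hgen : mE ≤ ⨆ h ∈ C, MeasurableSpace.comap h inferInstance)
    {μ ν : Measure E} [IsFiniteMeasure μ] [IsFiniteMeasure ν]
    (heq : ∀ h ∈ C, ∫⁻ x, h x ∂μ = ∫⁻ x, h x ∂ν) : μ = ν := by
  have huniv : μ univ = ν univ := by simpa using heq _ hone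
  let m : (E → ℝ≥0∞) → MeasurableSpace E := fun h => MeasurableSpace.comap h inferInstance
  have hgen' : mE = MeasurableSpace.generateFrom
      (piiUnionInter (fun h => {s | MeasurableSet[m h] s}) C) := by
    rw [generateFrom_piiUnionInter_measurableSet m C]
    refine le_antisymm hgen ?_
    refine iSup₂_le fun h hh => ?_
    exact (hmeas h hh).comap_le
  refine ext_of_generate_finite _ hgen'
    (isPiSystem_piiUnionInter _ (fun h => @MeasurableSpace.isPiSystem_measurableSet _ (m h)) _)
    ?_ huniv
  rintro A ⟨s, hsC, f, hf, rfl⟩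
  -- The functions in `s`, combined to a map into a cube.
  have hval : ∀ (h : s) (x : E), (h.1 x).toReal ∈ Icc (0 : ℝ) 1 := fun h x =>
    ⟨ENNReal.toReal_nonneg, by
      have := ENNReal.toReal_mono ENNReal.one_ne_top (hle h.1 (hsC h.2) x)
      simpa using this⟩
  let Φ : E → (s → Icc (0 : ℝ) 1) := fun x h => ⟨(h.1 x).toReal, hval h x⟩
  have hΦ : Measurable Φ := measurable_pi_lambda _ fun h =>
    ((hmeas h.1 (hsC h.2)).ennreal_toReal).subtype_mk
  have key : μ.map Φ = ν.map Φ := by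
    let coord : s → BoundedContinuousFunction (s → Icc (0 : ℝ) 1) ℝ := fun h =>
      BoundedContinuousFunction.mkOfCompact
        ⟨fun y => (y h : ℝ), continuous_subtype_val.comp (continuous_apply h)⟩
    let A₀ : Subalgebra ℝ (BoundedContinuousFunction (s → Icc (0 : ℝ) 1) ℝ) :=
      Algebra.adjoin ℝ (Set.range coord)
    let A : StarSubalgebra ℝ (BoundedContinuousFunction (s → Icc (0 : ℝ) 1) ℝ) :=
      { A₀ with
        star_mem' := by
          intro g hg
          have : star g = g := by ext y; simp
          rw [this]; exact hg }
    refine ext_of_forall_mem_subalgebra_integral_eq_of_polish (A := A) (𝕜 := ℝ) ?_ ?_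
    · intro y z hyz
      obtain ⟨h, hh⟩ := Function.ne_iff.1 hyz
      refine ⟨fun y => (y h : ℝ), ⟨BoundedContinuousFunction.toContinuousMapStarₐ ℝ (coord h),
        ⟨coord h, Algebra.subset_adjoin ⟨h, rfl⟩, rfl⟩, rfl⟩, ?_⟩
      exact fun h' => hh (Subtype.ext h')
    · intro g hg
      have hg' : g ∈ Submodule.span ℝ (Submonoid.closure (Set.range coord) :
          Set (BoundedContinuousFunction (s → Icc (0 : ℝ) 1) ℝ)) := by
        rw [← Algebra.adjoin_eq_span]; exact hg
      clear hg
      induction hg' using Submodule.span_induction with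
      | mem g hg =>
        have : ∃ h ∈ C, ∀ x, g (Φ x) = (h x).toReal := by
          refine Submonoid.closure_induction
            (motive := fun g _ => ∃ h ∈ C, ∀ x, g (Φ x) = (h x).toReal)
            ?_ ?_ ?_ hg
          · rintro _ ⟨h, rfl⟩
            exact ⟨h.1, hsC h.2, fun x => rfl⟩
          · exact ⟨_, hone, fun x => by simp⟩
          · rintro g g' _ _ ⟨h, hh, e⟩ ⟨h', hh', e'⟩
            exact ⟨_, hmul h hh h' hh', fun x => by simp [e, e']⟩
        obtain ⟨h, hh, e⟩ := this
        rw [integral_map hΦ.aemeasurable g.continuous.aestronglyMeasurable,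
          integral_map hΦ.aemeasurable g.continuous.aestronglyMeasurable]
        simp_rw [e]
        rw [integral_toReal (hmeas h hh).aemeasurable
            (Filter.Eventually.of_forall fun x => (hle h hh x).trans_lt ENNReal.one_lt_top),
          integral_toReal (hmeas h hh).aemeasurable
            (Filter.Eventually.of_forall fun x => (hle h hh x).trans_lt ENNReal.one_lt_top),
          heq h hh]
      | zero => simp
      | add g g' hg hg' ih ih' =>
        have i1 := fun (κ : Measure (s → Icc (0 : ℝ) 1)) [IsFiniteMeasure κ] => g.integrable κ
        have i2 := fun (κ : Measure (s → Icc (0 : ℝ) 1)) [IsFiniteMeasure κ] => g'.integrable κ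
        simp only [BoundedContinuousFunction.coe_add, Pi.add_apply]
        rw [integral_add (i1 _) (i2 _), integral_add (i1 _) (i2 _), ih, ih']
      | smul r g hg ih =>
        simp only [BoundedContinuousFunction.coe_smul]
        rw [integral_smul, integral_smul, ih]
  have hA : ∃ B : Set (s → Icc (0 : ℝ) 1), MeasurableSet B ∧ ⋂ h ∈ s, f h = Φ ⁻¹' B := by
    choose! t ht htf using fun h (hh : h ∈ s) => (hf h hh : ∃ t, MeasurableSet t ∧ h ⁻¹' t = f h)
    refine ⟨⋂ h : s, (fun y => ENNReal.ofReal (y h : ℝ)) ⁻¹' (t h.1),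
      MeasurableSet.iInter fun h => ?_, ?_⟩
    · have h1 : Measurable fun y : s → Icc (0 : ℝ) 1 => ENNReal.ofReal (y h : ℝ) := by fun_prop
      refine h1 ?_
      exact ht h.1 h.2
    · ext x
      simp only [mem_iInter, mem_preimage, Subtype.forall]
      refine forall₂_congr fun h hh => ?_
      rw [← htf h hh, mem_preimage]
      show _ ↔ ENNReal.ofReal ((h x).toReal) ∈ t h
      rw [ENNReal.ofReal_toReal ((hle h (hsC hh) x).trans_lt ENNReal.one_lt_top).ne]
  obtain ⟨B, hB, e⟩ := hA
  rw [e, ← Measure.map_apply hΦ hB, ← Measure.map_apply hΦ hB, key]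

/-! ### Laplace functionals of pairs of random measures -/

@[fun_prop] lemma Measurable.lintegral_measure {α X : Type*} [MeasurableSpace α] [MeasurableSpace X]
    {f : α → Measure X} (hf : Measurable f) {g : X → ℝ≥0∞} (hg : Measurable g) :
    Measurable fun a => ∫⁻ x, g x ∂f a :=
  (Measure.measurable_lintegral hg).comp hf

/-- The joint law of a random element `θ` and two random measures `χ₁, χ₂` is determined by the
integrals of `1_B(θ) exp(-∫ g₁ dχ₁) exp(-∫ g₂ dχ₂)`. -/
theorem MeasureTheory.Measure.ext_of_laplace {Θ X : Type*} [MeasurableSpace Θ] [MeasurableSpace X]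
    {m₁ m₂ : Measure (Θ × Measure X × Measure X)} [IsFiniteMeasure m₁] [IsFiniteMeasure m₂]
    (h : ∀ B : Set Θ, MeasurableSet B → ∀ g₁ g₂ : X → ℝ≥0∞, Measurable g₁ → Measurable g₂ →
      ∫⁻ p, B.indicator 1 p.1 * (nexp (∫⁻ x, g₁ x ∂p.2.1) * nexp (∫⁻ x, g₂ x ∂p.2.2)) ∂m₁ =
      ∫⁻ p, B.indicator 1 p.1 * (nexp (∫⁻ x, g₁ x ∂p.2.1) * nexp (∫⁻ x, g₂ x ∂p.2.2)) ∂m₂) :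
    m₁ = m₂ := by
  let F : Set Θ → (X → ℝ≥0∞) → (X → ℝ≥0∞) → Θ × Measure X × Measure X → ℝ≥0∞ := fun B g₁ g₂ p =>
    B.indicator 1 p.1 * (nexp (∫⁻ x, g₁ x ∂p.2.1) * nexp (∫⁻ x, g₂ x ∂p.2.2))
  have hF : ∀ B, MeasurableSet B → ∀ g₁ g₂, Measurable g₁ → Measurable g₂ →
      Measurable (F B g₁ g₂) := by
    intro B hB g₁ g₂ h₁ h₂
    have a1 : Measurable fun p : Θ × Measure X × Measure X => B.indicator (1 : Θ → ℝ≥0∞) p.1 :=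
      (measurable_one.indicator hB).comp measurable_fst
    have a2 := Measurable.lintegral_measure
      (show Measurable fun p : Θ × Measure X × Measure X => p.2.1 by fun_prop) h₁
    have a3 := Measurable.lintegral_measure
      (show Measurable fun p : Θ × Measure X × Measure X => p.2.2 by fun_prop) h₂
    exact a1.mul ((measurable_nexp.comp a2).mul (measurable_nexp.comp a3))
  let C : Set (Θ × Measure X × Measure X → ℝ≥0∞) :=
    {f | ∃ B g₁ g₂, MeasurableSet B ∧ Measurable g₁ ∧ Measurable g₂ ∧ f = F B g₁ g₂}
  refine Measure.ext_of_multiplicative (C := C) ?_ ?_ ?_ ?_ ?_ ?_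
  · rintro _ ⟨B, g₁, g₂, hB, h₁, h₂, rfl⟩
    exact hF B hB g₁ g₂ h₁ h₂
  · rintro _ ⟨B, g₁, g₂, hB, h₁, h₂, rfl⟩ p
    have : B.indicator (1 : Θ → ℝ≥0∞) p.1 ≤ 1 := indicator_le_self' (by simp) _
    exact mul_le_one' this (mul_le_one' (nexp_le_one _) (nexp_le_one _))
  · exact ⟨univ, 0, 0, .univ, measurable_zero, measurable_zero, by ext p; simp [F]⟩
  · rintro _ ⟨B, g₁, g₂, hB, h₁, h₂, rfl⟩ _ ⟨B', g₁', g₂', hB', h₁', h₂', rfl⟩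
    refine ⟨B ∩ B', g₁ + g₁', g₂ + g₂', hB.inter hB', h₁.add h₁', h₂.add h₂', ?_⟩
    ext p
    simp only [F, Pi.add_apply]
    rw [lintegral_add_left h₁, lintegral_add_left h₂, nexp_add, nexp_add, Set.inter_indicator_one]
    simp only [Pi.mul_apply]
    ring
  · set G : MeasurableSpace (Θ × Measure X × Measure X) :=
      ⨆ h ∈ C, MeasurableSpace.comap h inferInstance with hG
    have hmeas : ∀ f ∈ C, @Measurable _ _ G _ f := fun f hf =>
      (comap_measurable f).mono (le_iSup₂_of_le f hf le_rfl) le_rfl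
    have m1 : @Measurable _ _ G _ (fun p : Θ × Measure X × Measure X => p.1) := by
      intro B hB
      have h1 := hmeas (F B 0 0) ⟨B, 0, 0, hB, measurable_zero, measurable_zero, rfl⟩
        (measurableSet_singleton 1)
      convert h1 using 1
      ext p
      by_cases hp : p.1 ∈ B <;> simp [F, hp]
    have m2 : @Measurable _ _ G _ (fun p : Θ × Measure X × Measure X => p.2.1) := by
      refine @Measure.measurable_of_measurable_coe _ _ _ G _ fun B hB => ?_
      have h1 := @Measurable.comp _ _ _ G _ _ _ _ measurable_nlog
        (hmeas (F univ (B.indicator 1) 0) ⟨univ, B.indicator 1, 0, .univ,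
        measurable_one.indicator hB, measurable_zero, rfl⟩)
      convert h1 using 1
      ext p
      simp [F, lintegral_indicator_one hB, nlog_nexp]
    have m3 : @Measurable _ _ G _ (fun p : Θ × Measure X × Measure X => p.2.2) := by
      refine @Measure.measurable_of_measurable_coe _ _ _ G _ fun B hB => ?_
      have h1 := @Measurable.comp _ _ _ G _ _ _ _ measurable_nlog
        (hmeas (F univ 0 (B.indicator 1)) ⟨univ, 0, B.indicator 1, .univ,
        measurable_zero, measurable_one.indicator hB, rfl⟩)
      convert h1 using 1
      ext p
      simp [F, lintegral_indicator_one hB, nlog_nexp]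
    have m5 : @Measurable _ _ G _ (fun p : Θ × Measure X × Measure X => p.2) :=
      Measurable.prodMk (m := G) m2 m3
    have m4 := Measurable.prodMk (m := G) m1 m5
    exact fun A hA => m4 hA
  · rintro _ ⟨B, g₁, g₂, hB, h₁, h₂, rfl⟩
    exact h B hB g₁ g₂ h₁ h₂

/-! ### Resampling in infinite product measures -/

section Product

open Classical in
/-- Resampling the coordinates outside of `J` does not change an infinite product measure. -/
theorem MeasureTheory.Measure.infinitePi_map_piecewise {ι : Type*} {E : ι → Type*}
    [∀ i, MeasurableSpace (E i)] (μ : ∀ i, Measure (E i)) [∀ i, IsProbabilityMeasure (μ i)]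
    (J : Set ι) :
    ((Measure.infinitePi μ).prod (Measure.infinitePi μ)).map (fun p => J.piecewise p.1 p.2) =
      Measure.infinitePi μ := by
  have hm : Measurable fun p : (∀ i, E i) × (∀ i, E i) => J.piecewise p.1 p.2 := by
    refine measurable_pi_lambda _ fun i => ?_
    by_cases hi : i ∈ J
    · simp only [Set.piecewise, hi, if_true]; fun_prop
    · simp only [Set.piecewise, hi, if_false]; fun_prop
  refine Measure.eq_infinitePi _ fun s t ht => ?_
  rw [Measure.map_apply hm (.pi s.countable_toSet fun i _ => ht i)]
  have : (fun p : (∀ i, E i) × (∀ i, E i) => J.piecewise p.1 p.2) ⁻¹' (Set.pi s t) =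
      (Set.pi (s.filter (· ∈ J)) t) ×ˢ (Set.pi (s.filter (· ∉ J)) t) := by
    ext p
    simp only [mem_preimage, Set.mem_pi, mem_prod, Finset.mem_coe, Finset.mem_filter]
    constructor
    · intro h
      refine ⟨fun i hi => ?_, fun i hi => ?_⟩
      · simpa [Set.piecewise, hi.2] using h i hi.1
      · simpa [Set.piecewise, hi.2] using h i hi.1
    · rintro ⟨h1, h2⟩ i hi
      by_cases hJ : i ∈ J
      · simpa [Set.piecewise, hJ] using h1 i ⟨hi, hJ⟩
      · simpa [Set.piecewise, hJ] using h2 i ⟨hi, hJ⟩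
  rw [this, Measure.prod_prod, Measure.infinitePi_pi _ (fun i _ => ht i),
    Measure.infinitePi_pi _ (fun i _ => ht i), Finset.prod_filter_mul_prod_filter_not]

open Classical in
/-- In an integral over an infinite product space, the coordinates outside of `J` may be replaced by
an independent copy. -/
theorem MeasureTheory.Measure.lintegral_infinitePi_piecewise {ι : Type*} {E : ι → Type*}
    [∀ i, MeasurableSpace (E i)] (μ : ∀ i, Measure (E i)) [∀ i, IsProbabilityMeasure (μ i)]
    (J : Set ι) {Φ : (∀ i, E i) → ℝ≥0∞} (hΦ : Measurable Φ) :
    ∫⁻ b, Φ b ∂Measure.infinitePi μ =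
      ∫⁻ b, ∫⁻ b', Φ (J.piecewise b b') ∂Measure.infinitePi μ ∂Measure.infinitePi μ := by
  have hm : Measurable fun p : (∀ i, E i) × (∀ i, E i) => J.piecewise p.1 p.2 := by
    refine measurable_pi_lambda _ fun i => ?_
    by_cases hi : i ∈ J
    · simp only [Set.piecewise, hi, if_true]; fun_prop
    · simp only [Set.piecewise, hi, if_false]; fun_prop
  conv_lhs => rw [← Measure.infinitePi_map_piecewise μ J]
  rw [lintegral_map hΦ hm]
  exact lintegral_prod _ (hΦ.comp hm).aemeasurable

/-- The coordinates of an infinite product measure along an injection of the index sets. -/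
theorem MeasureTheory.Measure.infinitePi_map_comp {ι κ E : Type*} [MeasurableSpace E]
    (μ : ι → Measure E) [∀ i, IsProbabilityMeasure (μ i)] {σ : κ → ι}
    (hσ : Function.Injective σ) :
    (Measure.infinitePi μ).map (fun b k => b (σ k)) = Measure.infinitePi fun k => μ (σ k) := by
  refine Measure.eq_infinitePi _ fun s t ht => ?_
  rw [Measure.map_apply (by fun_prop) (.pi s.countable_toSet fun i _ => ht i)]
  have : (fun (b : ι → E) k => b (σ k)) ⁻¹' (Set.pi s t) =
      Set.pi (s.map ⟨σ, hσ⟩) (Function.extend σ t fun _ => univ) := by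
    ext b
    simp [Set.mem_pi, hσ.extend_apply]
  rw [this, Measure.infinitePi_pi]
  · simp [hσ.extend_apply]
  · intro i hi
    obtain ⟨k, _, rfl⟩ := Finset.mem_map.1 hi
    simpa [hσ.extend_apply] using ht k

/-- Functions of disjoint blocks of coordinates of a product measure are independent; here for
countably many functions and in terms of `nexp`. -/
theorem MeasureTheory.Measure.lintegral_nexp_tsum_blocks {ι : Type*} {E : ι → Type*}
    [∀ i, MeasurableSpace (E i)] (μ : ∀ i, Measure (E i)) [∀ i, IsProbabilityMeasure (μ i)]
    {J : ℕ → Set ι} (hJ : Pairwise fun m n => Disjoint (J m) (J n))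
    {w : ℕ → (∀ i, E i) → ℝ≥0∞} (hw : ∀ n, Measurable (w n))
    (hdep : ∀ n b b', (∀ i ∈ J n, b i = b' i) → w n b = w n b') :
    ∫⁻ b, nexp (∑' n, w n b) ∂Measure.infinitePi μ =
      nexp (∑' n, nlog (∫⁻ b, nexp (w n b) ∂Measure.infinitePi μ)) := by
  classical
  have hle : ∀ n, ∫⁻ b, nexp (w n b) ∂Measure.infinitePi μ ≤ 1 := fun n =>
    (lintegral_mono fun b => nexp_le_one _).trans (by simp)
  have hfin : ∀ N, ∫⁻ b, ∏ n ∈ Finset.range N, nexp (w n b) ∂Measure.infinitePi μ =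
      ∏ n ∈ Finset.range N, ∫⁻ b, nexp (w n b) ∂Measure.infinitePi μ := by
    intro N
    induction N with
    | zero => simp
    | succ N ih =>
      have hmeas : ∀ K, Measurable fun b => ∏ n ∈ Finset.range K, nexp (w n b) := fun K =>
        Finset.measurable_prod _ fun n _ => measurable_nexp.comp (hw n)
      rw [Measure.lintegral_infinitePi_piecewise μ (J N) (hmeas _), Finset.prod_range_succ, ← ih]
      have e1 : ∀ b b', ∏ n ∈ Finset.range (N + 1), nexp (w n ((J N).piecewise b b')) =
          nexp (w N b) * ∏ n ∈ Finset.range N, nexp (w n b') := by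
        intro b b'
        rw [Finset.prod_range_succ, mul_comm]
        congr 1
        · rw [hdep N _ b fun i hi => by simp [Set.piecewise, hi]]
        · refine Finset.prod_congr rfl fun n hn => ?_
          rw [hdep n _ b' fun i hi => ?_]
          have : i ∉ J N := fun h =>
            Set.disjoint_left.1 (hJ (Finset.mem_range.1 hn).ne) hi h
          simp [Set.piecewise, this]
      simp_rw [e1]
      simp_rw [lintegral_const_mul _ (hmeas N)]
      rw [lintegral_mul_const _ (show Measurable fun b => nexp (w N b) from
        measurable_nexp.comp (hw N)), mul_comm]
  have l1 : Filter.Tendsto (fun N => ∫⁻ b, ∏ n ∈ Finset.range N, nexp (w n b)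
      ∂Measure.infinitePi μ) Filter.atTop
      (nhds (∫⁻ b, nexp (∑' n, w n b) ∂Measure.infinitePi μ)) := by
    refine tendsto_lintegral_of_dominated_convergence (fun _ => 1)
      (fun N => Finset.measurable_prod _ fun n _ => measurable_nexp.comp (hw n))
      (fun N => Filter.Eventually.of_forall fun b => ?_) (by simp)
      (Filter.Eventually.of_forall fun b => nexp_tsum_tendsto _)
    exact Finset.prod_le_one' fun n _ => nexp_le_one _
  have l2 := nexp_tsum_tendsto fun n => nlog (∫⁻ b, nexp (w n b) ∂Measure.infinitePi μ)
  simp_rw [nexp_nlog (hle _), ← hfin] at l2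
  exact tendsto_nhds_unique l1 l2

end Product

/-! ### Counting measures of enumerated points -/

/-- The counting measure of the points `x m`, `m ∈ S`. -/
def cnt {X : Type*} [MeasurableSpace X] (x : ℕ → X) (S : Set ℕ) : Measure X :=
  Measure.sum fun m : S => Measure.dirac (x m)

section Cnt

variable {X : Type*} [MeasurableSpace X]

lemma lintegral_cnt (x : ℕ → X) (S : Set ℕ) {g : X → ℝ≥0∞} (hg : Measurable g) :
    ∫⁻ y, g y ∂cnt x S = ∑' m, S.indicator (fun m => g (x m)) m := by
  rw [cnt, lintegral_sum_measure, ← tsum_subtype]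
  exact tsum_congr fun m => lintegral_dirac' _ hg

lemma cnt_apply (x : ℕ → X) (S : Set ℕ) {B : Set X} (hB : MeasurableSet B) :
    cnt x S B = ∑' m, S.indicator (fun m => B.indicator 1 (x m)) m := by
  rw [← lintegral_indicator_one hB, lintegral_cnt x S (measurable_one.indicator hB)]

@[fun_prop] lemma measurable_cnt {α : Type*} [MeasurableSpace α] {x : α → ℕ → X} {S : α → Set ℕ}
    (hx : Measurable x) (hS : Measurable S) : Measurable fun a => cnt (x a) (S a) := by
  refine Measure.measurable_of_measurable_coe _ fun B hB => ?_
  simp_rw [cnt_apply _ _ hB]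
  refine Measurable.tsum fun m => ?_
  have hm : MeasurableSet {a | m ∈ S a} := measurableSet_setOfPred.2 ((measurable_set_iff.1 hS) m)
  have : (fun a => (S a).indicator (fun m => B.indicator (1 : X → ℝ≥0∞) (x a m)) m) =
      {a | m ∈ S a}.indicator fun a => B.indicator 1 (x a m) := by
    ext a
    by_cases h : m ∈ S a <;> simp [h]
  rw [this]
  exact ((measurable_one.indicator hB).comp ((measurable_pi_apply m).comp hx)).indicator hm

lemma cnt_mono (x : ℕ → X) {S T : Set ℕ} (h : S ⊆ T) : cnt x S ≤ cnt x T := by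
  refine Measure.le_iff.2 fun B hB => ?_
  rw [cnt_apply _ _ hB, cnt_apply _ _ hB]
  exact ENNReal.tsum_le_tsum fun m => indicator_le_indicator_of_subset h (fun _ => zero_le) m

lemma cnt_union (x : ℕ → X) {S T : Set ℕ} (h : Disjoint S T) :
    cnt x (S ∪ T) = cnt x S + cnt x T := by
  ext B hB
  rw [Measure.add_apply, cnt_apply _ _ hB, cnt_apply _ _ hB, cnt_apply _ _ hB, ← ENNReal.tsum_add]
  refine tsum_congr fun m => ?_
  rw [indicator_union_of_disjoint h]

@[simp] lemma cnt_empty (x : ℕ → X) : cnt x ∅ = 0 := by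
  ext B hB
  simp [cnt_apply _ _ hB]

@[simp] lemma cnt_singleton (x : ℕ → X) (m : ℕ) : cnt x {m} = Measure.dirac (x m) := by
  ext B hB
  rw [cnt_apply _ _ hB, tsum_eq_single m, indicator_of_mem (mem_singleton m),
    Measure.dirac_apply' _ hB]
  intro n hn
  simp [hn]

lemma cnt_image_succ (x : ℕ → X) (S : Set ℕ) :
    cnt x {m | ∃ k ∈ S, m = k + 1} = cnt (fun k => x (k + 1)) S := by
  ext B hB
  rw [cnt_apply _ _ hB, cnt_apply _ _ hB, tsum_eq_zero_add' ENNReal.summable]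
  have h0 : (0 : ℕ) ∉ {m | ∃ k ∈ S, m = k + 1} := by simp
  rw [indicator_of_notMem h0, zero_add]
  refine tsum_congr fun k => ?_
  by_cases h : k ∈ S <;> simp [h]

lemma cnt_iUnion_apply (x : ℕ → X) {S : ℕ → Set ℕ} (hS : Monotone S) {B : Set X}
    (hB : MeasurableSet B) : cnt x (⋃ n, S n) B = ⨆ n, cnt x (S n) B := by
  have h1 : ∀ T, cnt x T B = ∫⁻ m, T.indicator (fun m => B.indicator 1 (x m)) m
      ∂Measure.count := fun T => by
    rw [cnt_apply _ _ hB, lintegral_count]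
  simp_rw [h1]
  rw [← lintegral_iSup (fun n => measurable_of_countable _)]
  · refine lintegral_congr fun m => ?_
    rw [indicator_iUnion_apply rfl]
  · exact fun n n' h m => indicator_le_indicator_of_subset (hS h) (fun _ => zero_le) m

end Cnt

/-! ### The Laplace functional of a Poisson process -/

namespace IsPoissonProcess

variable {X Ω : Type*} [MeasurableSpace X] [MeasurableSpace Ω] {lam : Measure X} {P : Measure Ω}
  [IsProbabilityMeasure P] {eta : Ω → Measure X}

lemma lintegral_nexp_poissonMeasure (r : ℝ≥0) (t : ℝ≥0∞) :
    ∫⁻ n : ℕ, nexp (t * n) ∂poissonMeasure r = nexp ((1 - nexp t) * r) := by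
  obtain ⟨p, hp⟩ : ∃ p : ℝ≥0, nexp t = p := ⟨_, (ENNReal.coe_toNNReal (nexp_ne_top t)).symm⟩
  have hp1 : p ≤ 1 := by exact_mod_cast hp ▸ nexp_le_one t
  have hterm : ∀ n : ℕ, nexp (t * n) = ENNReal.ofReal ((p : ℝ) ^ n) := fun n => by
    rw [mul_comm, nexp_nat_mul, hp, ENNReal.ofReal_pow p.coe_nonneg]; simp
  have hrhs : nexp ((1 - nexp t) * r) =
      ENNReal.ofReal (Real.exp (-((1 - (p : ℝ)) * r))) := by
    have h0 : (0 : ℝ) ≤ 1 - p := sub_nonneg.2 (by exact_mod_cast hp1)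
    rw [← nexp_ofReal (mul_nonneg h0 r.coe_nonneg), hp, ENNReal.ofReal_mul h0,
      ENNReal.ofReal_sub _ p.coe_nonneg]
    simp
  rw [hrhs, poissonMeasure, lintegral_sum_measure]
  simp_rw [lintegral_smul_measure, lintegral_dirac, hterm, smul_eq_mul]
  have hs : HasSum (fun n : ℕ => Real.exp (-r) * r ^ n / n.factorial * (p : ℝ) ^ n)
      (Real.exp (-((1 - (p : ℝ)) * r))) := by
    have h1 := (NormedSpace.expSeries_div_hasSum_exp ((p : ℝ) * r)).mul_left (Real.exp (-r))
    rw [← Real.exp_eq_exp_ℝ, ← Real.exp_add] at h1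
    rw [show -((1 - (p : ℝ)) * r) = -r + p * r by ring]
    refine h1.congr_fun ?_
    intro n
    rw [mul_pow]; ring
  rw [← hs.tsum_eq, ENNReal.ofReal_tsum_of_nonneg (fun n => by positivity) hs.summable]
  refine tsum_congr fun n => ?_
  rw [← ENNReal.ofReal_mul (by positivity)]

lemma lintegral_nexp_mul (h : IsPoissonProcess lam P eta) {B : Set X} (hB : MeasurableSet B)
    (t : ℝ≥0∞) : ∫⁻ ω, nexp (t * eta ω B) ∂P = nexp ((1 - nexp t) * lam B) := by
  by_cases hlam : lam B = ∞
  · have : ∫⁻ ω, nexp (t * eta ω B) ∂P = ∫⁻ ω, nexp (t * ∞) ∂P :=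
      lintegral_congr_ae ((h.law_top B hB hlam).mono fun ω hω => by simp [hω])
    rw [this, lintegral_const, measure_univ, mul_one, hlam]
    by_cases ht : t = 0
    · simp [ht]
    · rw [ENNReal.mul_top ht, ENNReal.mul_top]
      intro h0
      have h1 : nexp t = 1 := le_antisymm (nexp_le_one t) (tsub_eq_zero_iff_le.1 h0)
      exact ht (nexp_injective (h1.trans nexp_zero.symm))
  · have hm : Measurable fun ω => eta ω B := (Measure.measurable_coe hB).comp h.measurable
    have hf : Measurable fun y : ℝ≥0∞ => nexp (t * y) := by fun_prop
    rw [← lintegral_map hf hm, h.law B hB hlam, lintegral_map hf (measurable_of_countable _),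
      lintegral_nexp_poissonMeasure, ENNReal.coe_toNNReal hlam]

/-- For a simple function, the values of the Poisson process on the level sets are independent. -/
lemma lintegral_nexp_simpleFunc (h : IsPoissonProcess lam P eta) (g : SimpleFunc X ℝ≥0∞) :
    ∫⁻ ω, nexp (∫⁻ x, g x ∂eta ω) ∂P = nexp (∫⁻ x, (1 - nexp (g x)) ∂lam) := by
  let e := g.range.equivFin.symm
  have hind := h.indep g.range.card (fun i => g ⁻¹' {(e i : ℝ≥0∞)})
    (fun i => g.measurableSet_fiber _) (fun i j hij => by
      refine Disjoint.preimage _ (Set.disjoint_singleton.2 fun hh => hij ?_)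
      exact e.injective (Subtype.ext hh))
  have hsum : ∀ F : ℝ≥0∞ → ℝ≥0∞, ∑ c ∈ g.range, F c = ∑ i, F (e i) := fun F => by
    rw [← Finset.sum_coe_sort g.range F]
    exact (Equiv.sum_comp e (fun c : g.range => F c)).symm
  have hprod : ∀ F : ℝ≥0∞ → ℝ≥0∞, ∏ c ∈ g.range, F c = ∏ i, F (e i) := fun F => by
    rw [← Finset.prod_coe_sort g.range F]
    exact (Equiv.prod_comp e (fun c : g.range => F c)).symm
  have hR : ∫⁻ x, (1 - nexp (g x)) ∂lam = ∑ c ∈ g.range, (1 - nexp c) * lam (g ⁻¹' {c}) := by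
    rw [← SimpleFunc.map_lintegral (fun c => 1 - nexp c) g, ← SimpleFunc.lintegral_eq_lintegral]
    rfl
  have hL : ∀ ω, ∫⁻ x, g x ∂eta ω = ∑ c ∈ g.range, c * eta ω (g ⁻¹' {c}) := fun ω => by
    rw [SimpleFunc.lintegral_eq_lintegral]; rfl
  have hm : ∀ B, MeasurableSet B → Measurable fun ω => eta ω B := fun B hB =>
    (Measure.measurable_coe hB).comp h.measurable
  simp_rw [hL, nexp_sum]
  rw [hR, nexp_sum, hprod]
  simp_rw [hprod]
  have hind2 := hind.comp (fun i y => nexp ((e i : ℝ≥0∞) * y)) (fun i => by fun_prop)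
  have := lintegral_prod_eq_prod_lintegral_of_indepFun Finset.univ _ hind2
    (fun i => by
      have := hm _ (g.measurableSet_fiber (e i : ℝ≥0∞))
      simp only [Function.comp_def]; fun_prop)
  refine this.trans (Finset.prod_congr rfl fun i _ => ?_)
  exact h.lintegral_nexp_mul (g.measurableSet_fiber _) _

/-- The Laplace functional of a Poisson process, for every intensity measure and every `g`. -/
theorem lintegral_nexp (h : IsPoissonProcess lam P eta) {g : X → ℝ≥0∞} (hg : Measurable g) :
    ∫⁻ ω, nexp (∫⁻ x, g x ∂eta ω) ∂P = nexp (∫⁻ x, (1 - nexp (g x)) ∂lam) := by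
  have hmono : ∀ x, Monotone fun n => SimpleFunc.eapprox g n x := fun x n n' hn =>
    SimpleFunc.monotone_eapprox g hn x
  have ht : ∀ x, Filter.Tendsto (fun n => SimpleFunc.eapprox g n x) Filter.atTop (nhds (g x)) :=
    fun x => SimpleFunc.tendsto_eapprox hg x
  have t1 : ∀ ω, Filter.Tendsto (fun n => ∫⁻ x, SimpleFunc.eapprox g n x ∂eta ω) Filter.atTop
      (nhds (∫⁻ x, g x ∂eta ω)) := fun ω =>
    lintegral_tendsto_of_tendsto_of_monotone (fun n => (SimpleFunc.measurable _).aemeasurable)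
      (Filter.Eventually.of_forall hmono) (Filter.Eventually.of_forall ht)
  have t2 : Filter.Tendsto (fun n => ∫⁻ ω, nexp (∫⁻ x, SimpleFunc.eapprox g n x ∂eta ω) ∂P)
      Filter.atTop (nhds (∫⁻ ω, nexp (∫⁻ x, g x ∂eta ω) ∂P)) := by
    refine tendsto_lintegral_of_dominated_convergence (fun _ => 1) (fun n => ?_)
      (fun n => Filter.Eventually.of_forall fun ω => nexp_le_one _) (by simp)
      (Filter.Eventually.of_forall fun ω => (continuous_nexp.tendsto _).comp (t1 ω))
    exact measurable_nexp.comp (h.measurable.lintegral_measure (SimpleFunc.measurable _))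
  have t3 : Filter.Tendsto (fun n => ∫⁻ x, (1 - nexp (SimpleFunc.eapprox g n x)) ∂lam)
      Filter.atTop (nhds (∫⁻ x, (1 - nexp (g x)) ∂lam)) := by
    refine lintegral_tendsto_of_tendsto_of_monotone (fun n => by fun_prop)
      (Filter.Eventually.of_forall fun x n n' hn =>
        tsub_le_tsub_left (nexp_antitone (hmono x hn)) 1)
      (Filter.Eventually.of_forall fun x => ?_)
    exact ((ENNReal.continuous_sub_left ENNReal.one_ne_top).tendsto _).comp
      ((continuous_nexp.tendsto _).comp (ht x))
  refine tendsto_nhds_unique t2 ?_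
  simp_rw [h.lintegral_nexp_simpleFunc]
  exact (continuous_nexp.tendsto _).comp t3

end IsPoissonProcess

/-! ### Tame measures and the avoidance function -/

section Tame

variable {X : Type*} [MeasurableSpace X]

/-- Measures that are finite on each of the sets `spanningSets lam j`. On this measurable set of
measures, which carries the Poisson processes below, integrals depend measurably on the measure
and on parameters. -/
def Tame (lam : Measure X) [SigmaFinite lam] (χ : Measure X) : Prop :=
  ∀ j, χ (spanningSets lam j) < ∞

variable {lam : Measure X} [SigmaFinite lam]

lemma measurableSet_tame : MeasurableSet {χ : Measure X | Tame lam χ} := by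
  have : {χ : Measure X | Tame lam χ} = ⋂ j, {χ | χ (spanningSets lam j) < ∞} := by
    ext χ; simp [Tame]
  rw [this]
  exact MeasurableSet.iInter fun j =>
    Measure.measurable_coe (measurableSet_spanningSets lam j) measurableSet_Iio

lemma Tame.mono {χ χ' : Measure X} (h : Tame lam χ') (hle : χ ≤ χ') : Tame lam χ :=
  fun j => (hle _).trans_lt (h j)

lemma Tame.add {χ χ' : Measure X} (h : Tame lam χ) (h' : Tame lam χ') : Tame lam (χ + χ') :=
  fun j => by rw [Measure.add_apply]; exact ENNReal.add_lt_top.2 ⟨h j, h' j⟩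

lemma tame_dirac (x : X) : Tame lam (Measure.dirac x) := fun j =>
  (measure_mono (subset_univ _)).trans_lt (by simp)

open Classical in
/-- The identity on tame measures, extended by `0`, as a kernel. -/
def tameKernel (lam : Measure X) [SigmaFinite lam] : Kernel (Measure X) X where
  toFun χ := if Tame lam χ then χ else 0
  measurable' := Measurable.ite measurableSet_tame measurable_id measurable_const

lemma tameKernel_apply {χ : Measure X} (h : Tame lam χ) : tameKernel lam χ = χ := if_pos h

lemma tameKernel_of_not {χ : Measure X} (h : ¬ Tame lam χ) : tameKernel lam χ = 0 := if_neg h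

open Classical in
/-- The part of `tameKernel` on the `j`-th piece of the space, restricted to measures whose mass
there lies between `n` and `n + 1`. -/
def tameKernelPart (lam : Measure X) [SigmaFinite lam] (p : ℕ × ℕ) : Kernel (Measure X) X where
  toFun χ := if Tame lam χ ∧ ⌊(χ (disjointed (spanningSets lam) p.1)).toReal⌋₊ = p.2 then
    χ.restrict (disjointed (spanningSets lam) p.1) else 0
  measurable' := by
    have hD := MeasurableSet.disjointed (measurableSet_spanningSets lam) p.1
    have hr : Measurable fun χ : Measure X => χ.restrict (disjointed (spanningSets lam) p.1) := by
      refine Measure.measurable_of_measurable_coe _ fun B hB => ?_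
      simp_rw [Measure.restrict_apply hB]
      exact Measure.measurable_coe (hB.inter hD)
    refine Measurable.ite (measurableSet_tame.inter ?_) hr measurable_const
    exact (Nat.measurable_floor.comp (Measure.measurable_coe hD).ennreal_toReal)
      (measurableSet_singleton p.2)

open Classical in
instance (p : ℕ × ℕ) : IsFiniteKernel (tameKernelPart lam p) := by
  refine ⟨⟨p.2 + 1, by simp, fun χ => ?_⟩⟩
  show (if _ then _ else _ : Measure X) univ ≤ _
  split_ifs with h
  · rw [Measure.restrict_apply_univ]
    have hfin : χ (disjointed (spanningSets lam) p.1) ≠ ∞ :=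
      ((measure_mono (disjointed_subset _ _)).trans_lt (h.1 p.1)).ne
    rw [← ENNReal.ofReal_toReal hfin]
    refine ENNReal.ofReal_le_of_le_toReal ?_
    have := (Nat.lt_floor_add_one (χ (disjointed (spanningSets lam) p.1)).toReal).le
    rw [h.2] at this
    rw [ENNReal.toReal_add (by simp) (by simp)]
    simpa using this
  · simp

open Classical in
lemma tameKernel_eq_sum : tameKernel lam = Kernel.sum (tameKernelPart lam) := by
  ext1 χ
  rw [Kernel.sum_apply]
  by_cases h : Tame lam χ
  · rw [tameKernel_apply h]
    ext B hB
    have hD := MeasurableSet.disjointed (measurableSet_spanningSets lam)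
    rw [Measure.sum_apply _ hB, ENNReal.summable.tsum_prod' fun _ => ENNReal.summable]
    have h1 : ∀ j, ∑' n, tameKernelPart lam (j, n) χ B =
        χ.restrict (disjointed (spanningSets lam) j) B := by
      intro j
      rw [tsum_eq_single ⌊(χ (disjointed (spanningSets lam) j)).toReal⌋₊]
      · show (if _ then _ else _ : Measure X) B = _
        rw [if_pos ⟨h, rfl⟩]
      · intro n hn
        show (if _ then _ else _ : Measure X) B = _
        rw [if_neg fun h' => hn h'.2.symm]
        simp
    simp_rw [h1]
    rw [← Measure.sum_apply _ hB, ← Measure.restrict_iUnion (disjoint_disjointed _) hD,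
      iUnion_disjointed, iUnion_spanningSets, Measure.restrict_univ]
  · rw [tameKernel_of_not h]
    ext B hB
    rw [Measure.sum_apply _ hB]
    symm
    rw [Measure.coe_zero, Pi.zero_apply, ENNReal.tsum_eq_zero]
    intro p
    show (if _ then _ else _ : Measure X) B = _
    rw [if_neg fun h' => h h'.1]
    simp

instance : IsSFiniteKernel (tameKernel lam) := by
  rw [tameKernel_eq_sum]
  infer_instance

lemma Measurable.lintegral_tameKernel {α : Type*} [MeasurableSpace α] {g : α → X → ℝ≥0∞}
    (hg : Measurable (Function.uncurry g)) {χ : α → Measure X} (hχ : Measurable χ) :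
    Measurable fun a => ∫⁻ y, g a y ∂tameKernel lam (χ a) := by
  have := Measurable.lintegral_kernel_prod_right (κ := (tameKernel lam).comap χ hχ) hg
  simpa using this

/-- `avoid lam phi χ z` is the probability that `z` is not connected to any of the points of `χ`,
the product of `1 - phi y z` over the points `y` of `χ` (for tame `χ`). -/
def avoid (lam : Measure X) [SigmaFinite lam] (phi : X → X → ℝ) (χ : Measure X) (z : X) : ℝ≥0∞ :=
  nexp (∫⁻ y, nlog (1 - ENNReal.ofReal (phi y z)) ∂tameKernel lam χ)

lemma avoid_le_one (phi : X → X → ℝ) (χ : Measure X) (z : X) : avoid lam phi χ z ≤ 1 :=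
  nexp_le_one _

variable {phi : X → X → ℝ}

lemma measurable_connection (hphi : Measurable fun p : X × X => phi p.1 p.2) (z : X) :
    Measurable fun y => nlog (1 - ENNReal.ofReal (phi y z)) := by
  have : Measurable fun y => phi y z := hphi.comp (measurable_id.prodMk measurable_const)
  fun_prop

lemma measurable_avoid (hphi : Measurable fun p : X × X => phi p.1 p.2) {α : Type*}
    [MeasurableSpace α] {χ : α → Measure X} (hχ : Measurable χ) {z : α → X} (hz : Measurable z) :
    Measurable fun a => avoid lam phi (χ a) (z a) := by
  refine measurable_nexp.comp (Measurable.lintegral_tameKernel ?_ hχ)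
  have : Measurable fun p : α × X => phi p.2 (z p.1) :=
    hphi.comp (measurable_snd.prodMk (hz.comp measurable_fst))
  simp only [Function.uncurry_def]
  fun_prop

lemma avoid_of_tame {χ : Measure X} (h : Tame lam χ) (z : X) :
    avoid lam phi χ z = nexp (∫⁻ y, nlog (1 - ENNReal.ofReal (phi y z)) ∂χ) := by
  rw [avoid, tameKernel_apply h]

lemma avoid_add {χ χ' : Measure X} (h : Tame lam χ) (h' : Tame lam χ') (z : X) :
    avoid lam phi (χ + χ') z = avoid lam phi χ z * avoid lam phi χ' z := by
  rw [avoid_of_tame h, avoid_of_tame h', avoid_of_tame (h.add h'), lintegral_add_measure, nexp_add]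

lemma avoid_anti {χ χ' : Measure X} (h' : Tame lam χ') (hle : χ ≤ χ') (z : X) :
    avoid lam phi χ' z ≤ avoid lam phi χ z := by
  rw [avoid_of_tame h', avoid_of_tame (h'.mono hle)]
  exact nexp_antitone (lintegral_mono' hle le_rfl)

lemma avoid_cnt (hphi : Measurable fun p : X × X => phi p.1 p.2) {x : ℕ → X} {S : Set ℕ}
    (h : Tame lam (cnt x S)) (z : X) : avoid lam phi (cnt x S) z =
      nexp (∑' k, S.indicator (fun k => nlog (1 - ENNReal.ofReal (phi (x k) z))) k) := by
  rw [avoid_of_tame h, lintegral_cnt _ _ (measurable_connection hphi z)]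

lemma avoid_dirac (hphi : Measurable fun p : X × X => phi p.1 p.2) (x z : X) :
    avoid lam phi (Measure.dirac x) z = 1 - ENNReal.ofReal (phi x z) := by
  rw [avoid_of_tame (tame_dirac x), lintegral_dirac' _ (measurable_connection hphi z),
    nexp_nlog tsub_le_self]

end Tame

/-! ### Independent uniform marks -/

/-- Index set of the marks. -/
abbrev MarkIndex : Type := {p : ℕ × ℕ // p.1 < p.2}

/-- The uniform distribution on `[0,1]`. -/
def unif : Measure ℝ := volume.restrict (Icc 0 1)

instance : IsProbabilityMeasure unif := ⟨by simp [unif]⟩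

/-- The distribution of a family of independent, uniformly distributed marks. -/
def markLaw : Measure (MarkIndex → ℝ) := Measure.infinitePi fun _ => unif

instance : IsProbabilityMeasure markLaw := by unfold markLaw; infer_instance

lemma unif_Iic {p : ℝ} (hp : p ∈ Icc (0 : ℝ) 1) : unif {u | u ≤ p} = ENNReal.ofReal p := by
  rw [unif, Measure.restrict_apply (show MeasurableSet {u | u ≤ p} from measurableSet_Iic)]
  have : {u | u ≤ p} ∩ Icc (0 : ℝ) 1 = Icc 0 p := by
    ext u
    simp only [mem_inter_iff, mem_Icc]
    exact ⟨fun h => ⟨h.2.1, h.1⟩, fun h => ⟨h.2, h.1, h.2.trans hp.2⟩⟩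
  rw [this, Real.volume_Icc, sub_zero]

lemma unif_ofReal_le {p : ℝ≥0∞} (hp : p ≤ 1) : unif {u | ENNReal.ofReal u ≤ p} = p := by
  have hp' : p ≠ ∞ := (hp.trans_lt ENNReal.one_lt_top).ne
  have : {u | ENNReal.ofReal u ≤ p} = {u | u ≤ p.toReal} := by
    ext u
    exact ENNReal.ofReal_le_iff_le_toReal hp'
  rw [this, unif_Iic, ENNReal.ofReal_toReal hp']
  exact ⟨ENNReal.toReal_nonneg, by simpa using ENNReal.toReal_mono ENNReal.one_ne_top hp⟩

lemma markLaw_coord (p : MarkIndex) {B : Set ℝ} (hB : MeasurableSet B) :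
    markLaw {Z | Z p ∈ B} = unif B := by
  have : markLaw.map (fun Z => Z p) = unif := Measure.infinitePi_map_eval (fun _ => unif) p
  rw [← this, Measure.map_apply (by fun_prop) hB]
  rfl

/-- The mark of the unordered pair of two distinct numbers; the value `2` on the diagonal exceeds
every connection probability. -/
def edge (Z : MarkIndex → ℝ) (k n : ℕ) : ℝ :=
  if h : k < n then Z ⟨(k, n), h⟩ else if h : n < k then Z ⟨(n, k), h⟩ else 2

lemma exists_edge_eq {k n : ℕ} (h : k ≠ n) : ∃ p : MarkIndex,
    (p.1 = (k, n) ∨ p.1 = (n, k)) ∧ ∀ Z, edge Z k n = Z p := by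
  rcases lt_or_gt_of_ne h with h | h
  · exact ⟨⟨(k, n), h⟩, Or.inl rfl, fun Z => by simp [edge, h]⟩
  · exact ⟨⟨(n, k), h⟩, Or.inr rfl, fun Z => by simp [edge, h, h.not_gt]⟩

@[fun_prop] lemma measurable_edge (k n : ℕ) : Measurable fun Z => edge Z k n := by
  unfold edge
  split_ifs <;> fun_prop

/-! ### One step of the exploration -/

section Quenched

variable {X : Type*}

/-- The points with numbers in `S` that are joined to a point with number in `E`. -/
def nbr (phi : X → X → ℝ) (x : ℕ → X) (Z : MarkIndex → ℝ) (S E : Set ℕ) : Set ℕ :=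
  {n | n ∈ S ∧ ∃ k ∈ E, edge Z k n ≤ phi (x k) (x n)}

lemma nbr_subset (phi : X → X → ℝ) (x : ℕ → X) (Z : MarkIndex → ℝ) (S E : Set ℕ) :
    nbr phi x Z S E ⊆ S := fun _ h => h.1

variable {phi : X → X → ℝ}

lemma measurable_nbr [MeasurableSpace X] (hphi : Measurable fun p : X × X => phi p.1 p.2)
    {α : Type*} [MeasurableSpace α] {x : α → ℕ → X} {Z : α → MarkIndex → ℝ} {S E : α → Set ℕ}
    (hx : Measurable x) (hZ : Measurable Z) (hS : Measurable S) (hE : Measurable E) :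
    Measurable fun a => nbr phi (x a) (Z a) (S a) (E a) := by
  refine measurable_set_iff.2 fun n => ?_
  have hS' := measurable_set_iff.1 hS
  have hE' := measurable_set_iff.1 hE
  have hx' : ∀ k, Measurable fun a => x a k := fun k => (measurable_pi_apply k).comp hx
  refine (hS' n).and (Measurable.exists fun k => (hE' k).and ?_)
  refine measurableSet_setOfPred.1 (measurableSet_le ((measurable_edge k n).comp hZ) ?_)
  exact hphi.comp ((hx' k).prodMk (hx' n))

/-- The probability that a fixed point `n` is not joined to any of the points in `E`. -/
lemma markLaw_not_joined (hunit : ∀ x y, phi x y ∈ Icc (0 : ℝ) 1) (x : ℕ → X) {E : Set ℕ}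
    {n : ℕ} (hn : n ∉ E) :
    markLaw {Z | ∀ k ∈ E, ¬ edge Z k n ≤ phi (x k) (x n)} =
      nexp (∑' k, E.indicator (fun k => nlog (1 - ENNReal.ofReal (phi (x k) (x n)))) k) := by
  classical
  let A : ℕ → Set (MarkIndex → ℝ) := fun k => {Z | k ∈ E ∧ edge Z k n ≤ phi (x k) (x n)}
  have hA : ∀ k, MeasurableSet (A k) := fun k =>
    (MeasurableSet.const (k ∈ E)).inter (measurableSet_le (measurable_edge k n) measurable_const)
  let w : ℕ → (MarkIndex → ℝ) → ℝ≥0∞ := fun k => (A k).indicator fun _ => ∞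
  have hw : ∀ k, Measurable (w k) := fun k => measurable_const.indicator (hA k)
  let J : ℕ → Set MarkIndex := fun k => {p | k ∈ E ∧ (p.1 = (k, n) ∨ p.1 = (n, k))}
  have key := Measure.lintegral_nexp_tsum_blocks (fun _ : MarkIndex => unif) (J := J) (w := w)
    (fun k k' hk => by
      refine Set.disjoint_left.2 ?_
      rintro ⟨⟨a, b⟩, hab⟩ ⟨h1, h2⟩ ⟨h3, h4⟩
      simp only [Prod.mk.injEq] at h2 h4
      have : k ≠ n := fun h => hn (h ▸ h1)
      have : k' ≠ n := fun h => hn (h ▸ h3)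
      omega) hw (fun k b b' hb => by
      by_cases hk : k ∈ E
      · have hkn : k ≠ n := fun h => hn (h ▸ hk)
        obtain ⟨p, hp, he⟩ := exists_edge_eq hkn
        have : b ∈ A k ↔ b' ∈ A k := by
          simp only [A, mem_ofPred_eq, he, hb p ⟨hk, hp⟩]
        by_cases h : b ∈ A k
        · simp only [w, indicator_of_mem h, indicator_of_mem (this.1 h)]
        · simp only [w, indicator_of_notMem h, indicator_of_notMem (mt this.2 h)]
      · simp [w, A, hk])
  have e1 : ∀ Z : MarkIndex → ℝ, nexp (∑' k, w k Z) =
      {Z | ∀ k ∈ E, ¬ edge Z k n ≤ phi (x k) (x n)}.indicator 1 Z := by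
    intro Z
    by_cases hZ : ∀ k ∈ E, ¬ edge Z k n ≤ phi (x k) (x n)
    · rw [indicator_of_mem (by exact hZ)]
      have : ∀ k, w k Z = 0 := fun k => indicator_of_notMem (fun h => hZ k h.1 h.2) _
      simp [this]
    · rw [indicator_of_notMem (by exact hZ)]
      push Not at hZ
      obtain ⟨k, hk, hke⟩ := hZ
      have : w k Z = ∞ := indicator_of_mem (show Z ∈ A k from ⟨hk, hke⟩) _
      rw [ENNReal.tsum_eq_top_of_eq_top ⟨k, this⟩, nexp_top]
  have hms : MeasurableSet {Z : MarkIndex → ℝ | ∀ k ∈ E, ¬ edge Z k n ≤ phi (x k) (x n)} := by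
    have : {Z : MarkIndex → ℝ | ∀ k ∈ E, ¬ edge Z k n ≤ phi (x k) (x n)} = ⋂ k, (A k)ᶜ := by
      ext Z; simp [A]
    rw [this]
    exact MeasurableSet.iInter fun k => (hA k).compl
  simp_rw [e1] at key
  rw [lintegral_indicator_one hms] at key
  rw [markLaw, key]
  congr 1
  refine tsum_congr fun k => ?_
  by_cases hk : k ∈ E
  · rw [indicator_of_mem hk]
    congr 1
    have hkn : k ≠ n := fun h => hn (h ▸ hk)
    obtain ⟨p, hp, he⟩ := exists_edge_eq hkn
    have e2 : ∀ Z, nexp (w k Z) = (A k)ᶜ.indicator 1 Z := by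
      intro Z
      by_cases h : Z ∈ A k <;> simp [w, h]
    simp_rw [e2]
    rw [lintegral_indicator_one (hA k).compl, measure_compl (hA k) (measure_ne_top _ _),
      measure_univ]
    congr 1
    have e3 : A k = {Z | Z p ∈ {u | u ≤ phi (x k) (x n)}} := by
      ext Z; simp [A, hk, he]
    rw [e3]
    exact (markLaw_coord p measurableSet_Iic).trans (unif_Iic (hunit _ _))
  · rw [indicator_of_notMem hk]
    have : ∀ Z, w k Z = 0 := fun Z => indicator_of_notMem (fun h => hk h.1) _
    simp only [this, nexp_zero, lintegral_const, measure_univ, mul_one]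
    rw [← nexp_zero, nlog_nexp]

/-- The Laplace functional of the two-colouring of the points in `S` into neighbours and
non-neighbours of `E`, for fixed points and random marks. -/
theorem lintegral_nexp_nbr [MeasurableSpace X] (hunit : ∀ x y, phi x y ∈ Icc (0 : ℝ) 1)
    (x : ℕ → X) {S E : Set ℕ} (hSE : Disjoint S E) {a : X → ℝ≥0∞} (ha : Measurable a)
    (haE : ∀ z, a z = nexp (∑' k, E.indicator (fun k => nlog (1 - ENNReal.ofReal (phi (x k) z))) k))
    {g₁ g₂ : X → ℝ≥0∞} (h₁ : Measurable g₁) (h₂ : Measurable g₂) :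
    ∫⁻ Z, nexp (∫⁻ z, g₁ z ∂cnt x (nbr phi x Z S E)) *
        nexp (∫⁻ z, g₂ z ∂cnt x (S \ nbr phi x Z S E)) ∂markLaw =
      nexp (∫⁻ z, nlog ((1 - a z) * nexp (g₁ z) + a z * nexp (g₂ z)) ∂cnt x S) := by
  classical
  let A : ℕ → Set (MarkIndex → ℝ) := fun n => {Z | ∃ k ∈ E, edge Z k n ≤ phi (x k) (x n)}
  have hA : ∀ n, MeasurableSet (A n) := fun n => by
    have : A n = ⋃ k, {Z | k ∈ E ∧ edge Z k n ≤ phi (x k) (x n)} := by ext Z; simp [A]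
    rw [this]
    exact MeasurableSet.iUnion fun k =>
      (MeasurableSet.const (k ∈ E)).inter (measurableSet_le (measurable_edge k n) measurable_const)
  let w : ℕ → (MarkIndex → ℝ) → ℝ≥0∞ := fun n Z =>
    if n ∈ S then (if Z ∈ A n then g₁ (x n) else g₂ (x n)) else 0
  have hw : ∀ n, Measurable (w n) := fun n => by
    refine Measurable.ite (MeasurableSet.const _)
      (Measurable.ite (hA n) measurable_const measurable_const) measurable_const
  let J : ℕ → Set MarkIndex := fun n =>
    {p | n ∈ S ∧ ((p.1.1 = n ∧ p.1.2 ∈ E) ∨ (p.1.2 = n ∧ p.1.1 ∈ E))}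
  have hne : ∀ {n k}, n ∈ S → k ∈ E → k ≠ n := fun hn hk h =>
    Set.disjoint_left.1 hSE hn (h ▸ hk)
  have key := Measure.lintegral_nexp_tsum_blocks (fun _ : MarkIndex => unif) (J := J) (w := w)
    (fun n n' hnn => by
      refine Set.disjoint_left.2 ?_
      rintro ⟨⟨a, b⟩, hab⟩ ⟨h1, h2⟩ ⟨h3, h4⟩
      dsimp only at h2 h4
      rcases h2 with ⟨rfl, h2⟩ | ⟨rfl, h2⟩ <;> rcases h4 with ⟨rfl, h4⟩ | ⟨rfl, h4⟩
      · exact hnn rfl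
      · exact hne h1 h4 rfl
      · exact hne h1 h4 rfl
      · exact hnn rfl) hw (fun n b b' hb => by
      by_cases hn : n ∈ S
      · have : b ∈ A n ↔ b' ∈ A n := by
          refine exists_congr fun k => and_congr_right fun hk => ?_
          obtain ⟨p, hp, he⟩ := exists_edge_eq (hne hn hk)
          rw [he, he, hb p ⟨hn, ?_⟩]
          rcases hp with hp | hp <;> simp [hp, hk]
        simp [w, this]
      · simp [w, hn])
  have e1 : ∀ Z, nexp (∫⁻ z, g₁ z ∂cnt x (nbr phi x Z S E)) *
        nexp (∫⁻ z, g₂ z ∂cnt x (S \ nbr phi x Z S E)) = nexp (∑' n, w n Z) := by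
    intro Z
    rw [lintegral_cnt _ _ h₁, lintegral_cnt _ _ h₂, ← nexp_add, ← ENNReal.tsum_add]
    congr 1
    refine tsum_congr fun n => ?_
    by_cases hn : n ∈ S
    · by_cases hZ : Z ∈ A n
      · have : n ∈ nbr phi x Z S E := ⟨hn, hZ⟩
        simp [w, hn, hZ, this]
      · have : n ∉ nbr phi x Z S E := fun h => hZ h.2
        simp [w, hn, hZ, this]
    · have : n ∉ nbr phi x Z S E := fun h => hn h.1
      simp [w, hn, this]
  simp_rw [e1]
  rw [lintegral_cnt _ _ (by fun_prop), markLaw, key]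
  congr 1
  refine tsum_congr fun n => ?_
  by_cases hn : n ∈ S
  · rw [indicator_of_mem hn]
    congr 1
    have hnE : n ∉ E := Set.disjoint_left.1 hSE hn
    have e2 : ∀ Z, nexp (w n Z) = (A n).indicator (fun _ => nexp (g₁ (x n))) Z +
        (A n)ᶜ.indicator (fun _ => nexp (g₂ (x n))) Z := by
      intro Z
      by_cases h : Z ∈ A n <;> simp [w, h, hn]
    simp_rw [e2]
    rw [lintegral_add_left (measurable_const.indicator (hA n)),
      lintegral_indicator_const (hA n), lintegral_indicator_const (hA n).compl]
    have e3 : markLaw (A n)ᶜ = a (x n) := by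
      rw [haE, ← markLaw_not_joined hunit x hnE]
      congr 1
      ext Z
      simp [A]
    have e4 : markLaw (A n) = 1 - a (x n) := by
      rw [← e3, measure_compl (hA n) (measure_ne_top _ _), measure_univ,
        ENNReal.sub_sub_cancel ENNReal.one_ne_top prob_le_one]
    rw [← markLaw, e3, e4, mul_comm, mul_comm (nexp (g₂ (x n)))]
  · rw [indicator_of_notMem hn]
    simp only [w, hn, if_false, nexp_zero, lintegral_const, measure_univ, mul_one]
    rw [← nexp_zero, nlog_nexp]

end Quenched

/-! ### The law of a random connection model -/

section Law

variable {X : Type*} [MeasurableSpace X]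

/-- The marks of the pairs of points of `η`, that is, of the pairs of vertices other than `0`,
renumbered along with the points. -/
def pointMarks (Z : MarkIndex → ℝ) : MarkIndex → ℝ := fun p =>
  Z ⟨(p.1.1 + 1, p.1.2 + 1), Nat.succ_lt_succ p.2⟩

@[fun_prop] lemma measurable_pointMarks : Measurable pointMarks := by
  unfold pointMarks; fun_prop

lemma Config.eta_eq_cnt (c : Config X) : c.eta = cnt c.points {m | (m : ℕ∞) < c.count} := rfl

@[fun_prop] lemma Config.measurable_count : Measurable (Config.count : Config X → ℕ∞) :=
  measurable_fst

@[fun_prop] lemma Config.measurable_points : Measurable (Config.points : Config X → ℕ → X) :=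
  measurable_fst.comp measurable_snd

@[fun_prop] lemma Config.measurable_marks : Measurable (Config.marks : Config X → MarkIndex → ℝ) :=
  measurable_snd.comp measurable_snd

lemma Config.measurable_eta : Measurable (Config.eta : Config X → Measure X) := by
  refine measurable_cnt Config.measurable_points (measurable_set_iff.2 fun m => ?_)
  exact measurableSet_setOfPred.1
    (Config.measurable_count (show MeasurableSet {n : ℕ∞ | (m : ℕ∞) < n} from .of_discrete))

/-- The properties of the distribution `μ` of a random connection model that are used: the marks
can be resampled independently, and the points form a Poisson process, which is described by its
Laplace functional. -/
structure IsRCMLaw (lam : Measure X) [SigmaFinite lam] (μ : Measure (Config X)) : Prop where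
  prob : IsProbabilityMeasure μ
  resample : ∀ Φ : Config X → ℝ≥0∞, Measurable Φ →
    ∫⁻ c, Φ c ∂μ = ∫⁻ c, ∫⁻ Z, Φ (c.1, c.2.1, Z) ∂markLaw ∂μ
  laplace : ∀ g : X → ℝ≥0∞, Measurable g →
    ∫⁻ c, nexp (∫⁻ x, g x ∂c.eta) ∂μ = nexp (∫⁻ x, (1 - nexp (g x)) ∂lam)
  tame : ∀ᵐ c ∂μ, Tame lam c.eta

/-- The marks of a random connection model are independent of the points and have the law `markLaw`,
so that they can be resampled. -/
theorem IsRCM.isRCMLaw {Ω : Type*} [MeasurableSpace Ω] {lam : Measure X} [SigmaFinite lam]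
    {P : Measure Ω} [IsProbabilityMeasure P] {c : Ω → Config X} (h : IsRCM lam P c) :
    IsRCMLaw lam (P.map c) where
  prob := Measure.isProbabilityMeasure_map h.measurable.aemeasurable
  resample Φ hΦ := by
    have hm : Measurable fun ω => (c ω).marks := Config.measurable_marks.comp h.measurable
    have hp : Measurable fun ω => ((c ω).count, (c ω).points) :=
      (Config.measurable_count.prodMk Config.measurable_points).comp h.measurable
    have h1 : P.map (fun ω => (c ω).marks) = markLaw := by
      have := h.marks_indep.map_fun_eq_infinitePi_map
        (fun p => (measurable_pi_apply p).comp hm)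
      refine this.trans ?_
      rw [markLaw]
      congr 1
      exact funext h.marks_uniform
    have h2 := (indepFun_iff_map_prod_eq_prod_map_map hp.aemeasurable hm.aemeasurable).1
      h.points_indep_marks
    let Ψ : (ℕ∞ × (ℕ → X)) × (MarkIndex → ℝ) → ℝ≥0∞ := fun q => Φ (q.1.1, q.1.2, q.2)
    have hΨ : Measurable Ψ := hΦ.comp (by fun_prop)
    have e1 : ∫⁻ ω, Φ (c ω) ∂P =
        ∫⁻ q, Ψ q ∂P.map fun ω => (((c ω).count, (c ω).points), (c ω).marks) := by
      rw [lintegral_map hΨ (hp.prodMk hm)]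
      rfl
    have hΨ' : Measurable fun y => ∫⁻ Z, Ψ (y, Z) ∂markLaw := hΨ.lintegral_prod_right'
    have hinner : Measurable fun d : Config X => ∫⁻ Z, Φ (d.1, d.2.1, Z) ∂markLaw :=
      hΨ'.comp (show Measurable fun d : Config X => (d.1, d.2.1) by fun_prop)
    rw [lintegral_map hΦ h.measurable, e1, h2, h1, lintegral_prod _ hΨ.aemeasurable,
      lintegral_map hΨ' hp, lintegral_map hinner h.measurable]
    rfl
  laplace g hg := by
    have hm : Measurable fun c : Config X => nexp (∫⁻ x, g x ∂c.eta) :=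
      measurable_nexp.comp (Config.measurable_eta.lintegral_measure hg)
    rw [lintegral_map hm h.measurable]
    exact h.poisson.lintegral_nexp hg
  tame := by
    refine (ae_map_iff (p := fun c : Config X => Tame lam c.eta) h.measurable.aemeasurable
      (Config.measurable_eta measurableSet_tame)).2 ?_
    refine ae_all_iff.2 fun j => ?_
    have hB := measurableSet_spanningSets lam j
    have hm : Measurable fun ω => (c ω).eta (spanningSets lam j) :=
      (Measure.measurable_coe hB).comp h.poisson.measurable
    have h1 := h.poisson.law _ hB (measure_spanningSets_lt_top lam j).ne
    have h2 : P.map (fun ω => (c ω).eta (spanningSets lam j)) {∞} = 0 := by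
      rw [h1, Measure.map_apply (measurable_of_countable _) (measurableSet_singleton _),
        show (fun n : ℕ => (n : ℝ≥0∞)) ⁻¹' {∞} = ∅ by ext n; simp, measure_empty]
    rw [Measure.map_apply hm (measurableSet_singleton _)] at h2
    refine measure_mono_null ?_ h2
    intro ω hω
    exact not_lt_top_iff.1 hω

/-- The numbers of the points of `η` that are kept when a point at `z` is kept with probability
`κ z`; the marks of the pairs containing the additional vertex decide. -/
def sel (κ : X → ℝ≥0∞) (c : Config X) : Set ℕ :=
  {m | (m : ℕ∞) < c.count ∧
    ENNReal.ofReal (c.marks ⟨(0, m + 1), Nat.succ_pos m⟩) ≤ κ (c.points m)}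

/-- The `κ`-thinning of `η`. -/
def thin (κ : X → ℝ≥0∞) (c : Config X) : Measure X := cnt c.points (sel κ c)

omit [MeasurableSpace X] in
lemma sel_mono {κ κ' : X → ℝ≥0∞} (h : κ ≤ κ') (c : Config X) : sel κ c ⊆ sel κ' c :=
  fun _ hm => ⟨hm.1, hm.2.trans (h _)⟩

lemma thin_mono {κ κ' : X → ℝ≥0∞} (h : κ ≤ κ') (c : Config X) : thin κ c ≤ thin κ' c :=
  cnt_mono _ (sel_mono h c)

lemma thin_le_eta (κ : X → ℝ≥0∞) (c : Config X) : thin κ c ≤ c.eta :=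
  cnt_mono _ fun _ hm => hm.1

lemma measurable_sel {α : Type*} [MeasurableSpace α] {κ : α → X → ℝ≥0∞}
    (hκ : Measurable (Function.uncurry κ)) {c : α → Config X} (hc : Measurable c) :
    Measurable fun a => sel (κ a) (c a) := by
  refine measurable_set_iff.2 fun m => ?_
  refine Measurable.and (measurableSet_setOfPred.1 ((Config.measurable_count.comp hc)
    (show MeasurableSet {n : ℕ∞ | (m : ℕ∞) < n} from .of_discrete))) ?_
  refine measurableSet_setOfPred.1 (measurableSet_le ?_ ?_)
  · exact ENNReal.measurable_ofReal.comp
      ((measurable_pi_apply _).comp (Config.measurable_marks.comp hc))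
  · exact hκ.comp (measurable_id.prodMk
      ((measurable_pi_apply m).comp (Config.measurable_points.comp hc)))

lemma measurable_thin {α : Type*} [MeasurableSpace α] {κ : α → X → ℝ≥0∞}
    (hκ : Measurable (Function.uncurry κ)) {c : α → Config X} (hc : Measurable c) :
    Measurable fun a => thin (κ a) (c a) :=
  measurable_cnt (Config.measurable_points.comp hc) (measurable_sel hκ hc)

lemma Measurable.set_diff {α : Type*} [MeasurableSpace α] {S T : α → Set ℕ} (hS : Measurable S)
    (hT : Measurable T) : Measurable fun a => S a \ T a :=
  measurable_set_iff.2 fun m => (measurable_set_iff.1 hS m).and (measurable_set_iff.1 hT m).not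

/-- The integrand of the Laplace functional of a thinned and coloured Poisson process: a point
is red with probability `κ`, blue with probability `ρ - κ`, and removed otherwise. -/
lemma sub_mixture {κ ρ e₁ e₂ : ℝ≥0∞} (hκ : κ ≤ ρ) (hρ : ρ ≤ 1) (h₁ : e₁ ≤ 1) (h₂ : e₂ ≤ 1) :
    1 - (κ * e₁ + (ρ - κ) * e₂ + (1 - ρ)) = κ * (1 - e₁) + (ρ - κ) * (1 - e₂) := by
  have key : κ * (1 - e₁) + (ρ - κ) * (1 - e₂) + (κ * e₁ + (ρ - κ) * e₂ + (1 - ρ)) = 1 := by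
    have : κ * (1 - e₁) + (ρ - κ) * (1 - e₂) + (κ * e₁ + (ρ - κ) * e₂ + (1 - ρ)) =
        κ * ((1 - e₁) + e₁) + (ρ - κ) * ((1 - e₂) + e₂) + (1 - ρ) := by ring
    rw [this, tsub_add_cancel_of_le h₁, tsub_add_cancel_of_le h₂, mul_one, mul_one,
      add_tsub_cancel_of_le hκ, add_tsub_cancel_of_le hρ]
  refine ENNReal.sub_eq_of_eq_add ?_ key.symm
  refine ne_top_of_le_ne_top ENNReal.one_ne_top (le_add_self.trans key.le)

variable {lam : Measure X} [SigmaFinite lam] {μ μ' : Measure (Config X)}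

/-- The joint Laplace functional of the points kept with probability `κ`, and of the additional
points kept with probability `ρ`. -/
theorem IsRCMLaw.lintegral_nexp_sel (h : IsRCMLaw lam μ) {κ ρ : X → ℝ≥0∞} (hκm : Measurable κ)
    (hρm : Measurable ρ) (hκ : κ ≤ ρ) (hρ : ρ ≤ 1) {g₁ g₂ : X → ℝ≥0∞} (h₁ : Measurable g₁)
    (h₂ : Measurable g₂) :
    ∫⁻ c, nexp (∫⁻ z, g₁ z ∂cnt c.points (sel κ c)) *
        nexp (∫⁻ z, g₂ z ∂cnt c.points (sel ρ c \ sel κ c)) ∂μ =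
      nexp (∫⁻ z, (κ z * (1 - nexp (g₁ z)) + (ρ z - κ z) * (1 - nexp (g₂ z))) ∂lam) := by
  classical
  have hsel : ∀ {κ : X → ℝ≥0∞}, Measurable κ → Measurable fun c : Config X => sel κ c :=
    fun hκ => measurable_sel (κ := fun _ => _) (hκ.comp measurable_snd) measurable_id
  rw [h.resample]
  swap
  · refine Measurable.mul ?_ ?_
    · exact measurable_nexp.comp ((measurable_cnt Config.measurable_points
        (hsel hκm)).lintegral_measure h₁)
    · exact measurable_nexp.comp ((measurable_cnt Config.measurable_points
        ((hsel hρm).set_diff (hsel hκm))).lintegral_measure h₂)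
  let G : X → ℝ≥0∞ := fun z =>
    nlog (κ z * nexp (g₁ z) + (ρ z - κ z) * nexp (g₂ z) + (1 - ρ z))
  have hG : Measurable G := by fun_prop
  have hmix : ∀ z, κ z * nexp (g₁ z) + (ρ z - κ z) * nexp (g₂ z) + (1 - ρ z) ≤ 1 := fun z =>
    calc κ z * nexp (g₁ z) + (ρ z - κ z) * nexp (g₂ z) + (1 - ρ z)
        ≤ κ z * 1 + (ρ z - κ z) * 1 + (1 - ρ z) := by gcongr <;> exact nexp_le_one _
      _ = 1 := by rw [mul_one, mul_one, add_tsub_cancel_of_le (hκ z),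
        add_tsub_cancel_of_le (show ρ z ≤ 1 from hρ z)]
  -- For fixed points the marks of different points are independent.
  have hinner : ∀ c : Config X, ∫⁻ Z, nexp (∫⁻ z, g₁ z ∂cnt (Config.points (c.1, c.2.1, Z))
        (sel κ (c.1, c.2.1, Z))) * nexp (∫⁻ z, g₂ z ∂cnt (Config.points (c.1, c.2.1, Z))
        (sel ρ (c.1, c.2.1, Z) \ sel κ (c.1, c.2.1, Z))) ∂markLaw =
      nexp (∫⁻ z, G z ∂c.eta) := by
    intro c
    let i : ℕ → MarkIndex := fun m => ⟨(0, m + 1), Nat.succ_pos m⟩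
    let A : ℕ → Set (MarkIndex → ℝ) := fun m => {Z | ENNReal.ofReal (Z (i m)) ≤ κ (c.points m)}
    let B : ℕ → Set (MarkIndex → ℝ) := fun m => {Z | ENNReal.ofReal (Z (i m)) ≤ ρ (c.points m)}
    have hAm : ∀ m, MeasurableSet (A m) := fun m => measurableSet_le (by fun_prop) measurable_const
    have hBm : ∀ m, MeasurableSet (B m) := fun m => measurableSet_le (by fun_prop) measurable_const
    have hAB : ∀ m, A m ⊆ B m := fun m Z hZ => le_trans (show _ ≤ _ from hZ) (hκ _)
    let w : ℕ → (MarkIndex → ℝ) → ℝ≥0∞ := fun m Z => if (m : ℕ∞) < c.count then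
      (if Z ∈ A m then g₁ (c.points m) else if Z ∈ B m then g₂ (c.points m) else 0) else 0
    have hw : ∀ m, Measurable (w m) := fun m => by
      refine Measurable.ite (MeasurableSet.const _) (Measurable.ite (hAm m) measurable_const
        (Measurable.ite (hBm m) measurable_const measurable_const)) measurable_const
    have key := Measure.lintegral_nexp_tsum_blocks (fun _ : MarkIndex => unif)
      (J := fun m => {i m}) (w := w)
      (fun m n hmn => by
        refine Set.disjoint_singleton.2 fun he => hmn ?_
        simpa [i] using he) hw (fun m b b' hb => by
        have hb' : b (i m) = b' (i m) := hb _ rfl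
        have a1 : b ∈ A m ↔ b' ∈ A m := by simp only [A, mem_ofPred_eq, hb']
        have a2 : b ∈ B m ↔ b' ∈ B m := by simp only [B, mem_ofPred_eq, hb']
        simp only [w, a1, a2])
    have e1 : ∀ Z, nexp (∫⁻ z, g₁ z ∂cnt (Config.points (c.1, c.2.1, Z))
        (sel κ (c.1, c.2.1, Z))) * nexp (∫⁻ z, g₂ z ∂cnt (Config.points (c.1, c.2.1, Z))
        (sel ρ (c.1, c.2.1, Z) \ sel κ (c.1, c.2.1, Z))) = nexp (∑' m, w m Z) := by
      intro Z
      rw [lintegral_cnt _ _ h₁, lintegral_cnt _ _ h₂, ← nexp_add, ← ENNReal.tsum_add]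
      congr 1
      refine tsum_congr fun m => ?_
      have a0 : Config.points (c.1, c.2.1, Z) m = c.points m := rfl
      have a1 : m ∈ sel κ (c.1, c.2.1, Z) ↔ (m : ℕ∞) < c.count ∧ Z ∈ A m := Iff.rfl
      have a2 : m ∈ sel ρ (c.1, c.2.1, Z) ↔ (m : ℕ∞) < c.count ∧ Z ∈ B m := Iff.rfl
      simp only [indicator_apply, mem_sdiff, a0, a1, a2, w]
      by_cases b0 : (m : ℕ∞) < c.count
      · by_cases b1 : Z ∈ A m
        · simp [b0, b1, hAB m b1]
        · by_cases b2 : Z ∈ B m <;> simp [b0, b1, b2]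
      · simp [b0]
    simp_rw [e1]
    rw [Config.eta_eq_cnt, lintegral_cnt _ _ hG, markLaw, key]
    congr 1
    refine tsum_congr fun m => ?_
    by_cases b0 : (m : ℕ∞) < c.count
    · rw [indicator_of_mem (by exact b0)]
      congr 1
      have e2 : ∀ Z, nexp (w m Z) = (A m).indicator (fun _ => nexp (g₁ (c.points m))) Z +
          ((B m \ A m).indicator (fun _ => nexp (g₂ (c.points m))) Z +
          (B m)ᶜ.indicator (fun _ => 1) Z) := by
        intro Z
        by_cases b1 : Z ∈ A m
        · simp [w, b0, b1, hAB m b1]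
        · by_cases b2 : Z ∈ B m <;> simp [w, b0, b1, b2]
      have m1 : markLaw (A m) = κ (c.points m) :=
        (markLaw_coord (i m) (measurableSet_le (by fun_prop) measurable_const)).trans
          (unif_ofReal_le ((hκ _).trans (hρ _)))
      have m2 : markLaw (B m) = ρ (c.points m) :=
        (markLaw_coord (i m) (measurableSet_le (by fun_prop) measurable_const)).trans
          (unif_ofReal_le (hρ _))
      simp_rw [e2]
      rw [lintegral_add_left (measurable_const.indicator (hAm m)),
        lintegral_add_left (measurable_const.indicator ((hBm m).diff (hAm m))),
        lintegral_indicator_const (hAm m), lintegral_indicator_const ((hBm m).diff (hAm m)),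
        lintegral_indicator_const (hBm m).compl, ← markLaw,
        measure_sdiff (hAB m) (hAm m).nullMeasurableSet (measure_ne_top _ _),
        measure_compl (hBm m) (measure_ne_top _ _), measure_univ, m1, m2, ← add_assoc]
      simp only [mul_comm, one_mul]
    · rw [indicator_of_notMem (by exact b0)]
      simp only [w, b0, if_false, nexp_zero, lintegral_const, measure_univ, mul_one]
      rw [← nexp_zero, nlog_nexp]
  simp_rw [hinner]
  rw [h.laplace G hG]
  congr 1
  refine lintegral_congr fun z => ?_
  rw [nexp_nlog (hmix z), sub_mixture (hκ z) (hρ z) (nexp_le_one _) (nexp_le_one _)]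

/-- The `κ`-thinning of the Poisson process is a Poisson process with intensity `κ • lam`. -/
theorem IsRCMLaw.lintegral_nexp_thin (h : IsRCMLaw lam μ) {κ : X → ℝ≥0∞} (hκm : Measurable κ)
    (hκ : κ ≤ 1) {g : X → ℝ≥0∞} (hg : Measurable g) :
    ∫⁻ c, nexp (∫⁻ z, g z ∂thin κ c) ∂μ = nexp (∫⁻ z, κ z * (1 - nexp (g z)) ∂lam) := by
  have := h.lintegral_nexp_sel hκm hκm le_rfl hκ hg measurable_zero
  simpa [thin] using this

lemma IsRCMLaw.tame_thin (h : IsRCMLaw lam μ) : ∀ᵐ c ∂μ, ∀ κ, Tame lam (thin κ c) :=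
  h.tame.mono fun _ hc _ => hc.mono (thin_le_eta _ _)

/-- The kept and the discarded points of a thinning are independent Poisson processes. -/
theorem IsRCMLaw.lintegral_sel (h' : IsRCMLaw lam μ') (h : IsRCMLaw lam μ) {κ ρ : X → ℝ≥0∞}
    (hκm : Measurable κ) (hρm : Measurable ρ) (hκ : κ ≤ ρ) (hρ : ρ ≤ 1)
    {G : Measure X → Measure X → ℝ≥0∞} (hG : Measurable (Function.uncurry G)) :
    ∫⁻ c, G (cnt c.points (sel κ c)) (cnt c.points (sel ρ c \ sel κ c)) ∂μ' =
      ∫⁻ c, ∫⁻ c', G (thin κ c) (thin (ρ - κ) c') ∂μ ∂μ := by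
  have := h.prob
  have := h'.prob
  have hsel : ∀ {κ : X → ℝ≥0∞}, Measurable κ → Measurable fun c : Config X => sel κ c :=
    fun hκ => measurable_sel (κ := fun _ => _) (hκ.comp measurable_snd) measurable_id
  have hthin : ∀ {κ : X → ℝ≥0∞}, Measurable κ → Measurable fun c : Config X => thin κ c :=
    fun hκ => measurable_thin (κ := fun _ => _) (hκ.comp measurable_snd) measurable_id
  have hdm : Measurable (ρ - κ) := hρm.sub hκm
  let f₁ : Config X → Unit × Measure X × Measure X := fun c =>
    ((), cnt c.points (sel κ c), cnt c.points (sel ρ c \ sel κ c))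
  let f₂ : Config X × Config X → Unit × Measure X × Measure X := fun p =>
    ((), thin κ p.1, thin (ρ - κ) p.2)
  have hf₁ : Measurable f₁ := measurable_const.prodMk
    ((measurable_cnt Config.measurable_points (hsel hκm)).prodMk
      (measurable_cnt Config.measurable_points ((hsel hρm).set_diff (hsel hκm))))
  have hf₂ : Measurable f₂ := measurable_const.prodMk
    (((hthin hκm).comp measurable_fst).prodMk ((hthin hdm).comp measurable_snd))
  have hm₁ : IsProbabilityMeasure (μ'.map f₁) := Measure.isProbabilityMeasure_map hf₁.aemeasurable
  have hm₂ : IsProbabilityMeasure ((μ.prod μ).map f₂) :=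
    Measure.isProbabilityMeasure_map hf₂.aemeasurable
  have key : μ'.map f₁ = (μ.prod μ).map f₂ := by
    refine Measure.ext_of_laplace fun B hB g₁ g₂ h₁ h₂ => ?_
    have hF : Measurable fun p : Unit × Measure X × Measure X => B.indicator (1 : Unit → ℝ≥0∞) p.1 *
        (nexp (∫⁻ x, g₁ x ∂p.2.1) * nexp (∫⁻ x, g₂ x ∂p.2.2)) := by
      have := (measurable_one (α := ℝ≥0∞)).indicator hB
      fun_prop
    rw [lintegral_map hF hf₁, lintegral_map hF hf₂]
    simp only [f₁, f₂]
    rw [lintegral_const_mul _ (by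
        refine Measurable.mul ?_ ?_
        · exact measurable_nexp.comp ((measurable_cnt Config.measurable_points
            (hsel hκm)).lintegral_measure h₁)
        · exact measurable_nexp.comp ((measurable_cnt Config.measurable_points
            ((hsel hρm).set_diff (hsel hκm))).lintegral_measure h₂)),
      lintegral_const_mul _ (by
        refine Measurable.mul ?_ ?_
        · exact measurable_nexp.comp (((hthin hκm).comp measurable_fst).lintegral_measure h₁)
        · exact measurable_nexp.comp (((hthin hdm).comp measurable_snd).lintegral_measure h₂)),
      h'.lintegral_nexp_sel hκm hρm hκ hρ h₁ h₂,
      lintegral_prod_mul (f := fun c => nexp (∫⁻ x, g₁ x ∂thin κ c))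
        (g := fun c => nexp (∫⁻ x, g₂ x ∂thin (ρ - κ) c))
        (measurable_nexp.comp ((hthin hκm).lintegral_measure h₁)).aemeasurable
        (measurable_nexp.comp ((hthin hdm).lintegral_measure h₂)).aemeasurable,
      h.lintegral_nexp_thin hκm (hκ.trans hρ) h₁,
      h.lintegral_nexp_thin hdm (fun z => tsub_le_self.trans (hρ z)) h₂, ← nexp_add,
      ← lintegral_add_left (by fun_prop)]
    rfl
  have hG' : Measurable fun p : Unit × Measure X × Measure X => G p.2.1 p.2.2 :=
    hG.comp measurable_snd
  calc ∫⁻ c, G (cnt c.points (sel κ c)) (cnt c.points (sel ρ c \ sel κ c)) ∂μ'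
      = ∫⁻ p, G p.2.1 p.2.2 ∂μ'.map f₁ := (lintegral_map hG' hf₁).symm
    _ = ∫⁻ p, G p.2.1 p.2.2 ∂(μ.prod μ).map f₂ := by rw [key]
    _ = ∫⁻ p : Config X × Config X, G (thin κ p.1) (thin (ρ - κ) p.2) ∂μ.prod μ :=
        lintegral_map hG' hf₂
    _ = _ := lintegral_prod _ (hG'.comp hf₂).aemeasurable

/-- The superposition of independent Poisson processes. -/
theorem IsRCMLaw.lintegral_thin_add (h : IsRCMLaw lam μ) {κ ρ : X → ℝ≥0∞}
    (hκm : Measurable κ) (hρm : Measurable ρ) (hκ : κ ≤ ρ) (hρ : ρ ≤ 1)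
    {G : Measure X → ℝ≥0∞} (hG : Measurable G) :
    ∫⁻ c, G (thin ρ c) ∂μ = ∫⁻ c, ∫⁻ c', G (thin κ c + thin (ρ - κ) c') ∂μ ∂μ := by
  rw [← h.lintegral_sel h hκm hρm hκ hρ (G := fun χ χ' => G (χ + χ'))
    (hG.comp (measurable_fst.add measurable_snd))]
  refine lintegral_congr fun c => ?_
  rw [← cnt_union _ disjoint_sdiff_right, union_sdiff_cancel (sel_mono hκ c)]
  rfl

end Law

/-! ### The exploration as a Markov chain -/

section Explore

/-- The density `ρ (1 - a)` of the points that are hit, for the density `ρ` of the available points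
and the probability `a` of avoiding a hit. -/
def hit {X : Type*} (ρ a : X → ℝ≥0∞) : X → ℝ≥0∞ := fun z => ρ z - ρ z * a z

section Hit

variable {X : Type*} {ρ a : X → ℝ≥0∞}

lemma hit_le (ρ a : X → ℝ≥0∞) : hit ρ a ≤ ρ := fun _ => tsub_le_self

lemma mul_le_one_fun (hρ : ρ ≤ 1) (ha : a ≤ 1) : ρ * a ≤ 1 := fun z => mul_le_one' (hρ z) (ha z)

lemma sub_hit (hρ : ρ ≤ 1) (ha : a ≤ 1) : ρ - hit ρ a = ρ * a := by
  ext z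
  refine ENNReal.sub_sub_cancel ((hρ z).trans_lt ENNReal.one_lt_top).ne ?_
  exact mul_le_of_le_one_right zero_le (ha z)

/-- The points that are hit increase with the available points and with the hitting probability. -/
lemma hit_mono {ρ' a' : X → ℝ≥0∞} (hρ' : ρ' ≤ 1) (hρ : ρ ≤ ρ') (ha' : a' ≤ 1) (ha : a' ≤ a) :
    hit ρ a ≤ hit ρ' a' := by
  intro z
  have h1 : a' z ≤ 1 := ha' z
  have h2 : ρ' z ≠ ∞ := ((hρ' z).trans_lt ENNReal.one_lt_top).ne
  have h3 : ρ z ≠ ∞ := ne_top_of_le_ne_top h2 (hρ z)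
  have e1 : ∀ r : ℝ≥0∞, r ≠ ∞ → r - r * a' z = r * (1 - a' z) := fun r hr => by
    rw [ENNReal.mul_sub (fun _ _ => hr), mul_one]
  calc ρ z - ρ z * a z ≤ ρ z - ρ z * a' z := tsub_le_tsub_left (mul_le_mul_right (ha z) _) _
    _ = ρ z * (1 - a' z) := e1 _ h3
    _ ≤ ρ' z * (1 - a' z) := mul_le_mul_left (hρ z) _
    _ = ρ' z - ρ' z * a' z := (e1 _ h2).symm

lemma measurable_hit {α : Type*} [MeasurableSpace α] {f g : α → ℝ≥0∞} (hf : Measurable f)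
    (hg : Measurable g) : Measurable fun x => f x - f x * g x := by fun_prop

end Hit

variable {X : Type u} [MeasurableSpace X]

/-- The last `s` steps of the exploration, in terms of Poisson processes: the available points have
density `ρ`, the points of `A` are explored next, and `D` collects the points found so far. In each
step the new points form a Poisson process with density `ρ (1 - avoid A)`, independent of the
remaining one with density `ρ (avoid A)`. -/
def chain (lam : Measure X) [SigmaFinite lam] (phi : X → X → ℝ) (μ : Measure (Config X))
    (F : Measure X → Measure X → ℝ≥0∞) : ℕ → (X → ℝ≥0∞) → Measure X → Measure X → ℝ≥0∞
  | 0, _, A, D => F D A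
  | s + 1, ρ, A, D => ∫⁻ c, chain lam phi μ F s (ρ * avoid lam phi A)
      (thin (hit ρ (avoid lam phi A)) c) (D + thin (hit ρ (avoid lam phi A)) c) ∂μ

/-- The numbers of the points found in the first `s` steps, and of those found in the last of
these steps, when starting from `E` with the points of `S` available. -/
def levels (phi : X → X → ℝ) (x : ℕ → X) (Z : MarkIndex → ℝ) :
    ℕ → Set ℕ → Set ℕ → Set ℕ × Set ℕ
  | 0, _, E => (∅, E)
  | s + 1, S, E =>
    (nbr phi x Z S E ∪ (levels phi x Z s (S \ nbr phi x Z S E) (nbr phi x Z S E)).1,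
      (levels phi x Z s (S \ nbr phi x Z S E) (nbr phi x Z S E)).2)

omit [MeasurableSpace X] in
lemma levels_fst_subset (phi : X → X → ℝ) (x : ℕ → X) (Z : MarkIndex → ℝ) (s : ℕ) :
    ∀ S E, (levels phi x Z s S E).1 ⊆ S := by
  induction s with
  | zero => intro S E; exact empty_subset _
  | succ s ih =>
    intro S E
    exact union_subset (nbr_subset _ _ _ _ _) ((ih _ _).trans sdiff_subset)

lemma edge_congr {Z Z' : MarkIndex → ℝ} {U V : Set ℕ}
    (h : ∀ p : MarkIndex, ((p.1.1 ∈ U ∧ p.1.2 ∈ V) ∨ (p.1.1 ∈ V ∧ p.1.2 ∈ U)) → Z p = Z' p)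
    {k n : ℕ} (hk : k ∈ U) (hn : n ∈ V) : edge Z k n = edge Z' k n := by
  unfold edge
  split_ifs
  · exact h _ (Or.inl ⟨hk, hn⟩)
  · exact h _ (Or.inr ⟨hn, hk⟩)
  · rfl

omit [MeasurableSpace X] in
/-- The neighbours of `E` in `S` depend on the marks of the pairs in `E × S` only. -/
lemma nbr_congr (phi : X → X → ℝ) (x : ℕ → X) {Z Z' : MarkIndex → ℝ} {S E : Set ℕ}
    (h : ∀ p : MarkIndex, ((p.1.1 ∈ E ∧ p.1.2 ∈ S) ∨ (p.1.1 ∈ S ∧ p.1.2 ∈ E)) → Z p = Z' p) :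
    nbr phi x Z S E = nbr phi x Z' S E := by
  ext n
  refine and_congr_right fun hn => exists_congr fun k => and_congr_right fun hk => ?_
  rw [edge_congr h hk hn]

omit [MeasurableSpace X] in
/-- The levels depend on the marks of the pairs of points in `S ∪ E` only. -/
lemma levels_congr (phi : X → X → ℝ) (x : ℕ → X) {Z Z' : MarkIndex → ℝ} {U : Set ℕ}
    (h : ∀ p : MarkIndex, p.1.1 ∈ U → p.1.2 ∈ U → Z p = Z' p) (s : ℕ) :
    ∀ S E, S ⊆ U → E ⊆ U → levels phi x Z s S E = levels phi x Z' s S E := by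
  induction s with
  | zero => intros; rfl
  | succ s ih =>
    intro S E hS hE
    have e : nbr phi x Z S E = nbr phi x Z' S E := nbr_congr phi x fun p hp => by
      rcases hp with hp | hp
      · exact h p (hE hp.1) (hS hp.2)
      · exact h p (hS hp.1) (hE hp.2)
    simp only [levels]
    rw [e, ih _ _ (sdiff_subset.trans hS) ((nbr_subset _ _ _ _ _).trans hS)]

variable {lam : Measure X} [SigmaFinite lam] {phi : X → X → ℝ} {μ : Measure (Config X)}

lemma Measurable.set_union {α : Type*} [MeasurableSpace α] {S T : α → Set ℕ} (hS : Measurable S)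
    (hT : Measurable T) : Measurable fun a => S a ∪ T a :=
  measurable_set_iff.2 fun m => (measurable_set_iff.1 hS m).or (measurable_set_iff.1 hT m)

lemma measurable_levels (hphi : Measurable fun p : X × X => phi p.1 p.2) {α : Type*}
    [MeasurableSpace α] {x : α → ℕ → X} {Z : α → MarkIndex → ℝ} (hx : Measurable x)
    (hZ : Measurable Z) (s : ℕ) : ∀ {S E : α → Set ℕ}, Measurable S → Measurable E →
    Measurable (fun a => (levels phi (x a) (Z a) s (S a) (E a)).1) ∧
    Measurable (fun a => (levels phi (x a) (Z a) s (S a) (E a)).2) := by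
  induction s with
  | zero => intro S E hS hE; exact ⟨measurable_const, hE⟩
  | succ s ih =>
    intro S E hS hE
    have hn := measurable_nbr hphi hx hZ hS hE
    have := ih (hS.set_diff hn) hn
    exact ⟨hn.set_union this.1, this.2⟩

lemma measurable_chain [IsProbabilityMeasure μ] (hphi : Measurable fun p : X × X => phi p.1 p.2)
    {F : Measure X → Measure X → ℝ≥0∞} (hF : Measurable (Function.uncurry F)) (s : ℕ) :
    ∀ {α : Type u} [MeasurableSpace α] {ρ : α → X → ℝ≥0∞}, Measurable (Function.uncurry ρ) →
    ∀ {A D : α → Measure X}, Measurable A → Measurable D →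
    Measurable fun a => chain lam phi μ F s (ρ a) (A a) (D a) := by
  induction s with
  | zero => intro α _ ρ hρ A D hA hD; exact hF.comp (hD.prodMk hA)
  | succ s ih =>
    intro α _ ρ hρ A D hA hD
    have ha : Measurable fun p : α × X => avoid lam phi (A p.1) p.2 :=
      measurable_avoid hphi (hA.comp measurable_fst) measurable_snd
    have hh : Measurable (Function.uncurry fun a => hit (ρ a) (avoid lam phi (A a))) :=
      measurable_hit hρ ha
    have hth : Measurable fun p : α × Config X => thin (hit (ρ p.1) (avoid lam phi (A p.1))) p.2 :=
      measurable_thin (κ := fun p : α × Config X => hit (ρ p.1) (avoid lam phi (A p.1)))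
        (hh.comp ((measurable_fst.comp measurable_fst).prodMk measurable_snd)) measurable_snd
    have hr : Measurable (Function.uncurry fun p : α × Config X =>
        ρ p.1 * avoid lam phi (A p.1)) :=
      (hρ.mul ha).comp ((measurable_fst.comp measurable_fst).prodMk measurable_snd)
    have := ih hr hth ((hD.comp measurable_fst).add hth)
    exact this.lintegral_prod_right'

/-- A random enumerated set `S` of points, which forms a Poisson process with density `ρ θ` with
respect to `lam`, conditionally on `θ`. -/
def CondPoisson {Ω Θ : Type*} [MeasurableSpace Ω] [MeasurableSpace Θ] (μ : Measure (Config X))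
    (π : Measure Ω) (θ : Ω → Θ) (x : Ω → ℕ → X) (S : Ω → Set ℕ) (ρ : Θ → X → ℝ≥0∞) : Prop :=
  ∀ G : Θ → Measure X → ℝ≥0∞, Measurable (Function.uncurry G) →
    ∫⁻ ω, G (θ ω) (cnt (x ω) (S ω)) ∂π = ∫⁻ ω, ∫⁻ c, G (θ ω) (thin (ρ (θ ω)) c) ∂μ ∂π

section Colour

variable {Ω Θ : Type*} [MeasurableSpace Ω] [MeasurableSpace Θ] {π : Measure Ω}
  {θ : Ω → Θ} {x : Ω → ℕ → X} {S E : Ω → Set ℕ} {ρ : Θ → X → ℝ≥0∞} {A : Θ → Measure X}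

lemma CondPoisson.ae_tame (h : IsRCMLaw lam μ) (H : CondPoisson μ π θ x S ρ)
    (hx : Measurable x) (hS : Measurable S) : ∀ᵐ ω ∂π, Tame lam (cnt (x ω) (S ω)) := by
  have hT : MeasurableSet {χ : Measure X | Tame lam χ}ᶜ := measurableSet_tame.compl
  have h1 := H (fun _ χ => {χ : Measure X | Tame lam χ}ᶜ.indicator 1 χ)
    ((measurable_one.indicator hT).comp measurable_snd)
  have h2 : ∀ θ', ∫⁻ c, {χ : Measure X | Tame lam χ}ᶜ.indicator (1 : Measure X → ℝ≥0∞)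
      (thin (ρ θ') c) ∂μ = 0 := fun θ' => by
    refine (lintegral_congr_ae (h.tame_thin.mono fun c hc => ?_)).trans lintegral_zero
    exact indicator_of_notMem (show thin (ρ θ') c ∉ {χ | Tame lam χ}ᶜ from fun h' => h' (hc _)) _
  simp_rw [h2, lintegral_zero] at h1
  have hm : Measurable fun ω => {χ : Measure X | Tame lam χ}ᶜ.indicator (1 : Measure X → ℝ≥0∞)
      (cnt (x ω) (S ω)) := (measurable_one.indicator hT).comp (measurable_cnt hx hS)
  rw [lintegral_eq_zero_iff hm] at h1
  filter_upwards [h1] with ω hω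
  by_contra hn
  rw [indicator_of_mem (by exact hn)] at hω
  exact one_ne_zero hω

lemma measurable_thin_const {κ : X → ℝ≥0∞} (hκ : Measurable κ) :
    Measurable fun c : Config X => thin κ c :=
  measurable_thin (κ := fun _ => κ) (hκ.comp measurable_snd) measurable_id

/-- Colouring the points of an `r`-thinning independently with probabilities `1 - a` and `a` gives
two independent thinnings, in terms of Laplace functionals. -/
lemma IsRCMLaw.lintegral_nexp_thin_colour (h : IsRCMLaw lam μ) {r a : X → ℝ≥0∞}
    (hr : Measurable r) (hr1 : r ≤ 1) (ha : Measurable a) (ha1 : a ≤ 1) {g₁ g₂ : X → ℝ≥0∞}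
    (h₁ : Measurable g₁) (h₂ : Measurable g₂) :
    ∫⁻ c, nexp (∫⁻ z, nlog ((1 - a z) * nexp (g₁ z) + a z * nexp (g₂ z)) ∂thin r c) ∂μ =
      (∫⁻ c, nexp (∫⁻ z, g₁ z ∂thin (hit r a) c) ∂μ) *
        ∫⁻ c, nexp (∫⁻ z, g₂ z ∂thin (r * a) c) ∂μ := by
  have hhm : Measurable (hit r a) := measurable_hit hr ha
  rw [h.lintegral_nexp_thin hr hr1 (by fun_prop),
    h.lintegral_nexp_thin hhm ((hit_le _ _).trans hr1) h₁,
    h.lintegral_nexp_thin (hr.mul ha) (mul_le_one_fun hr1 ha1) h₂,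
    ← nexp_add, ← lintegral_add_left (by fun_prop)]
  congr 1
  refine lintegral_congr fun z => ?_
  have a1 : a z ≤ 1 := ha1 z
  have s1 := sub_mixture (κ := 1 - a z) (ρ := 1) tsub_le_self le_rfl
    (nexp_le_one (g₁ z)) (nexp_le_one (g₂ z))
  rw [tsub_self, add_zero, ENNReal.sub_sub_cancel ENNReal.one_ne_top a1] at s1
  have le1 : (1 - a z) * nexp (g₁ z) + a z * nexp (g₂ z) ≤ 1 :=
    calc _ ≤ (1 - a z) * 1 + a z * 1 := by gcongr <;> exact nexp_le_one _
      _ = 1 := by rw [mul_one, mul_one, tsub_add_cancel_of_le a1]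
  rw [nexp_nlog le1, s1, mul_add, ← mul_assoc, ← mul_assoc,
    ENNReal.mul_sub (fun _ _ => ((hr1 z).trans_lt ENNReal.one_lt_top).ne), mul_one]
  rfl

/-- The colouring theorem below, for products of exponentials: given the points, the marks give
the integrand of `IsRCMLaw.lintegral_nexp_thin_colour`. -/
lemma CondPoisson.lintegral_nexp_colour (h : IsRCMLaw lam μ)
    (hphi : Measurable fun p : X × X => phi p.1 p.2) (hunit : ∀ x y, phi x y ∈ Icc (0 : ℝ) 1)
    (H : CondPoisson μ π θ x S ρ) (hx : Measurable x) (hS : Measurable S)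
    (hSE : ∀ ω, Disjoint (S ω) (E ω)) (hρ : Measurable (Function.uncurry ρ))
    (hρ1 : ∀ θ', ρ θ' ≤ 1) (hA : Measurable A)
    (hAE : ∀ᵐ ω ∂π, A (θ ω) = cnt (x ω) (E ω) ∧ Tame lam (cnt (x ω) (E ω)))
    {B : Set Θ} (hB : MeasurableSet B) {g₁ g₂ : X → ℝ≥0∞} (h₁ : Measurable g₁)
    (h₂ : Measurable g₂) :
    ∫⁻ ω, ∫⁻ Z, B.indicator 1 (θ ω) *
        (nexp (∫⁻ z, g₁ z ∂cnt (x ω) (nbr phi (x ω) Z (S ω) (E ω))) *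
          nexp (∫⁻ z, g₂ z ∂cnt (x ω) (S ω \ nbr phi (x ω) Z (S ω) (E ω)))) ∂markLaw ∂π =
      ∫⁻ ω, B.indicator 1 (θ ω) *
        ((∫⁻ c, nexp (∫⁻ z, g₁ z ∂thin (hit (ρ (θ ω)) (avoid lam phi (A (θ ω)))) c) ∂μ) *
        ∫⁻ c, nexp (∫⁻ z, g₂ z ∂thin (ρ (θ ω) * avoid lam phi (A (θ ω))) c) ∂μ) ∂π := by
  have ha : Measurable fun p : Θ × X => avoid lam phi (A p.1) p.2 :=
    measurable_avoid hphi (hA.comp measurable_fst) measurable_snd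
  obtain ⟨Γ, hΓe⟩ : ∃ Γ : Θ → X → ℝ≥0∞, ∀ t z, Γ t z =
      nlog ((1 - avoid lam phi (A t) z) * nexp (g₁ z) + avoid lam phi (A t) z * nexp (g₂ z)) :=
    ⟨_, fun _ _ => rfl⟩
  have hΓ : Measurable (Function.uncurry Γ) := by
    have m1 : Measurable fun p : Θ × X => nexp (g₁ p.2) := by fun_prop
    have m2 : Measurable fun p : Θ × X => nexp (g₂ p.2) := by fun_prop
    simp only [Function.uncurry_def, hΓe]
    exact measurable_nlog.comp (((measurable_const.sub ha).mul m1).add (ha.mul m2))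
  have hΓt : ∀ t, Measurable (Γ t) := fun t => hΓ.of_uncurry_left
  -- `Γ` is integrated against the tame part of the measure, for the sake of measurability.
  let G : Θ → Measure X → ℝ≥0∞ := fun t χ =>
    B.indicator 1 t * nexp (∫⁻ z, Γ t z ∂tameKernel lam χ)
  have hG : Measurable (Function.uncurry G) := by
    refine Measurable.mul (((measurable_one (α := ℝ≥0∞)).indicator hB).comp measurable_fst) ?_
    refine measurable_nexp.comp (Measurable.lintegral_tameKernel
      (g := fun p : Θ × Measure X => Γ p.1) ?_ measurable_snd)
    exact hΓ.comp ((measurable_fst.comp measurable_fst).prodMk measurable_snd)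
  have hL : ∀ᵐ ω ∂π, ∫⁻ Z, B.indicator 1 (θ ω) *
      (nexp (∫⁻ z, g₁ z ∂cnt (x ω) (nbr phi (x ω) Z (S ω) (E ω))) *
        nexp (∫⁻ z, g₂ z ∂cnt (x ω) (S ω \ nbr phi (x ω) Z (S ω) (E ω)))) ∂markLaw =
      G (θ ω) (cnt (x ω) (S ω)) := by
    filter_upwards [hAE, H.ae_tame h hx hS] with ω hω hω'
    have m0 : Measurable fun Z => nbr phi (x ω) Z (S ω) (E ω) :=
      measurable_nbr hphi measurable_const measurable_id measurable_const measurable_const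
    have m1 : Measurable fun Z =>
        nexp (∫⁻ z, g₁ z ∂cnt (x ω) (nbr phi (x ω) Z (S ω) (E ω))) *
        nexp (∫⁻ z, g₂ z ∂cnt (x ω) (S ω \ nbr phi (x ω) Z (S ω) (E ω))) :=
      (measurable_nexp.comp ((measurable_cnt measurable_const m0).lintegral_measure h₁)).mul
        (measurable_nexp.comp ((measurable_cnt measurable_const
          (measurable_const.set_diff m0)).lintegral_measure h₂))
    rw [lintegral_const_mul _ m1,
      lintegral_nexp_nbr hunit (x ω) (hSE ω) (a := avoid lam phi (A (θ ω)))
        (ha.comp (measurable_const.prodMk measurable_id))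
        (fun z => by rw [hω.1]; exact avoid_cnt hphi hω.2 z) h₁ h₂]
    simp only [← hΓe]
    show _ = B.indicator 1 (θ ω) * nexp (∫⁻ z, Γ (θ ω) z ∂tameKernel lam (cnt (x ω) (S ω)))
    rw [tameKernel_apply hω']
  refine (lintegral_congr_ae hL).trans ((H G hG).trans (lintegral_congr fun ω => ?_))
  have hρm : Measurable (ρ (θ ω)) := hρ.comp (measurable_const.prodMk measurable_id)
  have ham : Measurable (avoid lam phi (A (θ ω))) :=
    ha.comp (measurable_const.prodMk measurable_id)
  have e1 : ∫⁻ c, G (θ ω) (thin (ρ (θ ω)) c) ∂μ =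
      ∫⁻ c, B.indicator 1 (θ ω) * nexp (∫⁻ z, Γ (θ ω) z ∂thin (ρ (θ ω)) c) ∂μ :=
    lintegral_congr_ae (h.tame_thin.mono fun c hc => by
      show _ * nexp (∫⁻ z, _ ∂tameKernel lam _) = _
      rw [tameKernel_apply (hc _)])
  have q1 := measurable_nexp.comp ((measurable_thin_const hρm).lintegral_measure (hΓt (θ ω)))
  rw [e1, lintegral_const_mul _ (by exact q1)]
  congr 1
  simp only [hΓe]
  exact h.lintegral_nexp_thin_colour hρm (hρ1 _) ham (fun z => avoid_le_one _ _ _) h₁ h₂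

/-- Colouring theorem: conditionally on `θ`, the points that are joined to `E` and the remaining
ones are independent Poisson processes. -/
theorem CondPoisson.colour (h : IsRCMLaw lam μ) [IsProbabilityMeasure π]
    (hphi : Measurable fun p : X × X => phi p.1 p.2) (hunit : ∀ x y, phi x y ∈ Icc (0 : ℝ) 1)
    (H : CondPoisson μ π θ x S ρ) (hθ : Measurable θ) (hx : Measurable x) (hS : Measurable S)
    (hE : Measurable E) (hSE : ∀ ω, Disjoint (S ω) (E ω)) (hρ : Measurable (Function.uncurry ρ))
    (hρ1 : ∀ θ', ρ θ' ≤ 1) (hA : Measurable A)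
    (hAE : ∀ᵐ ω ∂π, A (θ ω) = cnt (x ω) (E ω) ∧ Tame lam (cnt (x ω) (E ω)))
    {G : Θ → Measure X → Measure X → ℝ≥0∞}
    (hG : Measurable fun p : Θ × Measure X × Measure X => G p.1 p.2.1 p.2.2) :
    ∫⁻ ω, ∫⁻ Z, G (θ ω) (cnt (x ω) (nbr phi (x ω) Z (S ω) (E ω)))
        (cnt (x ω) (S ω \ nbr phi (x ω) Z (S ω) (E ω))) ∂markLaw ∂π =
      ∫⁻ ω, ∫⁻ c, ∫⁻ c', G (θ ω) (thin (hit (ρ (θ ω)) (avoid lam phi (A (θ ω)))) c)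
        (thin (ρ (θ ω) * avoid lam phi (A (θ ω))) c') ∂μ ∂μ ∂π := by
  have := h.prob
  have ha : Measurable fun p : Θ × X => avoid lam phi (A p.1) p.2 :=
    measurable_avoid hphi (hA.comp measurable_fst) measurable_snd
  have hN : Measurable fun q : Ω × (MarkIndex → ℝ) =>
      nbr phi (x q.1) q.2 (S q.1) (E q.1) :=
    measurable_nbr hphi (hx.comp measurable_fst) measurable_snd (hS.comp measurable_fst)
      (hE.comp measurable_fst)
  have hc1 : Measurable fun q : Ω × (MarkIndex → ℝ) =>
      cnt (x q.1) (nbr phi (x q.1) q.2 (S q.1) (E q.1)) :=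
    measurable_cnt (hx.comp measurable_fst) hN
  have hc2 : Measurable fun q : Ω × (MarkIndex → ℝ) =>
      cnt (x q.1) (S q.1 \ nbr phi (x q.1) q.2 (S q.1) (E q.1)) :=
    measurable_cnt (hx.comp measurable_fst) ((hS.comp measurable_fst).set_diff hN)
  have hh : Measurable (Function.uncurry fun t => hit (ρ t) (avoid lam phi (A t))) :=
    measurable_hit hρ ha
  have hra : Measurable (Function.uncurry fun t => ρ t * avoid lam phi (A t)) := hρ.mul ha
  let f₁ : Ω × (MarkIndex → ℝ) → Θ × Measure X × Measure X := fun q =>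
    (θ q.1, cnt (x q.1) (nbr phi (x q.1) q.2 (S q.1) (E q.1)),
      cnt (x q.1) (S q.1 \ nbr phi (x q.1) q.2 (S q.1) (E q.1)))
  have hf₁ : Measurable f₁ := (hθ.comp measurable_fst).prodMk (hc1.prodMk hc2)
  let f₂ : Ω × Config X × Config X → Θ × Measure X × Measure X := fun q =>
    (θ q.1, thin (hit (ρ (θ q.1)) (avoid lam phi (A (θ q.1)))) q.2.1,
      thin (ρ (θ q.1) * avoid lam phi (A (θ q.1))) q.2.2)
  have ht1 : Measurable fun q : Ω × Config X × Config X =>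
      thin (hit (ρ (θ q.1)) (avoid lam phi (A (θ q.1)))) q.2.1 :=
    measurable_thin (κ := fun q : Ω × Config X × Config X =>
        hit (ρ (θ q.1)) (avoid lam phi (A (θ q.1))))
      (hh.comp ((hθ.comp (measurable_fst.comp measurable_fst)).prodMk measurable_snd))
      (measurable_fst.comp measurable_snd)
  have ht2 : Measurable fun q : Ω × Config X × Config X =>
      thin (ρ (θ q.1) * avoid lam phi (A (θ q.1))) q.2.2 :=
    measurable_thin (κ := fun q : Ω × Config X × Config X =>
        ρ (θ q.1) * avoid lam phi (A (θ q.1)))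
      (hra.comp ((hθ.comp (measurable_fst.comp measurable_fst)).prodMk measurable_snd))
      (measurable_snd.comp measurable_snd)
  have hf₂ : Measurable f₂ := (hθ.comp measurable_fst).prodMk (ht1.prodMk ht2)
  have key : (π.prod markLaw).map f₁ = (π.prod (μ.prod μ)).map f₂ := by
    have i1 : IsProbabilityMeasure ((π.prod markLaw).map f₁) :=
      Measure.isProbabilityMeasure_map hf₁.aemeasurable
    have i2 : IsProbabilityMeasure ((π.prod (μ.prod μ)).map f₂) :=
      Measure.isProbabilityMeasure_map hf₂.aemeasurable
    refine Measure.ext_of_laplace fun B hB g₁ g₂ h₁ h₂ => ?_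
    have hF : Measurable fun p : Θ × Measure X × Measure X => B.indicator (1 : Θ → ℝ≥0∞) p.1 *
        (nexp (∫⁻ x, g₁ x ∂p.2.1) * nexp (∫⁻ x, g₂ x ∂p.2.2)) := by
      have := (measurable_one (α := ℝ≥0∞)).indicator hB
      fun_prop
    rw [lintegral_map hF hf₁, lintegral_map hF hf₂]
    refine (lintegral_prod _ (hF.comp hf₁).aemeasurable).trans
      (Eq.trans ?_ (lintegral_prod _ (hF.comp hf₂).aemeasurable).symm)
    simp only [f₁, f₂, Function.comp_apply]
    refine (H.lintegral_nexp_colour h hphi hunit hx hS hSE hρ hρ1 hA hAE hB h₁ h₂).trans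
      (lintegral_congr fun ω => ?_)
    have q2 := measurable_nexp.comp ((measurable_thin_const (X := X)
      (κ := hit (ρ (θ ω)) (avoid lam phi (A (θ ω))))
      (hh.comp (measurable_const.prodMk measurable_id))).lintegral_measure h₁)
    have q3 := measurable_nexp.comp ((measurable_thin_const (X := X)
      (κ := ρ (θ ω) * avoid lam phi (A (θ ω)))
      (hra.comp (measurable_const.prodMk measurable_id))).lintegral_measure h₂)
    rw [lintegral_const_mul _ (by exact (q2.comp measurable_fst).mul (q3.comp measurable_snd))]
    congr 1
    exact (lintegral_prod_mul q2.aemeasurable q3.aemeasurable).symm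
  calc _ = ∫⁻ q, G (f₁ q).1 (f₁ q).2.1 (f₁ q).2.2 ∂π.prod markLaw :=
        (lintegral_prod _ (hG.comp hf₁).aemeasurable).symm
    _ = ∫⁻ p, G p.1 p.2.1 p.2.2 ∂(π.prod markLaw).map f₁ := (lintegral_map hG hf₁).symm
    _ = ∫⁻ p, G p.1 p.2.1 p.2.2 ∂(π.prod (μ.prod μ)).map f₂ := by rw [key]
    _ = ∫⁻ q, G (f₂ q).1 (f₂ q).2.1 (f₂ q).2.2 ∂π.prod (μ.prod μ) := lintegral_map hG hf₂
    _ = _ := by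
      have hGf : Measurable fun q => G (f₂ q).1 (f₂ q).2.1 (f₂ q).2.2 := hG.comp hf₂
      rw [lintegral_prod _ hGf.aemeasurable]
      refine lintegral_congr fun ω => ?_
      exact lintegral_prod _ (hGf.comp (measurable_const.prodMk measurable_id)).aemeasurable

end Colour

end Explore

/-! ### The law of the exploration -/

section ExploreChain

variable {X : Type u} [MeasurableSpace X] {lam : Measure X} [SigmaFinite lam] {phi : X → X → ℝ}
  {μ μ' : Measure (Config X)}

/-- The law of the next generation of the exploration, jointly with `θ`. -/
lemma CondPoisson.lintegral_nbr {Ω Θ : Type*} [MeasurableSpace Ω] [MeasurableSpace Θ]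
    {π : Measure Ω} {θ : Ω → Θ} {x : Ω → ℕ → X} {S E : Ω → Set ℕ} {ρ : Θ → X → ℝ≥0∞}
    {A : Θ → Measure X} (h : IsRCMLaw lam μ) [IsProbabilityMeasure π]
    (hphi : Measurable fun p : X × X => phi p.1 p.2) (hunit : ∀ x y, phi x y ∈ Icc (0 : ℝ) 1)
    (H : CondPoisson μ π θ x S ρ) (hθ : Measurable θ) (hx : Measurable x) (hS : Measurable S)
    (hE : Measurable E) (hSE : ∀ ω, Disjoint (S ω) (E ω)) (hρ : Measurable (Function.uncurry ρ))
    (hρ1 : ∀ θ', ρ θ' ≤ 1) (hA : Measurable A)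
    (hAE : ∀ᵐ ω ∂π, A (θ ω) = cnt (x ω) (E ω) ∧ Tame lam (cnt (x ω) (E ω)))
    {G : Θ → Measure X → ℝ≥0∞} (hG : Measurable (Function.uncurry G)) :
    ∫⁻ ω, ∫⁻ Z, G (θ ω) (cnt (x ω) (nbr phi (x ω) Z (S ω) (E ω))) ∂markLaw ∂π =
      ∫⁻ ω, ∫⁻ c, G (θ ω) (thin (hit (ρ (θ ω)) (avoid lam phi (A (θ ω)))) c) ∂μ ∂π := by
  have := h.prob
  have := H.colour h hphi hunit hθ hx hS hE hSE hρ hρ1 hA hAE (G := fun t χ _ => G t χ)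
    (by exact hG.comp (measurable_fst.prodMk (measurable_fst.comp measurable_snd)))
  simpa using this

/-- The exploration of a random graph whose available points form a Poisson process, by
generations, has the law of the chain of Poisson processes. -/
theorem CondPoisson.explore (h : IsRCMLaw lam μ) (hphi : Measurable fun p : X × X => phi p.1 p.2)
    (hunit : ∀ x y, phi x y ∈ Icc (0 : ℝ) 1) {F : Measure X → Measure X → ℝ≥0∞}
    (hF : Measurable (Function.uncurry F)) (s : ℕ) :
    ∀ {Ω Θ : Type u} [MeasurableSpace Ω] [MeasurableSpace Θ] {π : Measure Ω}
      [IsProbabilityMeasure π] {θ : Ω → Θ} {x : Ω → ℕ → X} {S E : Ω → Set ℕ}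
      {ρ : Θ → X → ℝ≥0∞} {A D : Θ → Measure X},
      CondPoisson μ π θ x S ρ → Measurable θ → Measurable x → Measurable S → Measurable E →
      (∀ ω, Disjoint (S ω) (E ω)) → Measurable (Function.uncurry ρ) → (∀ θ', ρ θ' ≤ 1) →
      Measurable A → Measurable D →
      (∀ᵐ ω ∂π, A (θ ω) = cnt (x ω) (E ω) ∧ Tame lam (cnt (x ω) (E ω))) →
      ∫⁻ ω, ∫⁻ Z, F (D (θ ω) + cnt (x ω) (levels phi (x ω) Z s (S ω) (E ω)).1)
        (cnt (x ω) (levels phi (x ω) Z s (S ω) (E ω)).2) ∂markLaw ∂π =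
      ∫⁻ ω, chain lam phi μ F s (ρ (θ ω)) (A (θ ω)) (D (θ ω)) ∂π := by
  classical
  have := h.prob
  induction s with
  | zero =>
    intro Ω Θ _ _ π _ θ x S E ρ A D H hθ hx hS hE hSE hρ hρ1 hA hD hAE
    refine lintegral_congr_ae (hAE.mono fun ω hω => ?_)
    simp [levels, chain, hω.1]
  | succ s ih =>
    intro Ω Θ _ _ π _ θ x S E ρ A D H hθ hx hS hE hSE hρ hρ1 hA hD hAE
    have ha : Measurable fun p : Θ × X => avoid lam phi (A p.1) p.2 :=
      measurable_avoid hphi (hA.comp measurable_fst) measurable_snd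
    obtain ⟨N, hNe⟩ : ∃ N : Ω × (MarkIndex → ℝ) → Set ℕ,
      ∀ ω Z, N (ω, Z) = nbr phi (x ω) Z (S ω) (E ω) :=
        ⟨fun q => nbr phi (x q.1) q.2 (S q.1) (E q.1), fun _ _ => rfl⟩
    have hN : Measurable N := by
      have : N = fun q => nbr phi (x q.1) q.2 (S q.1) (E q.1) := funext fun q => hNe q.1 q.2
      rw [this]
      exact measurable_nbr hphi (hx.comp measurable_fst) measurable_snd (hS.comp measurable_fst)
        (hE.comp measurable_fst)
    have hNS : ∀ ω Z, N (ω, Z) ⊆ S ω := fun ω Z => by rw [hNe]; exact nbr_subset _ _ _ _ _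
    have hcN : Measurable fun q : Ω × (MarkIndex → ℝ) => cnt (x q.1) (N q) :=
      measurable_cnt (hx.comp measurable_fst) hN
    -- The law of the next generation, jointly with `θ`.
    have hnext : ∀ {G : Θ → Measure X → ℝ≥0∞}, Measurable (Function.uncurry G) →
        ∫⁻ q, G (θ q.1) (cnt (x q.1) (N q)) ∂π.prod markLaw =
          ∫⁻ ω, ∫⁻ c, G (θ ω) (thin (hit (ρ (θ ω)) (avoid lam phi (A (θ ω)))) c) ∂μ ∂π :=
      fun {G} hG => by
        rw [← H.lintegral_nbr h hphi hunit hθ hx hS hE hSE hρ hρ1 hA hAE hG]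
        simp only [← hNe]
        exact lintegral_prod _ (hG.comp ((hθ.comp measurable_fst).prodMk hcN)).aemeasurable
    let θ₁ : Ω × (MarkIndex → ℝ) → Θ × Measure X := fun q => (θ q.1, cnt (x q.1) (N q))
    have hθ₁ : Measurable θ₁ := (hθ.comp measurable_fst).prodMk hcN
    let x₁ : Ω × (MarkIndex → ℝ) → ℕ → X := fun q => x q.1
    let S₁ : Ω × (MarkIndex → ℝ) → Set ℕ := fun q => S q.1 \ N q
    have hS₁ : Measurable S₁ := (hS.comp measurable_fst).set_diff hN
    let ρ₁ : Θ × Measure X → X → ℝ≥0∞ := fun t => ρ t.1 * avoid lam phi (A t.1)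
    have hρ₁ : Measurable (Function.uncurry ρ₁) := (hρ.mul ha).comp
      ((measurable_fst.comp measurable_fst).prodMk measurable_snd)
    have hρ₁1 : ∀ t, ρ₁ t ≤ 1 := fun t => mul_le_one_fun (hρ1 _) fun z => avoid_le_one _ _ _
    have hth : Measurable fun p : (Θ × Measure X) × Config X => thin (ρ₁ p.1) p.2 :=
      measurable_thin (κ := fun p : (Θ × Measure X) × Config X => ρ₁ p.1)
        (hρ₁.comp ((measurable_fst.comp measurable_fst).prodMk measurable_snd)) measurable_snd
    have H₁ : CondPoisson μ (π.prod markLaw) θ₁ x₁ S₁ ρ₁ := fun G hG => by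
      have e1 := H.colour h hphi hunit hθ hx hS hE hSE hρ hρ1 hA hAE
        (G := fun t χ χ' => G (t, χ) χ') (hG.comp
          ((measurable_fst.prodMk (measurable_fst.comp measurable_snd)).prodMk
            (measurable_snd.comp measurable_snd)))
      have m2 : Measurable fun t : Θ × Measure X => ∫⁻ c', G t (thin (ρ₁ t) c') ∂μ :=
        (Measurable.lintegral_prod_right' (f := fun p : (Θ × Measure X) × Config X =>
          G p.1 (thin (ρ₁ p.1) p.2)) (hG.comp (measurable_fst.prodMk hth)))
      have e2 := hnext (G := fun t χ => ∫⁻ c', G (t, χ) (thin (ρ₁ (t, χ)) c') ∂μ) (by exact m2)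
      refine Eq.trans ?_ (e1.trans e2.symm)
      simp only [← hNe]
      refine lintegral_prod _ (Measurable.aemeasurable ?_)
      exact hG.comp (hθ₁.prodMk (measurable_cnt (hx.comp measurable_fst) hS₁))
    have hAE₁ : ∀ᵐ q ∂π.prod markLaw, (θ₁ q).2 = cnt (x₁ q) (N q) ∧
        Tame lam (cnt (x₁ q) (N q)) := by
      have := (Measure.quasiMeasurePreserving_fst (μ := π) (ν := markLaw)).ae
        (H.ae_tame h hx hS)
      filter_upwards [this] with q hq
      exact ⟨rfl, hq.mono (cnt_mono _ (hNS q.1 q.2))⟩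
    have IH := ih (D := fun t : Θ × Measure X => D t.1 + t.2) (A := Prod.snd) H₁ hθ₁
      (hx.comp measurable_fst) hS₁ hN (fun q => disjoint_sdiff_left) hρ₁ hρ₁1 measurable_snd
      ((hD.comp measurable_fst).add measurable_snd) hAE₁
    have hlast := hnext
      (G := fun t χ => chain lam phi μ F s (ρ t * avoid lam phi (A t)) χ (D t + χ))
      (measurable_chain hphi hF s (α := Θ × Measure X) hρ₁ measurable_snd
        ((hD.comp measurable_fst).add measurable_snd))
    refine Eq.trans ?_ (IH.trans hlast)
    have hmL := measurable_levels (phi := phi) hphi (α := (Ω × (MarkIndex → ℝ)) × (MarkIndex → ℝ))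
      (x := fun q => x q.1.1) (Z := fun q => q.2) (S := fun q => S₁ q.1) (E := fun q => N q.1)
      (hx.comp (measurable_fst.comp measurable_fst)) measurable_snd s
      (hS₁.comp measurable_fst) (hN.comp measurable_fst)
    have hmI : Measurable fun q : (Ω × (MarkIndex → ℝ)) × (MarkIndex → ℝ) =>
        F (D (θ₁ q.1).1 + (θ₁ q.1).2 + cnt (x₁ q.1) (levels phi (x₁ q.1) q.2 s (S₁ q.1) (N q.1)).1)
          (cnt (x₁ q.1) (levels phi (x₁ q.1) q.2 s (S₁ q.1) (N q.1)).2) := by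
      have hx' : Measurable fun q : (Ω × (MarkIndex → ℝ)) × (MarkIndex → ℝ) => x q.1.1 :=
        hx.comp (measurable_fst.comp measurable_fst)
      exact hF.comp (((((hD.comp measurable_fst).add measurable_snd).comp hθ₁).comp
        measurable_fst |>.add (measurable_cnt hx' hmL.1)).prodMk (measurable_cnt hx' hmL.2))
    refine Eq.trans (lintegral_congr fun ω => ?_)
      (lintegral_prod _ hmI.lintegral_prod_right'.aemeasurable).symm
    -- The marks within the available points are fresh after the first step.
    obtain ⟨J, hJ⟩ : ∃ J : Set MarkIndex, ∀ p, p ∈ J ↔ ¬ (p.1.1 ∈ S ω ∧ p.1.2 ∈ S ω) :=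
      ⟨{p | _}, fun _ => Iff.rfl⟩
    have hmω := measurable_levels (phi := phi) hphi (α := MarkIndex → ℝ)
      (x := fun _ => x ω) (Z := fun Z => Z) (S := fun _ => S ω) (E := fun _ => E ω)
      measurable_const measurable_id (s + 1) measurable_const measurable_const
    refine (Measure.lintegral_infinitePi_piecewise (fun _ => unif) J (hF.comp
      ((measurable_const.add (measurable_cnt measurable_const hmω.1)).prodMk
        (measurable_cnt measurable_const hmω.2)))).trans ?_
    refine lintegral_congr fun Z => lintegral_congr fun Z' => ?_
    have n1 : nbr phi (x ω) (J.piecewise Z Z') (S ω) (E ω) = N (ω, Z) := by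
      rw [hNe]
      refine nbr_congr _ _ fun p hp => piecewise_eq_of_mem _ _ _ ((hJ p).2 ?_)
      rintro ⟨h1, h2⟩
      rcases hp with hp | hp
      · exact disjoint_left.1 (hSE ω) h1 hp.1
      · exact disjoint_left.1 (hSE ω) h2 hp.2
    have n2 : levels phi (x ω) (J.piecewise Z Z') s (S ω \ N (ω, Z)) (N (ω, Z)) =
        levels phi (x ω) Z' s (S ω \ N (ω, Z)) (N (ω, Z)) :=
      levels_congr _ _ (fun p h1 h2 => piecewise_eq_of_notMem _ _ _
          fun h3 => (hJ p).1 h3 ⟨h1, h2⟩) _ _ _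
        sdiff_subset (hNS ω Z)
    show F (D (θ ω) + cnt (x ω) (levels phi (x ω) (J.piecewise Z Z') (s + 1) (S ω) (E ω)).1)
      (cnt (x ω) (levels phi (x ω) (J.piecewise Z Z') (s + 1) (S ω) (E ω)).2) = _
    simp only [levels, n1, n2]
    rw [cnt_union, ← add_assoc]
    exact (disjoint_sdiff_left.mono_left (levels_fst_subset _ _ _ _ _ _)).symm

/-- Two laws of the random connection model give the same law to each thinning. -/
lemma IsRCMLaw.lintegral_thin_congr (h' : IsRCMLaw lam μ') (h : IsRCMLaw lam μ) {κ : X → ℝ≥0∞}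
    (hκm : Measurable κ) (hκ : κ ≤ 1) {G : Measure X → ℝ≥0∞} (hG : Measurable G) :
    ∫⁻ c, G (thin κ c) ∂μ' = ∫⁻ c, G (thin κ c) ∂μ := by
  have := h.prob
  have := h'.lintegral_sel h hκm hκm le_rfl hκ (G := fun χ _ => G χ) (hG.comp measurable_fst)
  simpa [thin] using this

omit [MeasurableSpace X] in
lemma sel_congr {κ : X → ℝ≥0∞} {c c' : Config X} (h1 : c.count = c'.count)
    (h2 : c.points = c'.points) (h3 : ∀ p : MarkIndex, p.1.1 = 0 → c.marks p = c'.marks p) :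
    sel κ c = sel κ c' := by
  ext m
  simp only [sel, mem_ofPred_eq]
  rw [h1, h2, h3 _ rfl]

/-- The marks of the pairs of points of the Poisson process are independent of the points and of
the marks of the pairs containing the additional vertex. -/
lemma IsRCMLaw.lintegral_pointMarks (h : IsRCMLaw lam μ) {I : Config X → (MarkIndex → ℝ) → ℝ≥0∞}
    (hI : Measurable (Function.uncurry I))
    (hdep : ∀ c c' : Config X, c.count = c'.count → c.points = c'.points →
      (∀ p : MarkIndex, p.1.1 = 0 → c.marks p = c'.marks p) → I c = I c') :
    ∫⁻ c, I c (pointMarks c.marks) ∂μ = ∫⁻ c, ∫⁻ Z, I c Z ∂markLaw ∂μ := by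
  classical
  obtain ⟨J, hJ⟩ : ∃ J : Set MarkIndex, ∀ p, p ∈ J ↔ p.1.1 = 0 := ⟨{p | _}, fun _ => Iff.rfl⟩
  have hm1 : Measurable fun c : Config X => I c (pointMarks c.marks) :=
    hI.comp (measurable_id.prodMk (measurable_pointMarks.comp Config.measurable_marks))
  have hm4 : Measurable fun c => ∫⁻ Z, I c Z ∂markLaw := hI.lintegral_prod_right'
  rw [h.resample _ hm1, h.resample _ hm4]
  refine lintegral_congr fun c => ?_
  have hm2 : Measurable fun Z : MarkIndex → ℝ => ((c.1, c.2.1, Z) : Config X) := by fun_prop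
  have hm3 : Measurable fun Z : MarkIndex → ℝ => I (c.1, c.2.1, Z) (pointMarks Z) := hm1.comp hm2
  refine (Measure.lintegral_infinitePi_piecewise (fun _ => unif) J hm3).trans
    (lintegral_congr fun Z => ?_)
  have e : ∀ Z' : MarkIndex → ℝ,
      I (c.1, c.2.1, J.piecewise Z Z') (pointMarks (J.piecewise Z Z')) =
        I (c.1, c.2.1, Z) (pointMarks Z') := by
    intro Z'
    have s2 : pointMarks (J.piecewise Z Z') = pointMarks Z' :=
      funext fun p => piecewise_eq_of_notMem _ _ _ fun hp => Nat.succ_ne_zero _ ((hJ _).1 hp)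
    rw [s2]
    exact congrFun (hdep (c.1, c.2.1, J.piecewise Z Z') (c.1, c.2.1, Z) rfl rfl fun p hp =>
      show J.piecewise Z Z' p = Z p from piecewise_eq_of_mem _ _ _ ((hJ p).2 hp)) _
  have hlaw : markLaw.map pointMarks = markLaw :=
    Measure.infinitePi_map_comp (fun _ : MarkIndex => unif)
      (σ := fun p : MarkIndex => (⟨(p.1.1 + 1, p.1.2 + 1), Nat.succ_lt_succ p.2⟩ : MarkIndex))
      (fun p q hpq => by
        simp only [Subtype.mk.injEq, Prod.mk.injEq, add_left_inj] at hpq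
        exact Subtype.ext (Prod.ext hpq.1 hpq.2))
  simp_rw [e]
  conv_rhs => rw [← hlaw]
  exact (lintegral_map (hI.comp (measurable_const.prodMk measurable_id))
    measurable_pointMarks).symm

/-- The exploration of the cluster of the additional vertex, by generations: the available points
have density `ρ`, and those joined to the additional vertex have density `ρ (1 - a)`. -/
theorem IsRCMLaw.explore (h' : IsRCMLaw lam μ') (h : IsRCMLaw lam μ)
    (hphi : Measurable fun p : X × X => phi p.1 p.2) (hunit : ∀ x y, phi x y ∈ Icc (0 : ℝ) 1)
    {F : Measure X → Measure X → ℝ≥0∞} (hF : Measurable (Function.uncurry F)) (s : ℕ)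
    {ρ a : X → ℝ≥0∞} (hρ : Measurable ρ) (hρ1 : ρ ≤ 1) (ha : Measurable a) (ha1 : a ≤ 1)
    (D : Measure X) :
    ∫⁻ c, F (D + cnt c.points (sel (hit ρ a) c ∪ (levels phi c.points (pointMarks c.marks) s
          (sel ρ c \ sel (hit ρ a) c) (sel (hit ρ a) c)).1))
        (cnt c.points (levels phi c.points (pointMarks c.marks) s
          (sel ρ c \ sel (hit ρ a) c) (sel (hit ρ a) c)).2) ∂μ' =
      ∫⁻ c, chain lam phi μ F s (ρ * a) (thin (hit ρ a) c) (D + thin (hit ρ a) c) ∂μ := by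
  classical
  have := h.prob
  have := h'.prob
  obtain ⟨κ, hκe⟩ : ∃ κ, κ = hit ρ a := ⟨_, rfl⟩
  rw [← hκe]
  have hκm : Measurable κ := hκe ▸ measurable_hit hρ ha
  have hκρ : κ ≤ ρ := hκe ▸ hit_le _ _
  have hsel : ∀ {κ : X → ℝ≥0∞}, Measurable κ → Measurable fun c : Config X => sel κ c :=
    fun hκ => measurable_sel (κ := fun _ => _) (hκ.comp measurable_snd) measurable_id
  have hS : Measurable fun c : Config X => sel ρ c \ sel κ c := (hsel hρ).set_diff (hsel hκm)
  let I : Config X → (MarkIndex → ℝ) → ℝ≥0∞ := fun c Z =>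
    F (D + cnt c.points (sel κ c ∪ (levels phi c.points Z s (sel ρ c \ sel κ c) (sel κ c)).1))
      (cnt c.points (levels phi c.points Z s (sel ρ c \ sel κ c) (sel κ c)).2)
  have hI : Measurable (Function.uncurry I) := by
    have hp : Measurable fun q : Config X × (MarkIndex → ℝ) => q.1.points :=
      Config.measurable_points.comp measurable_fst
    have hL := measurable_levels (phi := phi) hphi (α := Config X × (MarkIndex → ℝ))
      (x := fun q => q.1.points) (Z := fun q => q.2) hp measurable_snd s
      (hS.comp measurable_fst) ((hsel hκm).comp measurable_fst)
    exact hF.comp ((measurable_const.add (measurable_cnt hp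
      (((hsel hκm).comp measurable_fst).set_union hL.1))).prodMk (measurable_cnt hp hL.2))
  have hfresh : ∫⁻ c, I c (pointMarks c.marks) ∂μ' = ∫⁻ c, ∫⁻ Z, I c Z ∂markLaw ∂μ' :=
    h'.lintegral_pointMarks hI fun c c' h1 h2 h3 => by
      have hs : ∀ κ : X → ℝ≥0∞, sel κ c = sel κ c' := fun κ => sel_congr h1 h2 h3
      ext Z
      show F _ _ = F _ _
      rw [hs, hs, h2]
  have hρa : Measurable (ρ * a) := hρ.mul ha
  have hthin : Measurable fun c : Config X => thin κ c := measurable_thin_const hκm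
  have H : CondPoisson μ μ' (thin κ) Config.points (fun c => sel ρ c \ sel κ c)
      (fun _ => ρ * a) := fun G hG => by
    have e1 := h'.lintegral_sel h hκm hρ hκρ hρ1 hG
    have m2 : Measurable fun p : Measure X × Config X => thin (ρ * a) p.2 :=
      (measurable_thin_const hρa).comp measurable_snd
    have e2 := h'.lintegral_thin_congr h hκm (hκρ.trans hρ1)
      (G := fun χ => ∫⁻ c', G χ (thin (ρ * a) c') ∂μ)
      (Measurable.lintegral_prod_right' (f := fun p : Measure X × Config X =>
        G p.1 (thin (ρ * a) p.2)) (hG.comp (measurable_fst.prodMk m2)))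
    rw [show ρ - κ = ρ * a by rw [hκe, sub_hit hρ1 ha1]] at e1
    exact e1.trans e2.symm
  have key := H.explore h hphi hunit hF s (E := sel κ) (A := id) (D := fun χ => D + χ) hthin
    Config.measurable_points hS (hsel hκm) (fun c => disjoint_sdiff_left)
    (hρa.comp measurable_snd) (fun _ => mul_le_one_fun hρ1 ha1) measurable_id (by fun_prop)
    (h'.tame_thin.mono fun c hc => ⟨rfl, hc κ⟩)
  refine hfresh.trans (Eq.trans ?_ (key.trans ?_))
  · refine lintegral_congr fun c => lintegral_congr fun Z => ?_
    show F _ _ = F _ _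
    rw [cnt_union, ← add_assoc]
    · rfl
    · exact (disjoint_sdiff_left.mono_left (levels_fst_subset _ _ _ _ _ _)).symm
  · exact h'.lintegral_thin_congr h hκm (hκρ.trans hρ1)
      (G := fun χ => chain lam phi μ F s (ρ * a) χ (D + χ))
      (measurable_chain hphi hF s (ρ := fun _ : Measure X => ρ * a)
        (hρa.comp measurable_snd) measurable_id (by fun_prop))

end ExploreChain

/-! ### Balls found by the exploration -/

section Ball

variable {X : Type*} (phi : X → X → ℝ) (x : ℕ → X) (Z : MarkIndex → ℝ)

/-- The numbers of the points found in `s` steps, when the points of `E` are found in the first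
one, and each further step adds the points in `A` that are joined to a point found before. -/
def ball (A E : Set ℕ) : ℕ → Set ℕ
  | 0 => ∅
  | s + 1 => E ∪ nbr phi x Z A (ball A E s)

variable {phi x Z}

lemma nbr_mono {S S' E E' : Set ℕ} (hS : S ⊆ S') (hE : E ⊆ E') :
    nbr phi x Z S E ⊆ nbr phi x Z S' E' :=
  fun _ hn => ⟨hS hn.1, hn.2.imp fun _ hk => ⟨hE hk.1, hk.2⟩⟩

lemma ball_mono {A A' E E' : Set ℕ} (hA : A ⊆ A') (hE : E ⊆ E') (s : ℕ) :
    ball phi x Z A E s ⊆ ball phi x Z A' E' s := by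
  induction s with
  | zero => exact subset_rfl
  | succ s ih => exact union_subset_union hE (nbr_mono hA ih)

lemma ball_subset_succ (A E : Set ℕ) (s : ℕ) :
    ball phi x Z A E s ⊆ ball phi x Z A E (s + 1) := by
  induction s with
  | zero => exact empty_subset _
  | succ s ih => exact union_subset_union subset_rfl (nbr_mono subset_rfl ih)

lemma monotone_ball (A E : Set ℕ) : Monotone (ball phi x Z A E) :=
  monotone_nat_of_le_succ (ball_subset_succ A E)

lemma ball_subset {A E : Set ℕ} (hE : E ⊆ A) (s : ℕ) : ball phi x Z A E s ⊆ A := by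
  cases s with
  | zero => exact empty_subset _
  | succ s => exact union_subset hE (nbr_subset _ _ _ _ _)

lemma ball_iUnion (A : Set ℕ) (E : ℕ → Set ℕ) (s : ℕ) :
    ball phi x Z A (⋃ N, E N) s = ⋃ N, ball phi x Z A (E N) s := by
  induction s with
  | zero => simp [ball]
  | succ s ih =>
    simp only [ball]
    rw [ih, iUnion_union_distrib]
    congr 1
    ext n
    simp only [nbr, mem_iUnion, mem_ofPred_eq]
    constructor
    · rintro ⟨h, k, ⟨N, hN⟩, hk⟩; exact ⟨N, h, k, hN, hk⟩
    · rintro ⟨N, h, k, hN, hk⟩; exact ⟨h, k, ⟨N, hN⟩, hk⟩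

/-- A ball can be built from its first step: the points of `E` are removed from the available ones
and the exploration continues from their neighbours. -/
lemma ball_succ_eq (A E : Set ℕ) (s : ℕ) :
    ball phi x Z A E (s + 1) = E ∪ ball phi x Z (A \ E) (nbr phi x Z (A \ E) E) s := by
  induction s with
  | zero => simp [ball, nbr]
  | succ s ih =>
    rw [ball, ih]
    ext n
    simp only [ball, nbr, mem_union, mem_ofPred_eq, mem_sdiff]
    by_cases hn : n ∈ E
    · simp [hn]
    · simp only [hn, false_or, not_false_eq_true, and_true]
      constructor
      · rintro ⟨h, k, hk | hk, hkn⟩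
        · exact Or.inl ⟨h, k, hk, hkn⟩
        · exact Or.inr ⟨h, k, hk, hkn⟩
      · rintro (⟨h, k, hk, hkn⟩ | ⟨h, k, hk, hkn⟩)
        · exact ⟨h, k, Or.inl hk, hkn⟩
        · exact ⟨h, k, Or.inr hk, hkn⟩

/-- The exploration by generations finds the balls, and its last generation is a sphere. -/
lemma levels_eq_ball (s : ℕ) : ∀ A E : Set ℕ,
    E ∪ (levels phi x Z s (A \ E) E).1 = ball phi x Z A E (s + 1) ∧
    (levels phi x Z s (A \ E) E).2 = ball phi x Z A E (s + 1) \ ball phi x Z A E s := by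
  induction s with
  | zero => intro A E; simp [levels, ball, nbr]
  | succ s ih =>
    intro A E
    have h1 := ih (A \ E) (nbr phi x Z (A \ E) E)
    rw [ball_succ_eq A E (s + 1), ball_succ_eq A E s]
    simp only [levels]
    rw [h1.1, h1.2]
    refine ⟨rfl, ?_⟩
    have h2 : Disjoint (ball phi x Z (A \ E) (nbr phi x Z (A \ E) E) (s + 1)) E :=
      disjoint_sdiff_left.mono_left (ball_subset (nbr_subset _ _ _ _ _) _)
    ext n
    simp only [mem_sdiff, mem_union, not_or]
    constructor
    · rintro ⟨h3, h4⟩; exact ⟨Or.inr h3, fun h5 => disjoint_left.1 h2 h3 h5, h4⟩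
    · rintro ⟨h3 | h3, h4, h5⟩
      · exact absurd h3 h4
      · exact ⟨h3, h5⟩

end Ball

lemma measurable_ball {X : Type*} [MeasurableSpace X] {phi : X → X → ℝ}
    (hphi : Measurable fun p : X × X => phi p.1 p.2) {α : Type*}
    [MeasurableSpace α] {x : α → ℕ → X} {Z : α → MarkIndex → ℝ} (hx : Measurable x)
    (hZ : Measurable Z) {A E : α → Set ℕ} (hA : Measurable A) (hE : Measurable E) (s : ℕ) :
    Measurable fun t => ball phi (x t) (Z t) (A t) (E t) s := by
  induction s with
  | zero => exact measurable_const
  | succ s ih => exact hE.set_union (measurable_nbr hphi hx hZ hA ih)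

/-! ### Growth: recursion, restarting and subadditivity -/

section Growth

variable {X : Type u}

/-- The numbers of the points found in `s` steps in the graph given by `c`, when the available
points have density `ρ`, and those joined to the additional vertex have density `ρ (1 - a)`. -/
def reach (phi : X → X → ℝ) (ρ a : X → ℝ≥0∞) (c : Config X) (s : ℕ) : Set ℕ :=
  ball phi c.points (pointMarks c.marks) (sel ρ c) (sel (hit ρ a) c) s

lemma monotone_reach (phi : X → X → ℝ) (ρ a : X → ℝ≥0∞) (c : Config X) :
    Monotone (reach phi ρ a c) := monotone_ball _ _

lemma reach_mono (phi : X → X → ℝ) {ρ ρ' a a' : X → ℝ≥0∞} (hρ' : ρ' ≤ 1) (hρ : ρ ≤ ρ')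
    (ha' : a' ≤ 1) (ha : a' ≤ a) (c : Config X) (s : ℕ) :
    reach phi ρ a c s ⊆ reach phi ρ' a' c s :=
  ball_mono (sel_mono hρ c) (sel_mono (hit_mono hρ' hρ ha' ha) c) s

variable [MeasurableSpace X]

/-- The expectation of `f (D + χ)`, where `χ` is the measure of the points found in `s` steps. -/
def growth (phi : X → X → ℝ) (μ : Measure (Config X)) (f : Measure X → ℝ≥0∞) (s : ℕ)
    (ρ a : X → ℝ≥0∞) (D : Measure X) : ℝ≥0∞ :=
  ∫⁻ c, f (D + cnt c.points (reach phi ρ a c s)) ∂μ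

variable {lam : Measure X} [SigmaFinite lam] {phi : X → X → ℝ} {μ μ' : Measure (Config X)}
  {f : Measure X → ℝ≥0∞}

lemma measurable_reach (hphi : Measurable fun p : X × X => phi p.1 p.2) {α : Type*}
    [MeasurableSpace α] {ρ a : α → X → ℝ≥0∞} (hρ : Measurable (Function.uncurry ρ))
    (ha : Measurable (Function.uncurry a)) {c : α → Config X} (hc : Measurable c) (s : ℕ) :
    Measurable fun t => reach phi (ρ t) (a t) (c t) s :=
  measurable_ball hphi (Config.measurable_points.comp hc)
    (measurable_pointMarks.comp (Config.measurable_marks.comp hc)) (measurable_sel hρ hc)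
    (measurable_sel (measurable_hit hρ ha) hc) s

lemma measurable_growth (hphi : Measurable fun p : X × X => phi p.1 p.2) [SFinite μ]
    (hf : Measurable f) {α : Type*} [MeasurableSpace α] {ρ a : α → X → ℝ≥0∞}
    (hρ : Measurable (Function.uncurry ρ)) (ha : Measurable (Function.uncurry a))
    {D : α → Measure X} (hD : Measurable D) (s : ℕ) :
    Measurable fun t => growth phi μ f s (ρ t) (a t) (D t) := by
  have hlift : ∀ {ρ : α → X → ℝ≥0∞}, Measurable (Function.uncurry ρ) →
      Measurable (Function.uncurry fun p : α × Config X => ρ p.1) := fun h =>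
    h.comp ((measurable_fst.comp measurable_fst).prodMk measurable_snd)
  have hr := measurable_reach hphi (hlift hρ) (hlift ha) measurable_snd s
  have hc : Measurable fun p : α × Config X =>
      cnt p.2.points (reach phi (ρ p.1) (a p.1) p.2 s) :=
    measurable_cnt (Config.measurable_points.comp measurable_snd) hr
  exact (hf.comp ((hD.comp measurable_fst).add hc)).lintegral_prod_right'

lemma measurable_growth_const (hphi : Measurable fun p : X × X => phi p.1 p.2) [SFinite μ]
    (hf : Measurable f) {ρ a : X → ℝ≥0∞} (hρ : Measurable ρ) (ha : Measurable a) (s : ℕ) :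
    Measurable fun D => growth phi μ f s ρ a D :=
  measurable_growth hphi hf (ρ := fun _ => ρ) (a := fun _ => a) (hρ.comp measurable_snd)
    (ha.comp measurable_snd) measurable_id s

lemma growth_mono (hf : Monotone f) {ρ ρ' a a' : X → ℝ≥0∞} (hρ' : ρ' ≤ 1) (hρ : ρ ≤ ρ')
    (ha' : a' ≤ 1) (ha : a' ≤ a) {s s' : ℕ} (hs : s ≤ s') {D D' : Measure X} (hD : D ≤ D') :
    growth phi μ f s ρ a D ≤ growth phi μ f s' ρ' a' D' :=
  lintegral_mono fun c => hf (add_le_add hD (cnt_mono _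
    ((monotone_reach phi ρ a c hs).trans (reach_mono phi hρ' hρ ha' ha c s'))))

lemma growth_mono_fun {f g : Measure X → ℝ≥0∞} (h : f ≤ g) (s : ℕ) (ρ a : X → ℝ≥0∞)
    (D : Measure X) : growth phi μ f s ρ a D ≤ growth phi μ g s ρ a D :=
  lintegral_mono fun _ => h _

@[simp] lemma growth_zero [IsProbabilityMeasure μ] (f : Measure X → ℝ≥0∞) (ρ a : X → ℝ≥0∞)
    (D : Measure X) : growth phi μ f 0 ρ a D = f D := by
  simp [growth, reach, ball]

/-- The exploration, with the points found in the last step singled out. -/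
theorem IsRCMLaw.lintegral_reach (h' : IsRCMLaw lam μ') (h : IsRCMLaw lam μ)
    (hphi : Measurable fun p : X × X => phi p.1 p.2) (hunit : ∀ x y, phi x y ∈ Icc (0 : ℝ) 1)
    {F : Measure X → Measure X → ℝ≥0∞} (hF : Measurable (Function.uncurry F)) (s : ℕ)
    {ρ a : X → ℝ≥0∞} (hρ : Measurable ρ) (hρ1 : ρ ≤ 1) (ha : Measurable a) (ha1 : a ≤ 1)
    (D : Measure X) :
    ∫⁻ c, F (D + cnt c.points (reach phi ρ a c (s + 1)))
        (cnt c.points (reach phi ρ a c (s + 1) \ reach phi ρ a c s)) ∂μ' =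
      ∫⁻ c, chain lam phi μ F s (ρ * a) (thin (hit ρ a) c) (D + thin (hit ρ a) c) ∂μ := by
  rw [← h'.explore h hphi hunit hF s hρ hρ1 ha ha1 D]
  refine lintegral_congr fun c => ?_
  have := levels_eq_ball (phi := phi) (x := c.points) (Z := pointMarks c.marks) s
    (sel ρ c) (sel (hit ρ a) c)
  rw [this.1, this.2]
  rfl

/-- Starting from the points of `A` amounts to joining points to the additional vertex with the
probability of being joined to `A`. -/
lemma IsRCMLaw.growth_avoid (h : IsRCMLaw lam μ)
    (hphi : Measurable fun p : X × X => phi p.1 p.2) (hunit : ∀ x y, phi x y ∈ Icc (0 : ℝ) 1)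
    (hf : Measurable f) (s : ℕ) {ρ : X → ℝ≥0∞} (hρ : Measurable ρ) (hρ1 : ρ ≤ 1)
    (A D : Measure X) :
    growth phi μ f s ρ (avoid lam phi A) D = chain lam phi μ (fun D _ => f D) s ρ A D := by
  have := h.prob
  cases s with
  | zero => simp [chain]
  | succ s =>
    exact h.lintegral_reach h hphi hunit (F := fun D _ => f D) (hf.comp measurable_fst) s hρ hρ1
      (measurable_avoid hphi measurable_const measurable_id) (fun z => avoid_le_one _ _ _) D

lemma measurable_avoid_const (hphi : Measurable fun p : X × X => phi p.1 p.2) (A : Measure X) :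
    Measurable (avoid lam phi A) :=
  measurable_avoid hphi measurable_const measurable_id

/-- First step recursion: the first generation is the `hit ρ a`-thinning, and the exploration
continues from it with the density `ρ * a` of points that have not been hit. -/
theorem IsRCMLaw.growth_succ (h : IsRCMLaw lam μ)
    (hphi : Measurable fun p : X × X => phi p.1 p.2) (hunit : ∀ x y, phi x y ∈ Icc (0 : ℝ) 1)
    (hf : Measurable f) (s : ℕ) {ρ a : X → ℝ≥0∞} (hρ : Measurable ρ) (hρ1 : ρ ≤ 1)
    (ha : Measurable a) (ha1 : a ≤ 1) (D : Measure X) :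
    growth phi μ f (s + 1) ρ a D = ∫⁻ c, growth phi μ f s (ρ * a)
      (avoid lam phi (thin (hit ρ a) c)) (D + thin (hit ρ a) c) ∂μ := by
  simp_rw [h.growth_avoid hphi hunit hf s (hρ.mul ha) (mul_le_one_fun hρ1 ha1)]
  exact h.lintegral_reach h hphi hunit (F := fun D _ => f D) (hf.comp measurable_fst) s hρ hρ1
    ha ha1 D

/-- The chain form of `IsRCMLaw.growth_add_le`: raising the density of the available points from
its current value to `1` increases the number of points found. -/
lemma IsRCMLaw.chain_le (h : IsRCMLaw lam μ)
    (hphi : Measurable fun p : X × X => phi p.1 p.2) (hunit : ∀ x y, phi x y ∈ Icc (0 : ℝ) 1)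
    (hf : Measurable f) (hfm : Monotone f) (s j : ℕ) :
    ∀ {ρ : X → ℝ≥0∞}, Measurable ρ → ρ ≤ 1 → ∀ A D : Measure X,
    chain lam phi μ (fun D _ => f D) (s + j) ρ A D ≤
      chain lam phi μ (fun D A => growth phi μ f s 1 (avoid lam phi A) D) j ρ A D := by
  induction j with
  | zero =>
    intro ρ hρ hρ1 A D
    rw [add_zero, ← h.growth_avoid hphi hunit hf s hρ hρ1]
    exact growth_mono hfm le_rfl hρ1 (fun z => avoid_le_one _ _ _) le_rfl le_rfl le_rfl
  | succ j ih =>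
    intro ρ hρ hρ1 A D
    exact lintegral_mono fun c => ih (hρ.mul (measurable_avoid_const hphi A))
      (mul_le_one_fun hρ1 fun z => avoid_le_one _ _ _) _ _

/-- After `j + 1` steps, the exploration may be restarted from the points found last, with all
points of a new Poisson process available. -/
theorem IsRCMLaw.growth_add_le (h' : IsRCMLaw lam μ') (h : IsRCMLaw lam μ)
    (hphi : Measurable fun p : X × X => phi p.1 p.2) (hunit : ∀ x y, phi x y ∈ Icc (0 : ℝ) 1)
    (hf : Measurable f) (hfm : Monotone f) (s j : ℕ) {ρ a : X → ℝ≥0∞} (hρ : Measurable ρ)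
    (hρ1 : ρ ≤ 1) (ha : Measurable a) (ha1 : a ≤ 1) (D : Measure X) :
    growth phi μ f (s + (j + 1)) ρ a D ≤ ∫⁻ c, growth phi μ f s 1
      (avoid lam phi (cnt c.points (reach phi ρ a c (j + 1) \ reach phi ρ a c j)))
      (D + cnt c.points (reach phi ρ a c (j + 1))) ∂μ' := by
  have := h.prob
  have hF : Measurable (Function.uncurry fun D A : Measure X =>
      growth phi μ f s 1 (avoid lam phi A) D) :=
    measurable_growth hphi hf (α := Measure X × Measure X) (ρ := fun _ => 1)
      (a := fun p => avoid lam phi p.2) measurable_const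
      (measurable_avoid hphi (measurable_snd.comp measurable_fst) measurable_snd) measurable_fst s
  have e1 := h'.lintegral_reach h hphi hunit hF j hρ hρ1 ha ha1 D
  have e2 := h.lintegral_reach h hphi hunit (F := fun D _ => f D) (hf.comp measurable_fst) (s + j)
    hρ hρ1 ha ha1 D
  refine (Eq.le e2).trans ((lintegral_mono fun c => ?_).trans e1.ge)
  exact h.chain_le hphi hunit hf hfm s j (hρ.mul ha) (mul_le_one_fun hρ1 ha1) _ _

omit [MeasurableSpace X] in
/-- Among the points hit by one of two sources, those not hit by the first one are the points hit by
the second one, when only the points avoided by the first one are available. -/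
lemma hit_mul {ρ a₁ a₂ : X → ℝ≥0∞} (hρ1 : ρ ≤ 1) (ha₁ : a₁ ≤ 1) (ha₂ : a₂ ≤ 1) :
    hit ρ (a₁ * a₂) - hit ρ a₁ = hit (ρ * a₁) a₂ := by
  ext z
  have f1 : ρ z ≠ ∞ := ((hρ1 z).trans_lt ENNReal.one_lt_top).ne
  have g1 : ρ z * a₁ z ≤ ρ z := mul_le_of_le_one_right zero_le (ha₁ z)
  have g2 : ρ z * a₁ z * a₂ z ≤ ρ z * a₁ z := mul_le_of_le_one_right zero_le (ha₂ z)
  show ρ z - ρ z * (a₁ z * a₂ z) - (ρ z - ρ z * a₁ z) = ρ z * a₁ z - ρ z * a₁ z * a₂ z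
  rw [← mul_assoc, tsub_right_comm, ENNReal.sub_sub_cancel f1 g1]

/-- Subadditivity: the points found when starting from two sources at once are dominated by the
points found in two independent explorations. -/
theorem IsRCMLaw.growth_mul_le (h : IsRCMLaw lam μ)
    (hphi : Measurable fun p : X × X => phi p.1 p.2) (hunit : ∀ x y, phi x y ∈ Icc (0 : ℝ) 1)
    (hf : Measurable f) (hfm : Monotone f) (s : ℕ) :
    ∀ {ρ ρ₁ ρ₂ a₁ a₂ : X → ℝ≥0∞}, Measurable ρ → Measurable ρ₁ → Measurable ρ₂ →
    Measurable a₁ → Measurable a₂ → ρ ≤ ρ₁ → ρ ≤ ρ₂ → ρ₁ ≤ 1 → ρ₂ ≤ 1 → a₁ ≤ 1 → a₂ ≤ 1 →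
    ∀ D : Measure X, growth phi μ f s ρ (a₁ * a₂) D ≤
      growth phi μ (fun D' => growth phi μ f s ρ₂ a₂ D') s ρ₁ a₁ D := by
  have := h.prob
  induction s with
  | zero => intros; simp
  | succ s ih =>
    intro ρ ρ₁ ρ₂ a₁ a₂ hρ hρ₁ hρ₂ ha₁ ha₂ h₁ h₂ h₁1 h₂1 ha₁1 ha₂1 D
    have hρ1 : ρ ≤ 1 := h₁.trans h₁1
    have ha1 : a₁ * a₂ ≤ 1 := mul_le_one_fun ha₁1 ha₂1
    have hG : Measurable fun D' => growth phi μ f (s + 1) ρ₂ a₂ D' :=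
      measurable_growth_const hphi hf hρ₂ ha₂ _
    rw [h.growth_succ hphi hunit hf s hρ hρ1 (ha₁.mul ha₂) ha1,
      h.growth_succ hphi hunit hG s hρ₁ h₁1 ha₁ ha₁1]
    -- The points hit by one of the sources: those hit by the first one, and an independent Poisson
    -- process of those hit by the second one only.
    have hadd := h.lintegral_thin_add (κ := hit ρ a₁) (ρ := hit ρ (a₁ * a₂))
      (measurable_hit hρ ha₁) (measurable_hit hρ (ha₁.mul ha₂))
      (hit_mono hρ1 le_rfl ha1 fun z => mul_le_of_le_one_right zero_le (ha₂1 z))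
      ((hit_le _ _).trans hρ1)
      (G := fun χ => growth phi μ f s (ρ * (a₁ * a₂)) (avoid lam phi χ) (D + χ))
      (measurable_growth hphi hf (α := Measure X) (ρ := fun _ => ρ * (a₁ * a₂))
        (a := fun χ => avoid lam phi χ) ((hρ.mul (ha₁.mul ha₂)).comp measurable_snd)
        (measurable_avoid hphi measurable_fst measurable_snd) (by fun_prop) s)
    refine (Eq.le hadd).trans ?_
    rw [hit_mul hρ1 ha₁1 ha₂1]
    refine lintegral_mono_ae (h.tame_thin.mono fun c hc => ?_)
    have hinner : ∀ᵐ c' ∂μ, growth phi μ f s (ρ * (a₁ * a₂))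
        (avoid lam phi (thin (hit ρ a₁) c + thin (hit (ρ * a₁) a₂) c'))
        (D + (thin (hit ρ a₁) c + thin (hit (ρ * a₁) a₂) c')) ≤
        growth phi μ (fun D' => growth phi μ f s (ρ₂ * a₂)
            (avoid lam phi (thin (hit ρ₂ a₂) c')) D') s (ρ₁ * a₁)
          (avoid lam phi (thin (hit ρ₁ a₁) c)) (D + thin (hit ρ₁ a₁) c + thin (hit ρ₂ a₂) c') :=
      h.tame_thin.mono fun c' hc' => by
        have le1 : thin (hit ρ a₁) c ≤ thin (hit ρ₁ a₁) c :=
          thin_mono (hit_mono h₁1 h₁ ha₁1 le_rfl) c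
        have le2 : thin (hit (ρ * a₁) a₂) c' ≤ thin (hit ρ₂ a₂) c' :=
          thin_mono (hit_mono h₂1 (fun z => (mul_le_of_le_one_right zero_le (ha₁1 z)).trans (h₂ z))
            ha₂1 le_rfl) c'
        have e : avoid lam phi (thin (hit ρ₁ a₁) c + thin (hit ρ₂ a₂) c') =
            avoid lam phi (thin (hit ρ₁ a₁) c) * avoid lam phi (thin (hit ρ₂ a₂) c') :=
          funext fun z => avoid_add (hc _) (hc' _) z
        have av : ∀ χ, avoid lam phi χ ≤ 1 := fun χ z => avoid_le_one _ _ _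
        refine (growth_mono hfm (ρ' := ρ * (a₁ * a₂)) (mul_le_one_fun hρ1 ha1) le_rfl (av _)
          (fun z => avoid_anti ((hc (hit ρ₁ a₁)).add (hc' (hit ρ₂ a₂))) (add_le_add le1 le2) z)
          le_rfl (add_le_add le_rfl (add_le_add le1 le2))).trans ?_
        rw [e, ← add_assoc]
        refine ih (hρ.mul (ha₁.mul ha₂)) (hρ₁.mul ha₁) (hρ₂.mul ha₂)
          (measurable_avoid_const hphi _) (measurable_avoid_const hphi _) (fun z => ?_)
          (fun z => ?_) (mul_le_one_fun h₁1 ha₁1) (mul_le_one_fun h₂1 ha₂1) (av _) (av _) _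
        · exact mul_le_mul' (h₁ z) (mul_le_of_le_one_right zero_le (ha₂1 z))
        · exact mul_le_mul' (h₂ z) (mul_le_of_le_one_left zero_le (ha₁1 z))
    refine (lintegral_mono_ae hinner).trans (Eq.le ?_)
    -- The first step of the second exploration may be taken after the first exploration.
    simp only [growth]
    rw [lintegral_lintegral_swap]
    · refine lintegral_congr fun c'' => ?_
      have := h.growth_succ hphi hunit hf s hρ₂ h₂1 ha₂ ha₂1
        (D + thin (hit ρ₁ a₁) c + cnt c''.points
        (reach phi (ρ₁ * a₁) (avoid lam phi (thin (hit ρ₁ a₁) c)) c'' s))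
      refine Eq.trans ?_ this.symm
      refine lintegral_congr fun c' => ?_
      rw [add_right_comm (D + thin (hit ρ₁ a₁) c)]
      rfl
    · refine Measurable.aemeasurable ?_
      have ht : Measurable fun p : Config X × Config X => thin (hit ρ₂ a₂) p.1 :=
        (measurable_thin_const (measurable_hit hρ₂ ha₂)).comp measurable_fst
      have hr : Measurable fun p : Config X × Config X => cnt p.2.points
          (reach phi (ρ₁ * a₁) (avoid lam phi (thin (hit ρ₁ a₁) c)) p.2 s) :=
        measurable_cnt (Config.measurable_points.comp measurable_snd)
          (measurable_reach hphi (ρ := fun _ => _) (a := fun _ => _)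
            ((hρ₁.mul ha₁).comp measurable_snd)
            ((measurable_avoid_const hphi _).comp measurable_snd) measurable_snd s)
      exact measurable_growth hphi hf (ρ := fun _ : Config X × Config X => ρ₂ * a₂)
        (a := fun p => avoid lam phi (thin (hit ρ₂ a₂) p.1)) ((hρ₂.mul ha₂).comp measurable_snd)
        (measurable_avoid hphi (ht.comp measurable_fst) measurable_snd)
        ((measurable_const.add ht).add hr) s

end Growth

/-! ### Test functions and the continuity of the growth -/

section Test

variable {X : Type*} [MeasurableSpace X]

/-- Test functions: measurable and increasing functions of a measure that are continuous along
increasing sequences. -/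
structure IsTest (f : Measure X → ℝ≥0∞) : Prop where
  measurable : Measurable f
  mono : Monotone f
  le_iSup : ∀ (χ : ℕ → Measure X) (χ' : Measure X), Monotone χ →
    (∀ B, MeasurableSet B → χ' B = ⨆ n, χ n B) → f χ' ≤ ⨆ n, f (χ n)

/-- Averaging over an independent random summand preserves test functions. -/
lemma IsTest.lintegral {f : Measure X → ℝ≥0∞} (hf : IsTest f) {Ω : Type*} [MeasurableSpace Ω]
    (π : Measure Ω) [SFinite π] {W : Ω → Measure X} (hW : Measurable W) :
    IsTest fun D => ∫⁻ ω, f (D + W ω) ∂π where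
  measurable := Measurable.lintegral_prod_right' (f := fun p : Measure X × Ω => f (p.1 + W p.2))
    (hf.measurable.comp (measurable_fst.add (hW.comp measurable_snd)))
  mono _ _ h := lintegral_mono fun _ => hf.mono (add_le_add h le_rfl)
  le_iSup χ χ' hχ h := by
    rw [← lintegral_iSup (f := fun n ω => f (χ n + W ω))
      (fun n => hf.measurable.comp (measurable_const.add hW))
      (fun m n hmn ω => hf.mono (add_le_add (hχ hmn) le_rfl))]
    refine lintegral_mono fun ω => hf.le_iSup (fun n => χ n + W ω) _
      (fun m n hmn => add_le_add (hχ hmn) le_rfl) fun B hB => ?_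
    simp only [Measure.add_apply]
    rw [h B hB, ENNReal.iSup_add]

lemma IsTest.add_iUnion_le {f : Measure X → ℝ≥0∞} (hf : IsTest f) (D : Measure X) (x : ℕ → X)
    {S : ℕ → Set ℕ} (hS : Monotone S) :
    f (D + cnt x (⋃ N, S N)) ≤ ⨆ N, f (D + cnt x (S N)) := by
  refine hf.le_iSup (fun N => D + cnt x (S N)) _ (fun m n hmn => add_le_add le_rfl
    (cnt_mono x (hS hmn))) fun B hB => ?_
  simp only [Measure.add_apply]
  rw [cnt_iUnion_apply x hS hB, ENNReal.add_iSup]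

end Test

lemma unif_ofReal_eq {p : ℝ≥0∞} : unif {u | ENNReal.ofReal u = p} = 0 := by
  have h : {u | ENNReal.ofReal u = p} ⊆ {u | u ≤ 0} ∪ {p.toReal} := fun u hu => by
    rcases le_or_gt u 0 with h | h
    · exact Or.inl h
    · right
      rw [mem_singleton_iff, ← (show ENNReal.ofReal u = p from hu), ENNReal.toReal_ofReal h.le]
  refine measure_mono_null h (measure_union_null ?_ ?_)
  · rw [unif_Iic ⟨le_rfl, zero_le_one⟩, ENNReal.ofReal_zero]
  · exact measure_mono_null subset_rfl (le_antisymm ((Measure.restrict_apply_le _ _).trans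
      (by simp)) zero_le)

section Continuity

variable {X : Type u} [MeasurableSpace X] {lam : Measure X} [SigmaFinite lam] {phi : X → X → ℝ}
  {μ μ' : Measure (Config X)} {f : Measure X → ℝ≥0∞}

/-- Almost surely, a thinning does not depend on whether ties are included. -/
lemma IsRCMLaw.ae_mark_ne (h : IsRCMLaw lam μ) {κ : X → ℝ≥0∞} (hκ : Measurable κ) :
    ∀ᵐ c ∂μ, ∀ m, ENNReal.ofReal (c.marks ⟨(0, m + 1), Nat.succ_pos m⟩) ≠ κ (c.points m) := by
  refine ae_all_iff.2 fun m => ?_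
  have hs : MeasurableSet {c : Config X |
      ENNReal.ofReal (c.marks ⟨(0, m + 1), Nat.succ_pos m⟩) = κ (c.points m)} :=
    measurableSet_eq_fun
      (ENNReal.measurable_ofReal.comp ((measurable_pi_apply _).comp Config.measurable_marks))
      (hκ.comp ((measurable_pi_apply m).comp Config.measurable_points))
  rw [ae_iff]
  simp only [ne_eq, not_not]
  rw [← lintegral_indicator_one hs, h.resample _ (measurable_one.indicator hs)]
  refine (lintegral_congr fun c => ?_).trans lintegral_zero
  have hs' : MeasurableSet {u : ℝ | ENNReal.ofReal u = κ (c.points m)} :=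
    measurableSet_eq_fun ENNReal.measurable_ofReal measurable_const
  have := markLaw_coord ⟨(0, m + 1), Nat.succ_pos m⟩ hs'
  rw [unif_ofReal_eq] at this
  exact (lintegral_indicator_one (hs'.preimage (measurable_pi_apply _))).trans this

/-- The growth depends continuously on the set of points joined to the additional vertex. -/
lemma IsRCMLaw.growth_iInf_le (h : IsRCMLaw lam μ)
    (hphi : Measurable fun p : X × X => phi p.1 p.2) (hf : IsTest f) (s : ℕ) {ρ : X → ℝ≥0∞}
    {a : ℕ → X → ℝ≥0∞} (hρ : Measurable ρ) (hρ1 : ρ ≤ 1) (ha : ∀ N, Measurable (a N))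
    (ha1 : ∀ N, a N ≤ 1) (hanti : Antitone a) (D : Measure X) :
    growth phi μ f s ρ (⨅ N, a N) D ≤ ⨆ N, growth phi μ f s ρ (a N) D := by
  have hmono : ∀ c : Config X, Monotone fun N => reach phi ρ (a N) c s := fun c m n hmn =>
    reach_mono phi hρ1 le_rfl (ha1 n) (hanti hmn) c s
  have hm : ∀ N, Measurable fun c : Config X => f (D + cnt c.points (reach phi ρ (a N) c s)) :=
    fun N => hf.measurable.comp (measurable_const.add (measurable_cnt Config.measurable_points
      (measurable_reach hphi (ρ := fun _ => ρ) (a := fun _ => a N) (hρ.comp measurable_snd)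
        ((ha N).comp measurable_snd) measurable_id s)))
  unfold growth
  rw [← lintegral_iSup hm fun m n hmn c => hf.mono (add_le_add le_rfl (cnt_mono _ (hmono c hmn)))]
  have hinf : Measurable (⨅ N, a N) := by
    have : (⨅ N, a N) = fun z => ⨅ N, a N z := by ext z; simp
    rw [this]
    exact Measurable.iInf ha
  refine lintegral_mono_ae ((h.ae_mark_ne (measurable_hit hρ hinf)).mono fun c hc => ?_)
  -- A mark that is strictly smaller than the limit of the thresholds is below one of them.
  have hsub : sel (hit ρ (⨅ N, a N)) c ⊆ ⋃ N, sel (hit ρ (a N)) c := fun m hm => by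
    have h1 : hit ρ (⨅ N, a N) (c.points m) = ⨆ N, hit ρ (a N) (c.points m) := by
      have hne : ρ (c.points m) ≠ ∞ := ((hρ1 _).trans_lt ENNReal.one_lt_top).ne
      show ρ _ - ρ _ * (⨅ N, a N) _ = ⨆ N, (ρ _ - ρ _ * a N _)
      rw [iInf_apply, ENNReal.mul_iInf (fun _ => absurd · hne), ENNReal.sub_iInf]
    have h2 := lt_of_le_of_ne hm.2 (hc m)
    change _ < hit ρ (⨅ N, a N) (c.points m) at h2
    rw [h1] at h2
    obtain ⟨N, hN⟩ := lt_iSup_iff.1 h2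
    exact mem_iUnion.2 ⟨N, hm.1, hN.le⟩
  have hreach : reach phi ρ (⨅ N, a N) c s ⊆ ⋃ N, reach phi ρ (a N) c s := by
    unfold reach
    rw [← ball_iUnion]
    exact ball_mono subset_rfl hsub s
  exact (hf.mono (add_le_add le_rfl (cnt_mono _ hreach))).trans
    (hf.add_iUnion_le D c.points (hmono c))

/-- Without points joined to the additional vertex, no points are found. -/
lemma IsRCMLaw.growth_one (h : IsRCMLaw lam μ) (f : Measure X → ℝ≥0∞) (s : ℕ)
    (D : Measure X) : growth phi μ f s 1 1 D = f D := by
  have := h.prob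
  have e : ∀ᵐ c ∂μ, reach phi 1 1 c s = ∅ := by
    filter_upwards [h.ae_mark_ne measurable_zero] with c hc
    have h0 : sel (hit (1 : X → ℝ≥0∞) 1) c = ∅ := by
      ext m
      refine ⟨fun hm => hc m ?_, fun hm => hm.elim⟩
      refine le_antisymm (hm.2.trans_eq ?_) zero_le
      simp [hit]
    unfold reach
    rw [h0]
    induction s with
    | zero => rfl
    | succ s ih => rw [ball, ih]; simp [nbr]
  rw [growth, lintegral_congr_ae (e.mono fun c hc => by
    show _ = f D
    rw [hc, cnt_empty, add_zero])]
  simp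

lemma avoid_zero : avoid lam phi 0 = 1 := by
  ext z
  have : Tame lam (0 : Measure X) := fun j => by simp
  simp [avoid_of_tame this]

/-- The avoidance function of infinitely many points is the limit of those of finitely many. -/
lemma avoid_cnt_eq_iInf (hphi : Measurable fun p : X × X => phi p.1 p.2) {x : ℕ → X} {S : Set ℕ}
    (h : Tame lam (cnt x S)) :
    avoid lam phi (cnt x S) = ⨅ N, avoid lam phi (cnt x (S ∩ Iio N)) := by
  ext z
  rw [iInf_apply, avoid_cnt hphi h]
  have e : ∀ N, avoid lam phi (cnt x (S ∩ Iio N)) z = nexp (∑ k ∈ Finset.range N,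
      S.indicator (fun k => nlog (1 - ENNReal.ofReal (phi (x k) z))) k) := fun N => by
    rw [avoid_cnt hphi (h.mono (cnt_mono _ inter_subset_left)),
      tsum_eq_sum (s := Finset.range N)]
    · congr 1
      refine Finset.sum_congr rfl fun k hk => ?_
      rw [inter_comm, ← indicator_indicator, indicator_of_mem (mem_Iio.2 (Finset.mem_range.1 hk))]
    · intro k hk
      exact indicator_of_notMem (fun h => hk (Finset.mem_range.2 h.2)) _
  simp_rw [e]
  rw [ENNReal.tsum_eq_iSup_nat]
  exact nexp_antitone.map_ciSup_of_continuousAt continuous_nexp.continuousAt (OrderTop.bddAbove _)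

end Continuity

/-! ### Graph distances -/

lemma SimpleGraph.edist_le_succ_iff {V : Type*} (G : SimpleGraph V) (u v : V) (s : ℕ) :
    G.edist u v ≤ (s + 1 : ℕ) ↔ G.edist u v ≤ s ∨ ∃ w, G.edist u w ≤ s ∧ G.Adj w v := by
  constructor
  · intro h
    have hne : G.edist v u ≠ ⊤ := by
      rw [SimpleGraph.edist_comm]
      exact (h.trans_lt (ENat.natCast_lt_top _)).ne
    obtain ⟨p, hp⟩ := SimpleGraph.exists_walk_of_edist_ne_top hne
    rw [SimpleGraph.edist_comm, ← hp] at h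
    cases p with
    | nil => left; simp
    | cons hadj q =>
      right
      refine ⟨_, ?_, hadj.symm⟩
      rw [SimpleGraph.edist_comm]
      refine (SimpleGraph.edist_le q).trans ?_
      simp only [SimpleGraph.Walk.length_cons, Nat.cast_le, add_le_add_iff_right] at h
      exact_mod_cast h
  · rintro (h | ⟨w, h, hw⟩)
    · exact h.trans (by exact_mod_cast Nat.le_succ s)
    · refine (SimpleGraph.edist_triangle (v := w)).trans ?_
      rw [SimpleGraph.edist_eq_one_iff_adj.2 hw]
      push_cast
      gcongr

section Graph

variable {X : Type*} {phi : X → X → ℝ} {x : X} {c : Config X}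

lemma Config.adj_zero_iff (k : ℕ) : (c.graph phi x).Adj 0 (k + 1) ↔
    (k : ℕ∞) < c.count ∧ c.marks ⟨(0, k + 1), Nat.succ_pos k⟩ ≤ phi x (c.points k) := by
  simp only [Config.graph, SimpleGraph.fromRel_adj, not_lt_zero, IsEmpty.exists_iff, or_false]
  have : (((k + 1 : ℕ) : ℕ∞) ≤ c.count) ↔ (k : ℕ∞) < c.count := by
    push_cast
    exact ENat.add_one_le_iff (ENat.natCast_ne_top k)
  rw [this]
  simp [Config.loc]

lemma Config.adj_succ_iff (hsymm : ∀ x y, phi x y = phi y x)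
    (hunit : ∀ x y, phi x y ∈ Icc (0 : ℝ) 1) (j k : ℕ) :
    (c.graph phi x).Adj (j + 1) (k + 1) ↔ (j : ℕ∞) < c.count ∧ (k : ℕ∞) < c.count ∧
      edge (pointMarks c.marks) j k ≤ phi (c.points j) (c.points k) := by
  have hc : ∀ k : ℕ, (((k + 1 : ℕ) : ℕ∞) ≤ c.count) ↔ (k : ℕ∞) < c.count := fun k => by
    push_cast
    exact ENat.add_one_le_iff (ENat.natCast_ne_top k)
  simp only [Config.graph, SimpleGraph.fromRel_adj, hc, Config.loc]
  have hlt : ∀ {a b : ℕ}, a < b → (b : ℕ∞) < c.count → (a : ℕ∞) < c.count := fun h h' =>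
    lt_trans (by exact_mod_cast h) h'
  rcases lt_trichotomy j k with h | rfl | h
  · have e : edge (pointMarks c.marks) j k = c.marks ⟨(j + 1, k + 1), Nat.succ_lt_succ h⟩ := by
      simp [edge, h, pointMarks]
    rw [e]
    constructor
    · rintro ⟨_, ⟨_, h1, h2⟩ | ⟨h1, _⟩⟩
      · exact ⟨hlt h h1, h1, h2⟩
      · omega
    · rintro ⟨_, h1, h2⟩
      exact ⟨by omega, Or.inl ⟨Nat.succ_lt_succ h, h1, h2⟩⟩
  · have e : edge (pointMarks c.marks) j j = 2 := by simp [edge]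
    rw [e]
    have := (hunit (c.points j) (c.points j)).2
    constructor
    · rintro ⟨h, _⟩; exact absurd rfl h
    · rintro ⟨_, _, h⟩; linarith
  · have e : edge (pointMarks c.marks) j k = c.marks ⟨(k + 1, j + 1), Nat.succ_lt_succ h⟩ := by
      simp [edge, h, h.not_gt, pointMarks]
    rw [e, hsymm (c.points j)]
    constructor
    · rintro ⟨_, ⟨h1, _⟩ | ⟨_, h1, h2⟩⟩
      · omega
      · exact ⟨h1, hlt h h1, h2⟩
    · rintro ⟨h1, _, h2⟩
      exact ⟨by omega, Or.inr ⟨Nat.succ_lt_succ h, h1, h2⟩⟩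

end Graph

section Reach

variable {X : Type u} [MeasurableSpace X] {lam : Measure X} [SigmaFinite lam] {phi : X → X → ℝ}
  {μ : Measure (Config X)}

/-- The exploration finds the vertices at graph distance at most `s`. -/
lemma Config.edist_le_iff (hphi : Measurable fun p : X × X => phi p.1 p.2)
    (hsymm : ∀ x y, phi x y = phi y x) (hunit : ∀ x y, phi x y ∈ Icc (0 : ℝ) 1)
    (x : X) {c : Config X} (hc : ∀ p, c.marks p ≤ 1) (s m : ℕ) :
    (c.graph phi x).edist 0 m ≤ s ↔
      m = 0 ∨ ∃ k ∈ reach phi 1 (avoid lam phi (Measure.dirac x)) c s, m = k + 1 := by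
  have hA : ∀ k, k ∈ sel 1 c ↔ (k : ℕ∞) < c.count := fun k =>
    and_iff_left (ENNReal.ofReal_le_one.2 (hc _))
  have hE : ∀ k, k ∈ sel (hit 1 (avoid lam phi (Measure.dirac x))) c ↔
      (c.graph phi x).Adj 0 (k + 1) := fun k => by
    rw [Config.adj_zero_iff]
    refine and_congr_right fun _ => ?_
    have h1 : ENNReal.ofReal (phi x (c.points k)) ≤ 1 := ENNReal.ofReal_le_one.2 (hunit _ _).2
    have : hit 1 (avoid lam phi (Measure.dirac x)) (c.points k) =
        ENNReal.ofReal (phi x (c.points k)) := by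
      simp only [hit, avoid_dirac hphi, Pi.one_apply, one_mul]
      exact ENNReal.sub_sub_cancel ENNReal.one_ne_top h1
    rw [this, ENNReal.ofReal_le_ofReal_iff (hunit _ _).1]
  induction s generalizing m with
  | zero =>
    simp only [Nat.cast_zero, nonpos_iff_eq_zero, SimpleGraph.edist_eq_zero_iff]
    simp [reach, ball, eq_comm]
  | succ s ih =>
    refine ((SimpleGraph.edist_le_succ_iff _ _ _ _).trans (or_congr_left (ih m))).trans ?_
    rcases m with _ | k
    · simp
    · simp only [Nat.add_eq_zero_iff, one_ne_zero, and_false, false_or, add_left_inj,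
        exists_eq_right']
      have e : k ∈ reach phi 1 (avoid lam phi (Measure.dirac x)) c (s + 1) ↔
          k ∈ sel (hit 1 (avoid lam phi (Measure.dirac x))) c ∨
            k ∈ nbr phi c.points (pointMarks c.marks) (sel 1 c)
              (reach phi 1 (avoid lam phi (Measure.dirac x)) c s) := Iff.rfl
      rw [e, hE]
      constructor
      · rintro (h | ⟨w, hw, hwk⟩)
        · exact (e.trans (or_congr_left (hE k))).1 (monotone_reach _ _ _ _ (Nat.le_succ s) h)
        · rcases (ih w).1 hw with rfl | ⟨j, hj, rfl⟩
          · exact Or.inl hwk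
          · obtain ⟨_, h2, h3⟩ := (Config.adj_succ_iff hsymm hunit _ _).1 hwk
            exact Or.inr ⟨(hA k).2 h2, j, hj, h3⟩
      · rintro (h | ⟨h1, j, hj, h3⟩)
        · exact Or.inr ⟨0, by simp, h⟩
        · have hjA : j ∈ sel 1 c := by
            refine ball_subset ?_ s hj
            exact sel_mono (hit_le _ _) c
          exact Or.inr ⟨j + 1, (ih _).2 (Or.inr ⟨j, hj, rfl⟩),
            (Config.adj_succ_iff hsymm hunit _ _).2 ⟨(hA j).1 hjA, (hA k).1 h1, h3⟩⟩

lemma IsRCMLaw.ae_marks_le (h : IsRCMLaw lam μ) : ∀ᵐ c ∂μ, ∀ p, c.marks p ≤ 1 := by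
  refine ae_all_iff.2 fun p => ?_
  have hs : MeasurableSet {c : Config X | ¬ c.marks p ≤ 1} :=
    (measurableSet_le ((measurable_pi_apply p).comp Config.measurable_marks)
      measurable_const).compl
  rw [ae_iff, ← lintegral_indicator_one hs, h.resample _ (measurable_one.indicator hs)]
  refine (lintegral_congr fun c => ?_).trans lintegral_zero
  have hs' : MeasurableSet {u : ℝ | ¬ u ≤ 1} := measurableSet_Iic.compl
  have e : unif {u : ℝ | ¬ u ≤ 1} = 0 := by
    have : unif {u : ℝ | ¬ u ≤ 1}ᶜ = 1 := by
      simpa [compl_ofPred] using unif_Iic (p := 1) ⟨zero_le_one, le_rfl⟩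
    exact (prob_compl_eq_one_iff hs').1 this
  exact (lintegral_indicator_one (hs'.preimage (measurable_pi_apply p))).trans
    ((markLaw_coord p hs').trans e)

variable (lam) in
/-- The ball of the random connection model, without its centre, consists of the points reached in
`n` steps. -/
lemma Config.clusterLE'_eq (hphi : Measurable fun p : X × X => phi p.1 p.2)
    (hsymm : ∀ x y, phi x y = phi y x) (hunit : ∀ x y, phi x y ∈ Icc (0 : ℝ) 1)
    (x : X) {c : Config X} (hc : ∀ p, c.marks p ≤ 1) (n : ℕ) :
    c.clusterLE' phi x n =
      cnt c.points (reach phi 1 (avoid lam phi (Measure.dirac x)) c n) := by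
  have := cnt_image_succ (c.loc x) (reach phi 1 (avoid lam phi (Measure.dirac x)) c n)
  refine Eq.trans ?_ this
  show cnt (c.loc x) _ = _
  congr 1
  ext m
  show m ≠ 0 ∧ _ ↔ _
  rw [Config.edist_le_iff (lam := lam) hphi hsymm hunit x hc]
  constructor
  · rintro ⟨h0, h | h⟩
    · exact absurd h h0
    · exact h
  · rintro ⟨k, hk, rfl⟩
    exact ⟨k.succ_ne_zero, Or.inr ⟨k, hk, rfl⟩⟩

lemma Config.clusterLE_eq (phi : X → X → ℝ) (x : X) (c : Config X) (n : ℕ) :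
    c.clusterLE phi x n = Measure.dirac x + c.clusterLE' phi x n := by
  have : {m | (c.graph phi x).edist 0 m ≤ n} =
      {0} ∪ {m | m ≠ 0 ∧ (c.graph phi x).edist 0 m ≤ n} := by
    ext m
    rcases eq_or_ne m 0 with rfl | h
    · simp
    · simp [h]
  show cnt (c.loc x) _ = _
  rw [this, cnt_union _ (by simp), cnt_singleton]
  rfl

variable (lam) in
/-- The vertices at graph distance exactly `n + 1` are those found in the last step. -/
lemma Config.edist_eq_iff (hphi : Measurable fun p : X × X => phi p.1 p.2)
    (hsymm : ∀ x y, phi x y = phi y x) (hunit : ∀ x y, phi x y ∈ Icc (0 : ℝ) 1)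
    (x : X) {c : Config X} (hc : ∀ p, c.marks p ≤ 1) (n m : ℕ) :
    (c.graph phi x).edist 0 m = (n + 1 : ℕ) ↔
      ∃ k ∈ reach phi 1 (avoid lam phi (Measure.dirac x)) c (n + 1) \
        reach phi 1 (avoid lam phi (Measure.dirac x)) c n, m = k + 1 := by
  have h : (c.graph phi x).edist 0 m = (n + 1 : ℕ) ↔
      (c.graph phi x).edist 0 m ≤ (n + 1 : ℕ) ∧ ¬ (c.graph phi x).edist 0 m ≤ n := by
    rw [not_le, le_antisymm_iff]
    refine and_congr_right fun _ => ?_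
    push_cast
    exact ENat.add_one_le_iff (ENat.natCast_ne_top n)
  rw [h, Config.edist_le_iff (lam := lam) hphi hsymm hunit x hc,
    Config.edist_le_iff (lam := lam) hphi hsymm hunit x hc]
  constructor
  · rintro ⟨h1 | ⟨k, hk, rfl⟩, h2⟩
    · exact absurd (Or.inl h1) h2
    · exact ⟨k, ⟨hk, fun h => h2 (Or.inr ⟨k, h, rfl⟩)⟩, rfl⟩
  · rintro ⟨k, hk, rfl⟩
    refine ⟨Or.inr ⟨k, hk.1, rfl⟩, ?_⟩
    rintro (h | ⟨j, hj, h⟩)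
    · exact k.succ_ne_zero h
    · exact hk.2 (Nat.succ_injective h ▸ hj)

/-! ### Measurability of the clusters -/

lemma Config.measurable_loc {α : Type*} [MeasurableSpace α] {x : α → X} {c : α → Config X}
    (hx : Measurable x) (hc : Measurable c) : Measurable fun t => (c t).loc (x t) := by
  refine measurable_pi_lambda _ fun m => ?_
  cases m with
  | zero => exact hx
  | succ m => exact (measurable_pi_apply m).comp (Config.measurable_points.comp hc)

lemma Config.measurable_adj (hphi : Measurable fun p : X × X => phi p.1 p.2) {α : Type*}
    [MeasurableSpace α] {x : α → X} {c : α → Config X} (hx : Measurable x) (hc : Measurable c)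
    (m n : ℕ) : Measurable fun t => ((c t).graph phi (x t)).Adj m n := by
  have hrel : ∀ m n : ℕ, Measurable fun t => ∃ hmn : m < n, (n : ℕ∞) ≤ (c t).count ∧
      (c t).marks ⟨(m, n), hmn⟩ ≤ phi ((c t).loc (x t) m) ((c t).loc (x t) n) := fun m n => by
    have hl := fun k => (measurable_pi_apply k).comp (Config.measurable_loc hx hc)
    refine Measurable.exists fun hmn => Measurable.and ?_ ?_
    · exact measurableSet_setOfPred.1 ((Config.measurable_count.comp hc)
        (MeasurableSet.of_discrete (s := Ici (n : ℕ∞))))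
    · exact measurableSet_setOfPred.1 (measurableSet_le
        ((measurable_pi_apply _).comp (Config.measurable_marks.comp hc))
        (hphi.comp ((hl m).prodMk (hl n))))
  simp only [Config.graph, SimpleGraph.fromRel_adj]
  exact measurable_const.and ((hrel m n).or (hrel n m))

lemma Config.measurable_edist_le (hphi : Measurable fun p : X × X => phi p.1 p.2) {α : Type*}
    [MeasurableSpace α] {x : α → X} {c : α → Config X} (hx : Measurable x) (hc : Measurable c)
    (s : ℕ) : ∀ m, Measurable fun t => ((c t).graph phi (x t)).edist 0 m ≤ s := by
  induction s with
  | zero =>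
    intro m
    simp only [Nat.cast_zero, nonpos_iff_eq_zero, SimpleGraph.edist_eq_zero_iff]
    exact measurable_const
  | succ s ih =>
    intro m
    simp only [SimpleGraph.edist_le_succ_iff]
    exact (ih m).or (Measurable.exists fun w => (ih w).and (Config.measurable_adj hphi hx hc w m))

lemma Config.measurable_edist_eq (hphi : Measurable fun p : X × X => phi p.1 p.2) {α : Type*}
    [MeasurableSpace α] {x : α → X} {c : α → Config X} (hx : Measurable x) (hc : Measurable c)
    (s m : ℕ) : Measurable fun t => ((c t).graph phi (x t)).edist 0 m = s := by
  cases s with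
  | zero =>
    simpa only [Nat.cast_zero, nonpos_iff_eq_zero] using Config.measurable_edist_le hphi hx hc 0 m
  | succ s =>
    have h : ∀ t, ((c t).graph phi (x t)).edist 0 m = (s + 1 : ℕ) ↔
        ((c t).graph phi (x t)).edist 0 m ≤ (s + 1 : ℕ) ∧
          ¬ ((c t).graph phi (x t)).edist 0 m ≤ s := fun t => by
      rw [not_le, le_antisymm_iff]
      refine and_congr_right fun _ => ?_
      push_cast
      exact ENat.add_one_le_iff (ENat.natCast_ne_top s)
    simp only [h]
    exact (Config.measurable_edist_le hphi hx hc _ m).and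
      (Config.measurable_edist_le hphi hx hc _ m).not

lemma Config.measurable_clusterLE' (hphi : Measurable fun p : X × X => phi p.1 p.2) {α : Type*}
    [MeasurableSpace α] {x : α → X} {c : α → Config X} (hx : Measurable x) (hc : Measurable c)
    (n : ℕ) : Measurable fun t => (c t).clusterLE' phi (x t) n :=
  measurable_cnt (Config.measurable_loc hx hc) (measurable_set_iff.2 fun m =>
    measurable_const.and (Config.measurable_edist_le hphi hx hc n m))

lemma Config.measurable_clusterLE (hphi : Measurable fun p : X × X => phi p.1 p.2) {α : Type*}
    [MeasurableSpace α] {x : α → X} {c : α → Config X} (hx : Measurable x) (hc : Measurable c)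
    (n : ℕ) : Measurable fun t => (c t).clusterLE phi (x t) n :=
  measurable_cnt (Config.measurable_loc hx hc) (measurable_set_iff.2 fun m =>
    Config.measurable_edist_le hphi hx hc n m)

omit [MeasurableSpace X] in
lemma Config.reachable_iff {phi : X → X → ℝ} {x : X} {c : Config X} (m : ℕ) :
    (c.graph phi x).Reachable 0 m ↔ ∃ n : ℕ, (c.graph phi x).edist 0 m ≤ n := by
  rw [← SimpleGraph.edist_ne_top_iff_reachable]
  constructor
  · intro h
    obtain ⟨n, hn⟩ := ENat.ne_top_iff_exists.1 h
    exact ⟨n, hn.ge⟩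
  · rintro ⟨n, hn⟩
    exact (hn.trans_lt (ENat.natCast_lt_top n)).ne

lemma Config.cluster_eq_iUnion (phi : X → X → ℝ) (x : X) (c : Config X) :
    c.cluster phi x = cnt (c.loc x) (⋃ n : ℕ, {m | (c.graph phi x).edist 0 m ≤ n}) := by
  show cnt _ _ = _
  congr 1
  ext m
  rw [mem_iUnion]
  exact Config.reachable_iff m

end Reach

/-! ### The branching process -/

lemma measurable_apply_nat {α β : Type*} [MeasurableSpace α] [MeasurableSpace β]
    {G : ℕ → α → β} (hG : ∀ n, Measurable (G n)) {n : α → ℕ} (hn : Measurable n) :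
    Measurable fun t => G (n t) t :=
  (measurable_from_prod_countable_right (f := Function.uncurry G) hG).comp
    (hn.prodMk measurable_id)

namespace Branching

variable {X : Type u}

/-- The data of the descendants of the child `[m]` of the ancestor. -/
def subtree (b : List ℕ → Config X) (m : ℕ) : List ℕ → Config X := fun u => b (u ++ [m])

/-- Individuals are named by the path from the individual to the ancestor, so that `u ++ [m]` is the
descendant `u` of the child `[m]`. -/
lemma pos_append (v : X) (b : List ℕ → Config X) (m : ℕ) (u : List ℕ) :
    pos v b (u ++ [m]) = pos ((b []).loc v m) (subtree b m) u := by
  induction u with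
  | nil => rfl
  | cons j u ih => simp only [List.cons_append, pos, ih]; rfl

/-- The individuals other than the ancestor are those of the trees of its children. -/
lemma isIndividual_append (phi : X → X → ℝ) (h : X → ℕ) (v : X) (b : List ℕ → Config X) (m : ℕ)
    (u : List ℕ) : IsIndividual phi h v b (u ++ [m]) ↔
      ((b []).graph phi v).edist 0 m = h v ∧
        IsIndividual phi h ((b []).loc v m) (subtree b m) u := by
  induction u with
  | nil => simp [IsIndividual, pos]
  | cons j u ih =>
    simp only [List.cons_append, IsIndividual, ih, pos_append, and_assoc]
    rfl

variable [MeasurableSpace X] {phi : X → X → ℝ} {h : X → ℕ}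

lemma Wtilde_succ_apply (v : X) (b : List ℕ → Config X) (k : ℕ) {B : Set X}
    (hB : MeasurableSet B) : Wtilde phi h v b (k + 1) B =
      ∑' u, {u | u.length = k ∧ IsIndividual phi h v b u}.indicator
        (fun u => (b u).clusterLE' phi (pos v b u) (h (pos v b u)) B) u := by
  rw [← tsum_subtype, Wtilde, Measure.sum_apply _ hB]
  rfl

lemma Wtilde_one (v : X) (b : List ℕ → Config X) :
    Wtilde phi h v b 1 = (b []).clusterLE' phi v (h v) := by
  ext B hB
  rw [Wtilde_succ_apply v b 0 hB, tsum_eq_single []]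
  · rw [indicator_of_mem (by exact ⟨rfl, trivial⟩)]
    rfl
  · intro u hu
    exact indicator_of_notMem (fun h => hu (List.length_eq_zero_iff.1 h.1)) _

/-- The descendants of the ancestor are those of its children. -/
lemma Wtilde_add_two_apply (v : X) (b : List ℕ → Config X) (k : ℕ) {B : Set X}
    (hB : MeasurableSet B) : Wtilde phi h v b (k + 2) B =
      ∑' m, {m | ((b []).graph phi v).edist 0 m = h v}.indicator
        (fun m => Wtilde phi h ((b []).loc v m) (subtree b m) (k + 1) B) m := by
  classical
  have hinj : Function.Injective fun p : ℕ × List ℕ => p.2 ++ [p.1] := fun p q hpq => by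
    have := List.append_inj' (show p.2 ++ [p.1] = q.2 ++ [q.1] from hpq) rfl
    exact Prod.ext (List.singleton_inj.1 this.2) this.1
  rw [Wtilde_succ_apply v b (k + 1) hB, ← hinj.tsum_eq, ENNReal.tsum_prod']
  · refine tsum_congr fun m => ?_
    by_cases hm : ((b []).graph phi v).edist 0 m = h v
    · rw [indicator_of_mem (by exact hm), Wtilde_succ_apply _ _ _ hB]
      refine tsum_congr fun u => ?_
      simp only [indicator_apply, mem_ofPred_eq, isIndividual_append, pos_append, hm, true_and,
        List.length_append, List.length_singleton, add_left_inj]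
      rfl
    · rw [indicator_of_notMem (by exact hm)]
      refine ENNReal.tsum_eq_zero.2 fun u => indicator_of_notMem (fun hu => hm ?_) _
      exact ((isIndividual_append _ _ _ _ _ _).1 hu.2).1
  · intro u hu
    have hlen : u.length = k + 1 := (mem_of_indicator_ne_zero hu).1
    rcases List.eq_nil_or_concat u with rfl | ⟨w, m, rfl⟩
    · simp at hlen
    · exact ⟨(m, w), by simp⟩

variable (phi h) in
/-- The offspring of the first `k` generations, without the ancestor itself. -/
def progeny (k : ℕ) (v : X) (b : List ℕ → Config X) : Measure X :=
  ∑ i ∈ Finset.range k, Wtilde phi h v b (i + 1)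

lemma WtildeLE_eq (v : X) (b : List ℕ → Config X) (k : ℕ) :
    WtildeLE phi h v b k = Measure.dirac v + progeny phi h k v b := by
  rw [WtildeLE, Finset.sum_range_succ', add_comm]
  rfl

/-- The branching property: the progeny consists of the ball around the ancestor and of the
progenies of the vertices at distance `h v`. -/
lemma progeny_succ_apply (k : ℕ) (v : X) (b : List ℕ → Config X) {B : Set X}
    (hB : MeasurableSet B) : progeny phi h (k + 1) v b B =
      (b []).clusterLE' phi v (h v) B +
      ∑' m, {m | ((b []).graph phi v).edist 0 m = h v}.indicator
        (fun m => progeny phi h k ((b []).loc v m) (subtree b m) B) m := by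
  have e : ∀ k v b, progeny phi h k v b B = ∑ i ∈ Finset.range k, Wtilde phi h v b (i + 1) B :=
    fun k v b => by rw [progeny, Measure.finsetSum_apply]
  simp only [e]
  rw [Finset.sum_range_succ', add_comm, Wtilde_one]
  congr 1
  simp only [Wtilde_add_two_apply _ _ _ hB]
  rw [← Summable.tsum_finsetSum fun _ _ => ENNReal.summable]
  refine tsum_congr fun m => ?_
  by_cases hm : ((b []).graph phi v).edist 0 m = h v <;> simp [hm]

section Measurability

variable {α : Type*} [MeasurableSpace α] {v : α → X} {b : α → List ℕ → Config X}

lemma measurable_pos (hv : Measurable v) (hb : Measurable b) (u : List ℕ) :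
    Measurable fun t => pos (v t) (b t) u := by
  induction u with
  | nil => exact hv
  | cons m u ih =>
    exact (measurable_pi_apply m).comp
      (Config.measurable_loc ih ((measurable_pi_apply u).comp hb))

lemma measurable_isIndividual (hphi : Measurable fun p : X × X => phi p.1 p.2)
    (hh : Measurable h) (hv : Measurable v) (hb : Measurable b) (u : List ℕ) :
    Measurable fun t => IsIndividual phi h (v t) (b t) u := by
  induction u with
  | nil => exact measurable_const
  | cons m u ih =>
    have hp := measurable_pos hv hb u
    have e : ∀ t, ((b t u).graph phi (pos (v t) (b t) u)).edist 0 m = h (pos (v t) (b t) u) ↔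
        ∃ n : ℕ, h (pos (v t) (b t) u) = n ∧
          ((b t u).graph phi (pos (v t) (b t) u)).edist 0 m = n := fun t => by simp
    simp only [IsIndividual, e]
    exact ih.and (Measurable.exists fun n => Measurable.and
      (measurableSet_setOfPred.1 ((hh.comp hp) (measurableSet_singleton n)))
      (Config.measurable_edist_eq hphi hp ((measurable_pi_apply u).comp hb) n m))

lemma measurable_Wtilde (hphi : Measurable fun p : X × X => phi p.1 p.2)
    (hh : Measurable h) (hv : Measurable v) (hb : Measurable b) (k : ℕ) :
    Measurable fun t => Wtilde phi h (v t) (b t) k := by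
  cases k with
  | zero => exact Measure.measurable_dirac.comp hv
  | succ k =>
    refine Measure.measurable_of_measurable_coe _ fun B hB => ?_
    simp_rw [Wtilde_succ_apply _ _ _ hB]
    refine Measurable.tsum fun u => ?_
    have hp := measurable_pos hv hb u
    have hm : Measurable fun t =>
        (b t u).clusterLE' phi (pos (v t) (b t) u) (h (pos (v t) (b t) u)) :=
      measurable_apply_nat (fun n =>
        Config.measurable_clusterLE' hphi hp ((measurable_pi_apply u).comp hb) n) (hh.comp hp)
    have hs : MeasurableSet {t | u.length = k ∧ IsIndividual phi h (v t) (b t) u} :=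
      measurableSet_setOfPred.2 (measurable_const.and (measurable_isIndividual hphi hh hv hb u))
    exact ((Measure.measurable_coe hB).comp hm).indicator hs

lemma measurable_progeny (hphi : Measurable fun p : X × X => phi p.1 p.2)
    (hh : Measurable h) (hv : Measurable v) (hb : Measurable b) (k : ℕ) :
    Measurable fun t => progeny phi h k (v t) (b t) :=
  Finset.measurable_sum _ fun i _ => measurable_Wtilde hphi hh hv hb (i + 1)

lemma measurable_subtree (m : ℕ) : Measurable fun b : List ℕ → Config X => subtree b m :=
  measurable_pi_lambda _ fun _ => measurable_pi_apply _

end Measurability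

end Branching

/-! ### Comparison with the branching process -/

section Comparison

variable {X : Type u} [MeasurableSpace X] {lam : Measure X} [SigmaFinite lam] {phi : X → X → ℝ}
  {μ : Measure (Config X)}

open Branching

/-- If single sources can be compared with offspring processes, then so can countably many sources
with independent offspring processes. -/
lemma IsRCMLaw.growth_avoid_cnt_le (hμ : IsRCMLaw lam μ)
    (hphi : Measurable fun p : X × X => phi p.1 p.2) (hunit : ∀ x y, phi x y ∈ Icc (0 : ℝ) 1)
    {s : ℕ} {x : ℕ → X} {L : Set ℕ} (hL : Tame lam (cnt x L))
    {W : ℕ → (List ℕ → Config X) → Measure X} (hW : ∀ i, Measurable (W i))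
    {ν : List ℕ → Measure (Config X)} [∀ u, IsProbabilityMeasure (ν u)]
    (hle : ∀ i f, IsTest f → ∀ D, growth phi μ f s 1 (avoid lam phi (Measure.dirac (x i))) D ≤
      ∫⁻ b, f (D + W i b) ∂Measure.infinitePi fun u => ν (u ++ [i + 1]))
    {f : Measure X → ℝ≥0∞} (hf : IsTest f) (D : Measure X) :
    growth phi μ f s 1 (avoid lam phi (cnt x L)) D ≤ ⨆ N,
      ∫⁻ b, f (D + ∑ i ∈ Finset.range N, L.indicator (fun i => W i (subtree b (i + 1))) i)
        ∂Measure.infinitePi ν := by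
  classical
  have := hμ.prob
  have av : ∀ χ, avoid lam phi χ ≤ 1 := fun χ z => avoid_le_one _ _ _
  have hT : ∀ N, Tame lam (cnt x (L ∩ Iio N)) := fun N => hL.mono (cnt_mono x inter_subset_left)
  rw [avoid_cnt_eq_iInf hphi hL]
  refine (hμ.growth_iInf_le hphi hf s (ρ := 1) measurable_one le_rfl
    (fun N => measurable_avoid_const hphi _) (fun N => av _) (fun M N hMN z => avoid_anti (hT N)
      (cnt_mono x (inter_subset_inter_right _ (Iio_subset_Iio hMN))) z) D).trans
    (iSup_mono fun N => ?_)
  have hP : ∀ N, Measurable fun b : List ℕ → Config X =>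
      ∑ i ∈ Finset.range N, L.indicator (fun i => W i (subtree b (i + 1))) i := fun N =>
    Finset.measurable_sum _ fun i _ => by
      by_cases hi : i ∈ L
      · simp only [indicator_of_mem hi]
        exact (hW i).comp (measurable_subtree _)
      · simp only [indicator_of_notMem hi]
        exact measurable_const
  induction N generalizing f D with
  | zero =>
    have : L ∩ Iio 0 = ∅ := by ext; simp
    rw [this, cnt_empty, avoid_zero, hμ.growth_one]
    simp
  | succ N ih =>
    by_cases hN : N ∈ L
    swap
    · have : L ∩ Iio (N + 1) = L ∩ Iio N := by
        ext k
        simp only [mem_inter_iff, mem_Iio, Order.lt_add_one_iff, and_congr_right_iff]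
        intro hk
        refine ⟨fun h => lt_of_le_of_ne h ?_, le_of_lt⟩
        rintro rfl
        exact hN hk
      rw [this]
      simp only [Finset.sum_range_succ, indicator_of_notMem hN, add_zero]
      exact ih hf D
    · have hsplit : cnt x (L ∩ Iio (N + 1)) = cnt x (L ∩ Iio N) + Measure.dirac (x N) := by
        have : L ∩ Iio (N + 1) = (L ∩ Iio N) ∪ {N} := by
          ext k
          simp only [mem_inter_iff, mem_Iio, Order.lt_add_one_iff, mem_union, mem_singleton_iff]
          constructor
          · rintro ⟨h1, h2⟩
            rcases h2.lt_or_eq with h | h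
            · exact Or.inl ⟨h1, h⟩
            · exact Or.inr h
          · rintro (⟨h1, h2⟩ | rfl)
            · exact ⟨h1, h2.le⟩
            · exact ⟨hN, le_rfl⟩
        rw [this, cnt_union, cnt_singleton]
        simp
      have hav : avoid lam phi (cnt x (L ∩ Iio (N + 1))) =
          avoid lam phi (cnt x (L ∩ Iio N)) * avoid lam phi (Measure.dirac (x N)) := by
        rw [hsplit]
        exact funext fun z => avoid_add (hT N) (tame_dirac _) z
      have hg := hf.lintegral (Measure.infinitePi fun u => ν (u ++ [N + 1])) (hW N)
      rw [hav]
      refine (hμ.growth_mul_le hphi hunit hf.measurable hf.mono s (ρ := 1) (ρ₁ := 1) (ρ₂ := 1)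
        measurable_one measurable_one measurable_one (measurable_avoid_const hphi _)
        (measurable_avoid_const hphi _) le_rfl le_rfl le_rfl le_rfl (av _) (av _) D).trans ?_
      refine (growth_mono_fun (hle N f hf) s 1 _ D).trans ((ih hg D).trans (Eq.le ?_))
      -- The data of the descendants of the child `N + 1` are independent of the other ones.
      obtain ⟨J, hJ⟩ : ∃ J : Set (List ℕ), ∀ u, u ∈ J ↔ ¬ ∃ w, u = w ++ [N + 1] :=
        ⟨{u | _}, fun _ => Iff.rfl⟩
      have hlaw : (Measure.infinitePi ν).map (fun b => subtree b (N + 1)) =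
          Measure.infinitePi fun u => ν (u ++ [N + 1]) :=
        Measure.infinitePi_map_comp ν (σ := fun u : List ℕ => u ++ [N + 1])
          (List.append_left_injective [N + 1])
      rw [Measure.lintegral_infinitePi_piecewise ν J (Φ := fun b => f (D + ∑ i ∈
        Finset.range (N + 1), L.indicator (fun i => W i (subtree b (i + 1))) i))
        (by exact hf.measurable.comp (measurable_const.add (hP (N + 1))))]
      refine lintegral_congr fun b => ?_
      rw [← hlaw, lintegral_map (by exact hf.measurable.comp (measurable_const.add (hW N)))
        (measurable_subtree _)]
      refine lintegral_congr fun b' => ?_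
      have s1 : subtree (J.piecewise b b') (N + 1) = subtree b' (N + 1) := funext fun u =>
        piecewise_eq_of_notMem _ _ _ fun hu => (hJ _).1 hu ⟨u, rfl⟩
      have s2 : ∀ i ∈ Finset.range N, subtree (J.piecewise b b') (i + 1) = subtree b (i + 1) :=
        fun i hi => funext fun u => piecewise_eq_of_mem _ _ _ ((hJ _).2 (by
          rintro ⟨w, hw⟩
          have := (List.append_inj' hw rfl).2
          have := Finset.mem_range.1 hi
          simp at *
          omega))
      rw [Finset.sum_range_succ, indicator_of_mem hN, s1, ← add_assoc]
      congr 3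
      refine Finset.sum_congr rfl fun i hi => ?_
      by_cases hiL : i ∈ L
      · rw [indicator_of_mem hiL, indicator_of_mem hiL, s2 i hi]
      · rw [indicator_of_notMem hiL, indicator_of_notMem hiL]

/-- The balls around the ancestor in the random connection model are dominated by the branching
process. -/
theorem IsRCMLaw.growth_le_progeny (hμ : IsRCMLaw lam μ)
    (hphi : Measurable fun p : X × X => phi p.1 p.2) (hsymm : ∀ x y, phi x y = phi y x)
    (hunit : ∀ x y, phi x y ∈ Icc (0 : ℝ) 1) {h : X → ℕ} (hh : Measurable h) {n : ℕ} (hn : 1 ≤ n)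
    (hnh : ∀ x, n ≤ h x) (k : ℕ) :
    ∀ (ν : List ℕ → Measure (Config X)) [∀ u, IsProbabilityMeasure (ν u)],
      (∀ u, IsRCMLaw lam (ν u)) → ∀ (y : X) (f : Measure X → ℝ≥0∞), IsTest f → ∀ D : Measure X,
      growth phi μ f (k * n) 1 (avoid lam phi (Measure.dirac y)) D ≤
        ∫⁻ b, f (D + progeny phi h k y b) ∂Measure.infinitePi ν := by
  classical
  have := hμ.prob
  have av : ∀ χ, avoid lam phi χ ≤ 1 := fun χ z => avoid_le_one _ _ _
  induction k with
  | zero => intro ν _ _ y f _ D; simp [progeny]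
  | succ k ih =>
    intro ν _ hν y f hf D
    obtain ⟨j, hj⟩ : ∃ j, h y = j + 1 := ⟨h y - 1, by have := hnh y; omega⟩
    let R : Config X → ℕ → Set ℕ := reach phi 1 (avoid lam phi (Measure.dirac y))
    have hR : ∀ s, Measurable fun c => R c s := fun s =>
      measurable_reach hphi (ρ := fun _ => 1) (a := fun _ => avoid lam phi (Measure.dirac y))
        measurable_const ((measurable_avoid_const hphi _).comp measurable_snd) measurable_id s
    let Ψ : Config X → ℝ≥0∞ := fun c => growth phi μ f (k * n) 1
      (avoid lam phi (cnt c.points (R c (j + 1) \ R c j))) (D + cnt c.points (R c (j + 1)))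
    have hΨ : Measurable Ψ :=
      measurable_growth hphi hf.measurable (ρ := fun _ => 1)
        (a := fun c => avoid lam phi (cnt c.points (R c (j + 1) \ R c j))) measurable_const
        (measurable_avoid hphi ((measurable_cnt Config.measurable_points
          ((hR _).set_diff (hR _))).comp measurable_fst) measurable_snd)
        (measurable_const.add (measurable_cnt Config.measurable_points (hR _))) _
    calc growth phi μ f ((k + 1) * n) 1 (avoid lam phi (Measure.dirac y)) D
        ≤ growth phi μ f (k * n + (j + 1)) 1 (avoid lam phi (Measure.dirac y)) D := by
          refine growth_mono hf.mono le_rfl le_rfl (av _) le_rfl ?_ le_rfl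
          have := hnh y
          rw [add_mul]
          omega
      _ ≤ ∫⁻ c, Ψ c ∂ν [] := (hν []).growth_add_le hμ hphi hunit hf.measurable hf.mono (k * n) j
          measurable_one le_rfl (measurable_avoid_const hphi _) (av _) D
      _ = ∫⁻ b, Ψ (b []) ∂Measure.infinitePi ν := by
          rw [← Measure.infinitePi_map_eval ν [], lintegral_map hΨ (measurable_pi_apply _)]
      _ ≤ ∫⁻ b, f (D + progeny phi h (k + 1) y b) ∂Measure.infinitePi ν := ?_
    -- The data of the ancestor are independent of those of all other individuals.
    obtain ⟨J, hJ⟩ : ∃ J : Set (List ℕ), ∀ u, u ∈ J ↔ u = [] := ⟨{u | _}, fun _ => Iff.rfl⟩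
    rw [Measure.lintegral_infinitePi_piecewise ν J (Φ := fun b => f (D + progeny phi h (k + 1) y b))
      (hf.measurable.comp (measurable_const.add
        (measurable_progeny hphi hh measurable_const measurable_id (k + 1))))]
    have hgood : ∀ᵐ b ∂Measure.infinitePi ν, Tame lam (b []).eta ∧ ∀ p, (b []).marks p ≤ 1 :=
      (measurePreserving_eval_infinitePi ν []).quasiMeasurePreserving.ae
        ((hν []).tame.and (hν []).ae_marks_le)
    refine lintegral_mono_ae (hgood.mono fun b hb => ?_)
    have hA : ∀ s, R (b []) s ⊆ {m | (m : ℕ∞) < (b []).count} := fun s =>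
      (ball_subset (sel_mono (hit_le _ _) _) s).trans fun m hm => hm.1
    refine (hμ.growth_avoid_cnt_le hphi hunit (x := (b []).points)
      (L := R (b []) (j + 1) \ R (b []) j)
      (hb.1.mono (cnt_mono _ (sdiff_subset.trans (hA _))))
      (W := fun i b' => progeny phi h k ((b []).points i) b')
      (fun i => measurable_progeny hphi hh measurable_const measurable_id k) (ν := ν)
      (fun i g hg D => ih _ (fun u => hν _) _ g hg D) hf _).trans
      (iSup_le fun N => lintegral_mono fun b' => hf.mono ?_)
    rw [add_assoc]
    refine add_le_add le_rfl (Measure.le_iff.2 fun B hB => ?_)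
    have s0 : J.piecewise b b' [] = b [] := piecewise_eq_of_mem _ _ _ ((hJ _).2 rfl)
    have s1 : ∀ m, subtree (J.piecewise b b') m = subtree b' m := fun m => funext fun u =>
      piecewise_eq_of_notMem _ _ _ fun hu => by simpa using (hJ _).1 hu
    rw [progeny_succ_apply _ _ _ hB, s0, Config.clusterLE'_eq lam hphi hsymm hunit y hb.2,
      Measure.add_apply, hj]
    refine add_le_add le_rfl ?_
    simp only [s1, Measure.finsetSum_apply]
    refine le_trans ?_ (ENNReal.sum_le_tsum ((Finset.range N).map (addRightEmbedding 1)))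
    rw [Finset.sum_map]
    refine Finset.sum_le_sum fun i _ => ?_
    by_cases hi : i ∈ R (b []) (j + 1) \ R (b []) j
    · rw [indicator_of_mem hi, indicator_of_mem]
      · exact le_rfl
      · exact (Config.edist_eq_iff lam hphi hsymm hunit y hb.2 j _).2 ⟨i, hi, rfl⟩
    · rw [indicator_of_notMem hi]
      exact zero_le

end Comparison

/-! ### Closure properties of the set of counting measures -/

section Counting

variable {X : Type*} [MeasurableSpace X]

lemma cnt_mem_countingMeasures (x : ℕ → X) (S : Set ℕ) : cnt x S ∈ countingMeasures X :=
  ⟨S, x, rfl⟩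

lemma sum_dirac_mem_countingMeasures [Nonempty X] {ι : Type*} [Countable ι] (x : ι → X) :
    Measure.sum (fun i => Measure.dirac (x i)) ∈ countingMeasures X := by
  obtain ⟨e, he⟩ := exists_injective_nat ι
  refine ⟨range e, Function.extend e x fun _ => Classical.arbitrary X, ?_⟩
  ext B hB
  rw [Measure.sum_apply _ hB, Measure.sum_apply _ hB,
    ← (Equiv.ofInjective e he).tsum_eq (fun i : range e => Measure.dirac _ B)]
  refine tsum_congr fun i => ?_
  rw [Equiv.ofInjective_apply, he.extend_apply]

lemma sum_mem_countingMeasures [Nonempty X] {ι : Type*} [Countable ι] {χ : ι → Measure X}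
    (h : ∀ i, χ i ∈ countingMeasures X) : Measure.sum χ ∈ countingMeasures X := by
  choose S x hx using h
  have e : Measure.sum χ =
      Measure.sum fun p : (Σ i, S i) => Measure.dirac (x p.1 p.2) := by
    ext B hB
    rw [Measure.sum_apply _ hB, Measure.sum_apply _ hB, ENNReal.tsum_sigma']
    refine tsum_congr fun i => ?_
    rw [hx i, Measure.sum_apply _ hB]
  rw [e]
  exact sum_dirac_mem_countingMeasures _

lemma add_mem_countingMeasures [Nonempty X] {χ χ' : Measure X} (h : χ ∈ countingMeasures X)
    (h' : χ' ∈ countingMeasures X) : χ + χ' ∈ countingMeasures X := by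
  have := sum_mem_countingMeasures (χ := fun b : Bool => cond b χ χ') (by rintro (_ | _) <;> simpa)
  rwa [Measure.sum_bool] at this

lemma restrict_mem_countingMeasures {χ : Measure X} (h : χ ∈ countingMeasures X) {B : Set X}
    (hB : MeasurableSet B) : χ.restrict B ∈ countingMeasures X := by
  obtain ⟨S, x, rfl⟩ := h
  refine ⟨S ∩ x ⁻¹' B, x, ?_⟩
  show (cnt x S).restrict B = cnt x (S ∩ x ⁻¹' B)
  ext A hA
  rw [Measure.restrict_apply hA, cnt_apply _ _ (hA.inter hB), cnt_apply _ _ hA]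
  refine tsum_congr fun m => ?_
  by_cases h1 : m ∈ S <;> by_cases h2 : x m ∈ B <;> by_cases h3 : x m ∈ A <;> simp [h1, h2, h3]

end Counting

/-! ### Comparison of counting measures on an algebra of sets -/

section Algebra

variable {X : Type*} [TopologicalSpace X] [PolishSpace X] [MeasurableSpace X] [BorelSpace X]
  {𝒜 : Set (Set X)}

/-- Measures that are comparable on an algebra containing a base of the topology are comparable
on each set of the algebra of finite measure. -/
lemma restrict_le_of_algebra (h𝒜 : IsSetAlgebra 𝒜) {𝓑 : Set (Set X)} (h𝓑 : 𝓑.Countable)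
    (hbasis : TopologicalSpace.IsTopologicalBasis 𝓑) (h𝓑𝒜 : 𝓑 ⊆ 𝒜) {χ χ' : Measure X}
    (hle : ∀ C ∈ 𝒜, χ C ≤ χ' C) {C : Set X} (hC : C ∈ 𝒜) (hCm : MeasurableSet C)
    (hfin : χ' C < ∞) :
    χ.restrict C ≤ χ'.restrict C := by
  have : IsFiniteMeasure (χ'.restrict C) := ⟨by simpa using hfin⟩
  have hopen : ∀ O, IsOpen O → χ.restrict C O ≤ χ'.restrict C O := fun O hO => by
    obtain ⟨𝓢, h𝓢, rfl⟩ := hbasis.open_eq_sUnion hO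
    obtain ⟨U, hU⟩ := ((h𝓑.mono h𝓢).union (countable_singleton (∅ : Set X))).exists_eq_range
      ⟨∅, Or.inr rfl⟩
    have hUm : ∀ n, U n ∈ 𝒜 := fun n => by
      rcases (hU ▸ mem_range_self n : U n ∈ 𝓢 ∪ {∅}) with h | h
      · exact h𝓑𝒜 (h𝓢 h)
      · rw [h]; exact h𝒜.empty_mem
    have hUO : ⋃₀ 𝓢 = ⋃ n, U n := by
      rw [← sUnion_range, ← hU, sUnion_union]
      simp
    rw [hUO, measure_iUnion_eq_iSup_accumulate, measure_iUnion_eq_iSup_accumulate]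
    refine iSup_mono fun n => ?_
    rw [Measure.restrict_apply' hCm, Measure.restrict_apply' hCm]
    refine hle _ (h𝒜.inter_mem ?_ hC)
    exact h𝒜.isSetRing.accumulate_mem hUm n
  refine Measure.le_iff.2 fun B _ => ?_
  rw [B.measure_eq_iInf_isOpen (χ'.restrict C)]
  exact le_iInf₂ fun O hBO => le_iInf fun hO => (measure_mono hBO).trans (hopen O hO)

/-- If `χ` is dominated by `χ'` on a countable algebra containing a base of the topology, then it
is dominated by a counting measure that coincides with `χ'` on the algebra: outside of the sets of
the algebra of finite measure, the points of `χ` may be added to `χ'`. -/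
lemma exists_countingMeasures_ge [Nonempty X] (h𝒜 : IsSetAlgebra 𝒜) (hcount : 𝒜.Countable)
    (hmeas : ∀ C ∈ 𝒜, MeasurableSet C) {𝓑 : Set (Set X)} (h𝓑 : 𝓑.Countable)
    (hbasis : TopologicalSpace.IsTopologicalBasis 𝓑) (h𝓑𝒜 : 𝓑 ⊆ 𝒜) {χ χ' : Measure X}
    (hχ : χ ∈ countingMeasures X) (hχ' : χ' ∈ countingMeasures X)
    (hle : ∀ C ∈ 𝒜, χ C ≤ χ' C) :
    ∃ χ'' ∈ countingMeasures X, χ ≤ χ'' ∧ ∀ C ∈ 𝒜, χ'' C = χ' C := by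
  obtain ⟨U, hU⟩ := (hcount.mono (sep_subset 𝒜 fun C => χ' C < ∞)).exists_eq_range
    ⟨∅, h𝒜.empty_mem, by simp⟩
  have hUm : ∀ n, U n ∈ 𝒜 ∧ χ' (U n) < ∞ := fun n => by
    have : U n ∈ {C ∈ 𝒜 | χ' C < ∞} := hU ▸ mem_range_self n
    exact this
  have hG : MeasurableSet (⋃ n, U n) := MeasurableSet.iUnion fun n => hmeas _ (hUm n).1
  refine ⟨χ' + χ.restrict (⋃ n, U n)ᶜ,
    add_mem_countingMeasures hχ' (restrict_mem_countingMeasures hχ hG.compl), ?_, fun C hC => ?_⟩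
  · have hfin : ∀ n, χ' (accumulate U n) < ∞ := fun n =>
      (measure_biUnion_lt_top (finite_Iic n) fun i _ => (hUm i).2)
    have hacc : ∀ n, accumulate U n ∈ 𝒜 := fun n =>
      h𝒜.isSetRing.accumulate_mem (fun i => (hUm i).1) n
    refine Measure.le_iff.2 fun B hB => ?_
    rw [← measure_inter_add_sdiff B hG, Measure.add_apply, Measure.restrict_apply hB,
      ← sdiff_eq_compl_inter.trans (inter_comm _ _)]
    refine add_le_add ?_ le_rfl
    rw [inter_comm, ← Measure.restrict_apply' hB, measure_iUnion_eq_iSup_accumulate]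
    refine iSup_le fun n => ?_
    have h1 := restrict_le_of_algebra h𝒜 h𝓑 hbasis h𝓑𝒜 hle (hacc n) (hmeas _ (hacc n)) (hfin n) B
    rw [Measure.restrict_apply hB, Measure.restrict_apply hB] at h1
    rw [Measure.restrict_apply' hB, inter_comm]
    exact h1.trans (measure_mono inter_subset_left)
  · rw [Measure.add_apply]
    rcases eq_top_or_lt_top (χ' C) with h | h
    · rw [h, top_add]
    · have hCU : C ⊆ ⋃ n, U n := by
        have hCr : C ∈ {C ∈ 𝒜 | χ' C < ∞} := ⟨hC, h⟩
        rw [hU] at hCr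
        obtain ⟨n, hn⟩ := hCr
        exact hn ▸ subset_iUnion U n
      rw [Measure.restrict_apply (hmeas C hC), (disjoint_compl_right_iff_subset.2 hCU).inter_eq]
      simp

end Algebra

/-- Measurable sets of measures depend on the values on countably many measurable sets only. -/
lemma exists_countable_evaluations {X : Type*} [MeasurableSpace X] {U : Set (Measure X)}
    (hU : MeasurableSet U) : ∃ 𝒞 : Set (Set X), 𝒞.Countable ∧ (∀ C ∈ 𝒞, MeasurableSet C) ∧
      ∃ T : Set (𝒞 → ℝ≥0∞), MeasurableSet T ∧ U = {χ | (fun C : 𝒞 => χ C) ∈ T} := by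
  let m : MeasurableSpace (Measure X) :=
    { MeasurableSet' := fun U => ∃ 𝒞 : Set (Set X), 𝒞.Countable ∧ (∀ C ∈ 𝒞, MeasurableSet C) ∧
        ∃ T : Set (𝒞 → ℝ≥0∞), MeasurableSet T ∧ U = {χ | (fun C : 𝒞 => χ C) ∈ T}
      measurableSet_empty := ⟨∅, countable_empty, by simp, ∅, .empty, by simp⟩
      measurableSet_compl := by
        rintro _ ⟨𝒞, h𝒞, hm, T, hT, rfl⟩
        exact ⟨𝒞, h𝒞, hm, Tᶜ, hT.compl, rfl⟩
      measurableSet_iUnion := by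
        intro f hf
        choose 𝒞 h𝒞 hm T hT hfT using hf
        refine ⟨⋃ n, 𝒞 n, countable_iUnion h𝒞, ?_,
          ⋃ n, (fun (w : (⋃ n, 𝒞 n : Set (Set X)) → ℝ≥0∞) (C : 𝒞 n) =>
            w ⟨C, mem_iUnion_of_mem n C.2⟩) ⁻¹' T n, ?_, ?_⟩
        · intro C hC
          obtain ⟨n, hn⟩ := mem_iUnion.1 hC
          exact hm n C hn
        · exact MeasurableSet.iUnion fun n => (hT n).preimage
            (measurable_pi_lambda _ fun C => measurable_pi_apply _)
        · ext χ
          simp only [mem_iUnion, mem_ofPred_eq, mem_preimage]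
          exact exists_congr fun n => by rw [hfT n]; rfl }
  have hle : Measure.instMeasurableSpace ≤ m := by
    refine iSup₂_le fun B hB => ?_
    rintro _ ⟨t, ht, rfl⟩
    refine ⟨{B}, countable_singleton B, by simpa using hB,
      {w | w ⟨B, mem_singleton B⟩ ∈ t}, ht.preimage (measurable_pi_apply _), rfl⟩
  exact hle U hU

/-! ### Reduction of stochastic domination to test functions -/

section Limit

open Filter Topology

/-- For a compact set `K` of sequences, neighbourhoods of the sequences that dominate some element
of `K`, in the first `m` coordinates. -/
def upperNhd (K : Set (ℕ → ℝ≥0∞)) (m : ℕ) : Set (ℕ → ℝ≥0∞) :=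
  {w | ∃ u ∈ K, ∀ i < m, min (u i) m < w i + (m : ℝ≥0∞)⁻¹}

lemma isOpen_upperNhd (K : Set (ℕ → ℝ≥0∞)) (m : ℕ) : IsOpen (upperNhd K m) := by
  have : upperNhd K m =
      ⋃ u ∈ K, ⋂ i ∈ Finset.range m, {w | min (u i) m < w i + (m : ℝ≥0∞)⁻¹} := by
    ext w
    simp [upperNhd]
  rw [this]
  refine isOpen_biUnion fun u _ => isOpen_biInter_finset fun i _ => ?_
  exact isOpen_lt continuous_const ((continuous_apply i).add continuous_const)

lemma upperNhd_upper {K : Set (ℕ → ℝ≥0∞)} {m : ℕ} {w w' : ℕ → ℝ≥0∞} (hw : w ∈ upperNhd K m)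
    (h : w ≤ w') : w' ∈ upperNhd K m := by
  obtain ⟨u, hu, hlt⟩ := hw
  exact ⟨u, hu, fun i hi => (hlt i hi).trans_le (add_le_add (h i) le_rfl)⟩

lemma antitone_upperNhd (K : Set (ℕ → ℝ≥0∞)) : Antitone fun m => upperNhd K (m + 1) := by
  refine antitone_nat_of_succ_le fun m w hw => ?_
  obtain ⟨u, hu, hlt⟩ := hw
  refine ⟨u, hu, fun i hi => lt_of_le_of_lt ?_ ((hlt i (by omega)).trans_le ?_)⟩
  · exact min_le_min le_rfl (by exact_mod_cast Nat.le_succ _)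
  · exact add_le_add le_rfl (ENNReal.inv_le_inv.2 (by exact_mod_cast Nat.le_succ _))

lemma subset_upperNhd (K : Set (ℕ → ℝ≥0∞)) (m : ℕ) : K ⊆ upperNhd K m := by
  refine fun u hu => ⟨u, hu, fun i _ => ?_⟩
  rcases eq_top_or_lt_top (u i) with h | h
  · rw [h, top_add]
    exact (min_le_right _ _).trans_lt (ENNReal.natCast_lt_top m)
  · exact (min_le_left _ _).trans_lt (ENNReal.lt_add_right h.ne (by simp))

/-- The neighbourhoods shrink to the sequences that dominate an element of `K`. -/
lemma exists_le_of_mem_upperNhd {K : Set (ℕ → ℝ≥0∞)} (hK : IsCompact K) {w : ℕ → ℝ≥0∞}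
    (hw : ∀ m, w ∈ upperNhd K (m + 1)) : ∃ u ∈ K, u ≤ w := by
  choose u hu hlt using hw
  obtain ⟨a, ha, φ, hφ, hlim⟩ := hK.tendsto_subseq hu
  refine ⟨a, ha, fun i => ?_⟩
  have h1 : Tendsto (fun n => u (φ n) i) atTop (𝓝 (a i)) :=
    ((continuous_apply i).tendsto a).comp hlim
  have h2 : Tendsto (fun n => ((φ n + 1 : ℕ) : ℝ≥0∞)) atTop (𝓝 ∞) :=
    ENNReal.tendsto_nat_nhds_top.comp ((tendsto_add_atTop_nat 1).comp hφ.tendsto_atTop)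
  have h3 : Tendsto (fun n => min (u (φ n) i) ((φ n + 1 : ℕ) : ℝ≥0∞)) atTop (𝓝 (a i)) := by
    simpa using h1.min h2
  have h4 : Tendsto (fun n => w i + ((φ n + 1 : ℕ) : ℝ≥0∞)⁻¹) atTop (𝓝 (w i)) := by
    simpa using tendsto_const_nhds.add (tendsto_inv_iff.2 h2)
  refine le_of_tendsto_of_tendsto h3 h4 ?_
  filter_upwards [eventually_ge_atTop i] with n hn
  exact (hlt (φ n) i (by have := hφ.id_le n; simp only [id] at this; omega)).le

/-- The event that the values on countably many sets lie in `upperNhd K m` has an admissible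
indicator, since it is increasing, and open as a condition on finitely many values. -/
lemma isTest_indicator_upperNhd {X : Type*} [MeasurableSpace X] {C : ℕ → Set X}
    (hC : ∀ i, MeasurableSet (C i)) (K : Set (ℕ → ℝ≥0∞)) (m : ℕ) :
    IsTest fun χ : Measure X =>
      (upperNhd K m).indicator (1 : (ℕ → ℝ≥0∞) → ℝ≥0∞) fun i => χ (C i) where
  measurable := (measurable_one.indicator (isOpen_upperNhd K m).measurableSet).comp
    (measurable_pi_lambda _ fun i => Measure.measurable_coe (hC i))
  mono χ χ' h := by
    by_cases hχ : (fun i => χ (C i)) ∈ upperNhd K m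
    · show (upperNhd K m).indicator 1 _ ≤ (upperNhd K m).indicator 1 _
      rw [indicator_of_mem hχ, indicator_of_mem (upperNhd_upper hχ fun i => h _)]
      exact le_rfl
    · show (upperNhd K m).indicator 1 _ ≤ _
      rw [indicator_of_notMem hχ]
      exact zero_le
  le_iSup χ χ' hmono h := by
    by_cases hχ : (fun i => χ' (C i)) ∈ upperNhd K m
    · obtain ⟨u, hu, hlt⟩ := hχ
      have h1 : ∀ i < m, ∀ᶠ n in atTop, min (u i) m < χ n (C i) + (m : ℝ≥0∞)⁻¹ := fun i hi => by
        have ht : Tendsto (fun n => χ n (C i) + (m : ℝ≥0∞)⁻¹) atTop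
            (𝓝 (χ' (C i) + (m : ℝ≥0∞)⁻¹)) := by
          rw [h _ (hC i)]
          exact (tendsto_atTop_iSup fun a b hab => hmono hab _).add tendsto_const_nhds
        exact ht.eventually (lt_mem_nhds (hlt i hi))
      have h2 : ∀ᶠ n in atTop, ∀ i ∈ Finset.range m, min (u i) m < χ n (C i) + (m : ℝ≥0∞)⁻¹ :=
        (Finset.eventually_all _).2 fun i hi => h1 i (Finset.mem_range.1 hi)
      obtain ⟨n, hn⟩ := h2.exists
      have hmem : (fun i => χ n (C i)) ∈ upperNhd K m :=
        ⟨u, hu, fun i hi => hn i (Finset.mem_range.2 hi)⟩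
      refine le_iSup_of_le n ?_
      rw [indicator_of_mem hmem]
      exact indicator_le_self' (fun _ _ => zero_le) _
    · rw [indicator_of_notMem hχ]
      exact zero_le

variable {X : Type*} [TopologicalSpace X] [PolishSpace X] [MeasurableSpace X] [BorelSpace X]
  [Nonempty X] {Ω Ω' : Type*} [MeasurableSpace Ω] [MeasurableSpace Ω'] {P : Measure Ω}
  {Q : Measure Ω'} [IsFiniteMeasure P] [IsFiniteMeasure Q] {x : Ω → ℕ → X} {S : Ω → Set ℕ}
  {W : Ω' → Measure X}

/-- Domination with respect to test functions implies the domination of the probabilities of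
increasing events. -/
theorem measure_le_of_isTest (hx : Measurable x) (hS : Measurable S) (hW : Measurable W)
    (hWc : ∀ ω, W ω ∈ countingMeasures X)
    (hle : ∀ f, IsTest f → ∫⁻ ω, f (cnt (x ω) (S ω)) ∂P ≤ ∫⁻ ω, f (W ω) ∂Q)
    {U : Set (Measure X)} (hU : MeasurableSet U) (hup : ∀ χ ∈ countingMeasures X, χ ∈ U →
      ∀ χ' ∈ countingMeasures X, χ ≤ χ' → χ' ∈ U) :
    P {ω | cnt (x ω) (S ω) ∈ U} ≤ Q {ω | W ω ∈ U} := by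
  classical
  obtain ⟨𝒞, h𝒞, h𝒞m, T, hT, hUT⟩ := exists_countable_evaluations hU
  -- A countable algebra which generates the topology and determines `U`.
  let 𝓑 := TopologicalSpace.countableBasis X
  let 𝒜 : Set (Set X) := generateSetAlgebra (𝒞 ∪ 𝓑)
  have h𝒜 : IsSetAlgebra 𝒜 := isSetAlgebra_generateSetAlgebra
  have h𝒜c : 𝒜.Countable :=
    countable_generateSetAlgebra (h𝒞.union (TopologicalSpace.countable_countableBasis X))
  have h𝒞𝒜 : 𝒞 ⊆ 𝒜 := subset_union_left.trans self_subset_generateSetAlgebra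
  have h𝓑𝒜 : 𝓑 ⊆ 𝒜 := subset_union_right.trans self_subset_generateSetAlgebra
  have h𝒜m : ∀ C ∈ 𝒜, MeasurableSet C := fun C hC => by
    induction hC with
    | base s hs =>
      rcases hs with hs | hs
      · exact h𝒞m s hs
      · exact (TopologicalSpace.isOpen_of_mem_countableBasis hs).measurableSet
    | empty => exact .empty
    | compl s _ ih => exact ih.compl
    | union s t _ _ ihs iht => exact ihs.union iht
  obtain ⟨C, hC⟩ := h𝒜c.exists_eq_range ⟨∅, h𝒜.empty_mem⟩
  have hCm : ∀ i, MeasurableSet (C i) := fun i => h𝒜m _ (hC ▸ mem_range_self i)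
  have hval : ∀ {χ χ' : Measure X}, (∀ i, χ (C i) = χ' (C i)) → (χ ∈ U ↔ χ' ∈ U) :=
    fun {χ χ'} h => by
      have : ∀ B : 𝒞, χ B = χ' B := fun B => by
        obtain ⟨i, hi⟩ : (B : Set X) ∈ range C := hC ▸ h𝒞𝒜 B.2
        rw [← hi, h i]
      rw [hUT]
      simp only [mem_ofPred_eq, this]
  -- The joint law of the enumerated points and the values on the algebra.
  let M : (ℕ → Bool) × (ℕ → X) → Measure X := fun p => cnt p.2 {n | p.1 n = true}
  have hM : Measurable M := measurable_cnt measurable_snd (measurable_set_iff.2 fun n =>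
    measurableSet_setOfPred.1 ((show Measurable fun p : (ℕ → Bool) × (ℕ → X) => p.1 n from
      (measurable_pi_apply n).comp measurable_fst) (measurableSet_singleton true)))
  let Γ : Set (((ℕ → Bool) × (ℕ → X)) × (ℕ → ℝ≥0∞)) :=
    {q | M q.1 ∈ U ∧ ∀ i, q.2 i = M q.1 (C i)}
  have hΓ : MeasurableSet Γ := by
    refine ((hM.comp measurable_fst) hU).inter ?_
    have : {q : ((ℕ → Bool) × (ℕ → X)) × (ℕ → ℝ≥0∞) | ∀ i, q.2 i = M q.1 (C i)} =
        ⋂ i, {q | q.2 i = M q.1 (C i)} := by ext; simp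
    show MeasurableSet {q : ((ℕ → Bool) × (ℕ → X)) × (ℕ → ℝ≥0∞) | ∀ i, q.2 i = M q.1 (C i)}
    rw [this]
    exact MeasurableSet.iInter fun i => measurableSet_eq_fun
      ((measurable_pi_apply i).comp measurable_snd)
      ((Measure.measurable_coe (hCm i)).comp (hM.comp measurable_fst))
  let ζ : Ω → ((ℕ → Bool) × (ℕ → X)) × (ℕ → ℝ≥0∞) := fun ω =>
    ((fun n => decide (n ∈ S ω), x ω), fun i => cnt (x ω) (S ω) (C i))
  have hζM : ∀ ω, M (ζ ω).1 = cnt (x ω) (S ω) := fun ω => by simp [M, ζ]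
  have hζ : Measurable ζ := by
    refine (Measurable.prodMk (measurable_pi_lambda _ fun n => ?_) hx).prodMk
      (measurable_pi_lambda _ fun i => (Measure.measurable_coe (hCm i)).comp (measurable_cnt hx hS))
    have hn := measurableSet_setOfPred.2 (measurable_set_iff.1 hS n)
    refine measurable_to_bool ?_
    convert hn using 1
    ext ω
    simp
  have hev : P {ω | cnt (x ω) (S ω) ∈ U} = P.map ζ Γ := by
    rw [Measure.map_apply hζ hΓ]
    congr 1
    ext ω
    show _ ↔ M (ζ ω).1 ∈ U ∧ ∀ i, (ζ ω).2 i = M (ζ ω).1 (C i)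
    rw [hζM]
    simp [ζ]
  refine ENNReal.le_of_forall_pos_le_add fun ε hε _ => ?_
  -- Up to `ε`, the event is carried by a compact set, whose projection to the values is compact.
  obtain ⟨K, hKΓ, hK, hPK⟩ := hΓ.exists_isCompact_lt_add (μ := P.map ζ) (measure_ne_top _ _)
    (ENNReal.coe_ne_zero.2 hε.ne')
  let K' : Set (ℕ → ℝ≥0∞) := Prod.snd '' K
  have hK' : IsCompact K' := hK.image continuous_snd
  have hKP : P.map ζ K ≤ P {ω | (fun i => cnt (x ω) (S ω) (C i)) ∈ K'} := by
    rw [Measure.map_apply hζ hK.measurableSet]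
    exact measure_mono fun ω hω => ⟨ζ ω, hω, rfl⟩
  have hVm : Measurable fun ω => fun i => cnt (x ω) (S ω) (C i) :=
    measurable_pi_lambda _ fun i => (Measure.measurable_coe (hCm i)).comp (measurable_cnt hx hS)
  have hWm : Measurable fun ω => fun i => W ω (C i) :=
    measurable_pi_lambda _ fun i => (Measure.measurable_coe (hCm i)).comp hW
  have hOm : ∀ m, MeasurableSet (upperNhd K' m) := fun m => (isOpen_upperNhd K' m).measurableSet
  have hstep : ∀ m, P {ω | (fun i => cnt (x ω) (S ω) (C i)) ∈ K'} ≤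
      Q {ω | (fun i => W ω (C i)) ∈ upperNhd K' (m + 1)} := fun m => by
    have h1 := hle _ (isTest_indicator_upperNhd hCm K' (m + 1))
    have h2 : ∫⁻ ω, (upperNhd K' (m + 1)).indicator (1 : (ℕ → ℝ≥0∞) → ℝ≥0∞)
        (fun i => cnt (x ω) (S ω) (C i)) ∂P =
        P {ω | (fun i => cnt (x ω) (S ω) (C i)) ∈ upperNhd K' (m + 1)} :=
      lintegral_indicator_one (hVm (hOm _))
    have h3 : ∫⁻ ω, (upperNhd K' (m + 1)).indicator (1 : (ℕ → ℝ≥0∞) → ℝ≥0∞)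
        (fun i => W ω (C i)) ∂Q = Q {ω | (fun i => W ω (C i)) ∈ upperNhd K' (m + 1)} :=
      lintegral_indicator_one (hWm (hOm _))
    rw [h2, h3] at h1
    have hsub : {ω | (fun i => cnt (x ω) (S ω) (C i)) ∈ K'} ⊆
        {ω | (fun i => cnt (x ω) (S ω) (C i)) ∈ upperNhd K' (m + 1)} := fun ω hω =>
      subset_upperNhd K' _ hω
    exact (measure_mono hsub).trans h1
  -- Values of `W` that dominate those of a counting measure in `U` force `W` into `U`.
  have hinter : ⋂ m : ℕ, {ω | (fun i => W ω (C i)) ∈ upperNhd K' (m + 1)} ⊆ {ω | W ω ∈ U} := by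
    intro ω hω
    obtain ⟨u, ⟨q, hq, rfl⟩, hqw⟩ := exists_le_of_mem_upperNhd hK'
      (w := fun i => W ω (C i)) fun m => mem_iInter.1 hω m
    obtain ⟨hqU, hqv⟩ := hKΓ hq
    have hcm : M q.1 ∈ countingMeasures X := cnt_mem_countingMeasures _ _
    obtain ⟨χ, hχc, hχ1, hχ2⟩ := exists_countingMeasures_ge h𝒜 h𝒜c h𝒜m
      (TopologicalSpace.countable_countableBasis X) (TopologicalSpace.isBasis_countableBasis X)
      h𝓑𝒜 hcm (hWc ω) (fun B hB => by
        obtain ⟨i, hi⟩ : B ∈ range C := hC ▸ hB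
        rw [← hi, ← hqv i]
        exact hqw i)
    exact (hval fun i => hχ2 _ (hC ▸ mem_range_self i)).1 (hup _ hcm hqU χ hχc hχ1)
  calc P {ω | cnt (x ω) (S ω) ∈ U} ≤ P.map ζ K + ε := hev ▸ hPK.le
    _ ≤ (⨅ m : ℕ, Q {ω | (fun i => W ω (C i)) ∈ upperNhd K' (m + 1)}) + ε :=
      add_le_add (hKP.trans (le_iInf hstep)) le_rfl
    _ = Q (⋂ m : ℕ, {ω | (fun i => W ω (C i)) ∈ upperNhd K' (m + 1)}) + ε := by
      have hanti : Antitone fun m : ℕ => {ω | (fun i => W ω (C i)) ∈ upperNhd K' (m + 1)} :=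
        fun m n hmn ω hω => antitone_upperNhd K' hmn hω
      rw [hanti.measure_iInter (fun m => (hWm (hOm _)).nullMeasurableSet) ⟨0, measure_ne_top _ _⟩]
    _ ≤ Q {ω | W ω ∈ U} + ε := add_le_add (measure_mono hinter) le_rfl

/-- The layer-cake formula; unlike the version in terms of real-valued functions, it allows the
value `∞`. -/
lemma lintegral_eq_lintegral_measure_lt {Ω : Type*} [MeasurableSpace Ω] (P : Measure Ω) [SFinite P]
    {f : Ω → ℝ≥0∞} (hf : Measurable f) :
    ∫⁻ ω, f ω ∂P = ∫⁻ t in Ioi (0 : ℝ), P {ω | ENNReal.ofReal t < f ω} := by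
  have hm : MeasurableSet {p : Ω × ℝ | ENNReal.ofReal p.2 < f p.1} :=
    measurableSet_lt (ENNReal.measurable_ofReal.comp measurable_snd) (hf.comp measurable_fst)
  have h1 : ∀ ω, f ω = ∫⁻ t in Ioi (0 : ℝ),
      {p : Ω × ℝ | ENNReal.ofReal p.2 < f p.1}.indicator 1 (ω, t) := fun ω => by
    have hm' : MeasurableSet {t : ℝ | ENNReal.ofReal t < f ω} :=
      measurableSet_lt ENNReal.measurable_ofReal measurable_const
    have e : ∫⁻ t in Ioi (0 : ℝ), {p : Ω × ℝ | ENNReal.ofReal p.2 < f p.1}.indicator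
        (1 : Ω × ℝ → ℝ≥0∞) (ω, t) = volume.restrict (Ioi (0 : ℝ)) {t | ENNReal.ofReal t < f ω} :=
      lintegral_indicator_one hm'
    rw [e, Measure.restrict_apply hm']
    rcases eq_top_or_lt_top (f ω) with h | h
    · simp [h]
    · have : {t : ℝ | ENNReal.ofReal t < f ω} ∩ Ioi 0 = Ioo 0 (f ω).toReal := by
        ext t
        simp only [mem_inter_iff, mem_ofPred_eq, mem_Ioi, mem_Ioo]
        rw [and_comm]
        refine and_congr_right fun ht => ?_
        rw [ENNReal.ofReal_lt_iff_lt_toReal ht.le h.ne]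
      rw [this, Real.volume_Ioo, sub_zero, ENNReal.ofReal_toReal h.ne]
  rw [lintegral_congr h1, lintegral_lintegral_swap]
  · refine lintegral_congr fun t => ?_
    have hmt : MeasurableSet {ω | ENNReal.ofReal t < f ω} := measurableSet_lt measurable_const hf
    exact lintegral_indicator_one hmt
  · exact (measurable_one.indicator hm).aemeasurable

/-- Domination with respect to test functions implies stochastic domination. -/
theorem lintegral_le_of_isTest (hx : Measurable x) (hS : Measurable S) (hW : Measurable W)
    (hWc : ∀ ω, W ω ∈ countingMeasures X)
    (hle : ∀ f, IsTest f → ∫⁻ ω, f (cnt (x ω) (S ω)) ∂P ≤ ∫⁻ ω, f (W ω) ∂Q)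
    {f : Measure X → ℝ≥0∞} (hf : Measurable f) (hmono : MonotoneOn f (countingMeasures X)) :
    ∫⁻ ω, f (cnt (x ω) (S ω)) ∂P ≤ ∫⁻ ω, f (W ω) ∂Q := by
  rw [lintegral_eq_lintegral_measure_lt P (f := fun ω => f (cnt (x ω) (S ω)))
      (hf.comp (measurable_cnt hx hS)),
    lintegral_eq_lintegral_measure_lt Q (f := fun ω => f (W ω)) (hf.comp hW)]
  refine lintegral_mono fun t => ?_
  exact measure_le_of_isTest hx hS hW hWc hle (U := {χ | ENNReal.ofReal t < f χ})
    (measurableSet_lt measurable_const hf)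
    fun χ hχ hχU χ' hχ' hle => lt_of_lt_of_le hχU (hmono hχ hχ' hle)

end Limit

/-! ### Stochastic domination of the clusters -/

section Domination

open Branching

variable {X : Type u} [MeasurableSpace X] {phi : X → X → ℝ} {h : X → ℕ}

lemma Config.clusterLE'_mem_countingMeasures (phi : X → X → ℝ) (x : X) (c : Config X) (n : ℕ) :
    c.clusterLE' phi x n ∈ countingMeasures X := cnt_mem_countingMeasures _ _

lemma Branching.Wtilde_mem_countingMeasures (phi : X → X → ℝ) (h : X → ℕ) (v : X)
    (b : List ℕ → Config X) (k : ℕ) : Wtilde phi h v b k ∈ countingMeasures X := by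
  have : Nonempty X := ⟨v⟩
  cases k with
  | zero =>
    show Measure.dirac v ∈ _
    rw [← cnt_singleton (fun _ => v) 0]
    exact cnt_mem_countingMeasures _ _
  | succ k =>
    exact sum_mem_countingMeasures fun u => Config.clusterLE'_mem_countingMeasures _ _ _ _

lemma Branching.WtildeTotal_mem_countingMeasures (phi : X → X → ℝ) (h : X → ℕ) (v : X)
    (b : List ℕ → Config X) : WtildeTotal phi h v b ∈ countingMeasures X :=
  have : Nonempty X := ⟨v⟩
  sum_mem_countingMeasures fun k => Wtilde_mem_countingMeasures phi h v b k

lemma Branching.WtildeLE_mem_countingMeasures (phi : X → X → ℝ) (h : X → ℕ) (v : X)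
    (b : List ℕ → Config X) (k : ℕ) : WtildeLE phi h v b k ∈ countingMeasures X := by
  have : Nonempty X := ⟨v⟩
  refine Finset.sum_induction _ (· ∈ countingMeasures X)
    (fun _ _ => add_mem_countingMeasures) ?_ fun i _ => Wtilde_mem_countingMeasures phi h v b i
  rw [← cnt_empty fun _ => v]
  exact cnt_mem_countingMeasures _ _

lemma Branching.WtildeLE_le_WtildeTotal (v : X) (b : List ℕ → Config X) (k : ℕ) :
    WtildeLE phi h v b k ≤ WtildeTotal phi h v b := by
  refine Measure.le_iff.2 fun B hB => ?_
  rw [WtildeLE, WtildeTotal, Measure.finsetSum_apply, Measure.sum_apply _ hB]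
  exact ENNReal.sum_le_tsum _

variable {lam : Measure X} [SigmaFinite lam] {Ω Ω' : Type*} [MeasurableSpace Ω]
  [MeasurableSpace Ω'] {P : Measure Ω} [IsProbabilityMeasure P] {c : Ω → Config X}
  {Q : Measure Ω'} [IsProbabilityMeasure Q] {b : List ℕ → Ω' → Config X}

/-- The comparison of balls with the branching process, for test functions. -/
lemma lintegral_clusterLE_le (hphi : Measurable fun p : X × X => phi p.1 p.2)
    (hsymm : ∀ x y, phi x y = phi y x) (hunit : ∀ x y, phi x y ∈ Icc (0 : ℝ) 1)
    (hc : IsRCM lam P c) (hb : IsBranchingInput lam Q b) (hh : Measurable h) {n : ℕ} (hn : 1 ≤ n)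
    (hnh : ∀ x, n ≤ h x) (v : X) (k : ℕ) {f : Measure X → ℝ≥0∞} (hf : IsTest f) :
    ∫⁻ ω, f ((c ω).clusterLE phi v (k * n)) ∂P ≤
      ∫⁻ ω, f (WtildeLE phi h v (fun u => b u ω) k) ∂Q := by
  have hμ := hc.isRCMLaw
  have hν : ∀ u, IsRCMLaw lam (Q.map (b u)) := fun u => (hb.rcm u).isRCMLaw
  have : ∀ u, IsProbabilityMeasure (Q.map (b u)) := fun u => (hν u).prob
  have hbm : Measurable fun ω => fun u => b u ω :=
    measurable_pi_lambda _ fun u => (hb.rcm u).measurable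
  have hlaw : Q.map (fun ω => fun u => b u ω) = Measure.infinitePi fun u => Q.map (b u) :=
    (iIndepFun_iff_map_fun_eq_infinitePi_map fun u => (hb.rcm u).measurable).1 hb.indep
  have hfc : Measurable fun c : Config X => f (c.clusterLE phi v (k * n)) :=
    hf.measurable.comp (Config.measurable_clusterLE hphi measurable_const measurable_id _)
  have hfb : Measurable fun b : List ℕ → Config X =>
      f (Measure.dirac v + progeny phi h k v b) :=
    hf.measurable.comp (measurable_const.add
      (measurable_progeny hphi hh measurable_const measurable_id k))
  calc ∫⁻ ω, f ((c ω).clusterLE phi v (k * n)) ∂P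
      = ∫⁻ c, f (c.clusterLE phi v (k * n)) ∂P.map c := (lintegral_map hfc hc.measurable).symm
    _ = growth phi (P.map c) f (k * n) 1 (avoid lam phi (Measure.dirac v)) (Measure.dirac v) :=
      lintegral_congr_ae (hμ.ae_marks_le.mono fun c hc => by
        show f _ = f _
        rw [Config.clusterLE_eq, Config.clusterLE'_eq lam hphi hsymm hunit v hc])
    _ ≤ ∫⁻ b, f (Measure.dirac v + progeny phi h k v b) ∂Measure.infinitePi fun u => Q.map (b u) :=
      hμ.growth_le_progeny hphi hsymm hunit hh hn hnh k _ hν v f hf _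
    _ = ∫⁻ ω, f (WtildeLE phi h v (fun u => b u ω) k) ∂Q := by
      rw [← hlaw, lintegral_map hfb hbm]
      simp only [WtildeLE_eq]

variable [TopologicalSpace X] [PolishSpace X] [BorelSpace X]

/-- Balls of radius `k * n` are dominated by `k` generations of the branching process. -/
lemma stochLE_clusterLE (hphi : Measurable fun p : X × X => phi p.1 p.2)
    (hsymm : ∀ x y, phi x y = phi y x) (hunit : ∀ x y, phi x y ∈ Icc (0 : ℝ) 1)
    (hc : IsRCM lam P c) (hb : IsBranchingInput lam Q b) (hh : Measurable h) {n : ℕ} (hn : 1 ≤ n)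
    (hnh : ∀ x, n ≤ h x) (v : X) (k : ℕ) :
    StochLE P Q (fun ω => (c ω).clusterLE phi v (k * n))
      (fun ω => WtildeLE phi h v (fun u => b u ω) k) := by
  have : Nonempty X := ⟨v⟩
  have hbm : Measurable fun ω => fun u => b u ω :=
    measurable_pi_lambda _ fun u => (hb.rcm u).measurable
  have hW : Measurable fun ω => WtildeLE phi h v (fun u => b u ω) k :=
    Finset.measurable_sum _ fun i _ => measurable_Wtilde hphi hh measurable_const hbm i
  refine ⟨Config.measurable_clusterLE hphi measurable_const hc.measurable _, hW,
    fun f hf hmono => ?_⟩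
  exact lintegral_le_of_isTest (Config.measurable_loc measurable_const hc.measurable)
    (measurable_set_iff.2 (Config.measurable_edist_le hphi measurable_const hc.measurable (k * n)))
    hW (fun ω => WtildeLE_mem_countingMeasures _ _ _ _ _)
    (fun g hg => lintegral_clusterLE_le hphi hsymm hunit hc hb hh hn hnh v k hg) hf hmono

/-- The cluster is the union of the balls with radii `t * 1`, each of which is dominated by `t`
generations of the branching process. -/
lemma stochLE_cluster (hphi : Measurable fun p : X × X => phi p.1 p.2)
    (hsymm : ∀ x y, phi x y = phi y x) (hunit : ∀ x y, phi x y ∈ Icc (0 : ℝ) 1)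
    (hc : IsRCM lam P c) (hb : IsBranchingInput lam Q b) (hh : Measurable h)
    (hh1 : ∀ x, 1 ≤ h x) (v : X) :
    StochLE P Q (fun ω => (c ω).cluster phi v)
      (fun ω => WtildeTotal phi h v (fun u => b u ω)) := by
  have : Nonempty X := ⟨v⟩
  have hbm : Measurable fun ω => fun u => b u ω :=
    measurable_pi_lambda _ fun u => (hb.rcm u).measurable
  have hW : Measurable fun ω => WtildeTotal phi h v (fun u => b u ω) := by
    refine Measure.measurable_of_measurable_coe _ fun B hB => ?_
    simp_rw [WtildeTotal, Measure.sum_apply _ hB]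
    exact Measurable.tsum fun i => (Measure.measurable_coe hB).comp
      (measurable_Wtilde hphi hh measurable_const hbm i)
  have hloc := Config.measurable_loc (measurable_const (a := v)) hc.measurable
  have hS : Measurable fun ω => {m | ((c ω).graph phi v).Reachable 0 m} :=
    measurable_set_iff.2 fun m => by
      simp only [mem_ofPred_eq, Config.reachable_iff]
      exact Measurable.exists fun n =>
        Config.measurable_edist_le hphi measurable_const hc.measurable n m
  refine ⟨measurable_cnt hloc hS, hW, fun f hf hmono => ?_⟩
  refine lintegral_le_of_isTest hloc hS hW (fun ω => WtildeTotal_mem_countingMeasures _ _ _ _)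
    (fun g hg => ?_) hf hmono
  have hballs : ∀ ω, Monotone fun t : ℕ => {m | ((c ω).graph phi v).edist 0 m ≤ t} :=
    fun ω s t hst m hm =>
      (show ((c ω).graph phi v).edist 0 m ≤ s from hm).trans (Nat.cast_le.2 hst)
  calc ∫⁻ ω, g ((c ω).cluster phi v) ∂P
      ≤ ∫⁻ ω, ⨆ t : ℕ, g ((c ω).clusterLE phi v t) ∂P := lintegral_mono fun ω => by
        rw [Config.cluster_eq_iUnion]
        have := hg.add_iUnion_le 0 ((c ω).loc v) (hballs ω)
        simp only [zero_add] at this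
        exact this
    _ = ⨆ t : ℕ, ∫⁻ ω, g ((c ω).clusterLE phi v t) ∂P :=
      lintegral_iSup (fun t => hg.measurable.comp
        (Config.measurable_clusterLE hphi measurable_const hc.measurable t))
        fun s t hst ω => hg.mono (cnt_mono _ (hballs ω hst))
    _ ≤ ∫⁻ ω, g (WtildeTotal phi h v (fun u => b u ω)) ∂Q := iSup_le fun t => by
      have := lintegral_clusterLE_le hphi hsymm hunit hc hb hh le_rfl hh1 v t hg
      rw [mul_one] at this
      exact this.trans (lintegral_mono fun ω => hg.mono (WtildeLE_le_WtildeTotal v _ t))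

end Domination

end

theorem proposition5 {X : Type*} [MetricSpace X] [CompleteSpace X]
    [TopologicalSpace.SeparableSpace X] [MeasurableSpace X] [BorelSpace X]
    (lam : Measure X) [IsLocallyFiniteMeasure lam] [NullSingletonClass lam]
    (phi : X → X → ℝ) (hphi : IsConnectionFunction lam phi) (v : X)
    {Ω : Type*} [MeasurableSpace Ω] (P : Measure Ω) [IsProbabilityMeasure P]
    (c : Ω → Config X) (hc : IsRCM lam P c)
    {Ω' : Type*} [MeasurableSpace Ω'] (Q : Measure Ω') [IsProbabilityMeasure Q]
    (b : List ℕ → Ω' → Config X) (hb : IsBranchingInput lam Q b) :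
    (∀ h : X → ℕ, Measurable h → (∀ x, 1 ≤ h x) →
      StochLE P Q (fun ω => (c ω).cluster phi v)
        (fun ω => Branching.WtildeTotal phi h v (fun u => b u ω))) ∧
    (∀ n : ℕ, 1 ≤ n →
      StochLE P Q (fun ω => (c ω).cluster phi v)
        (fun ω => Branching.WtildeTotal phi (fun _ => n) v (fun u => b u ω))) ∧
    (∀ n k : ℕ, 1 ≤ n → 1 ≤ k →
      StochLE P Q (fun ω => (c ω).clusterLE phi v (k * n))
        (fun ω => Branching.WtildeLE phi (fun _ => n) v (fun u => b u ω) k)) := by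
  have := UniformSpace.secondCountable_of_separable X
  refine ⟨fun h hh hh1 => ?_, fun n hn => ?_, fun n k hn _ => ?_⟩
  · exact stochLE_cluster hphi.measurable hphi.symm hphi.mem_unit hc hb hh hh1 v
  · exact stochLE_cluster hphi.measurable hphi.symm hphi.mem_unit hc hb measurable_const
      (fun _ => hn) v
  · exact stochLE_clusterLE hphi.measurable hphi.symm hphi.mem_unit hc hb measurable_const hn
      (fun _ => le_rfl) v k
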